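/- **Model.** $P$ processors, numbered $0,\dots,P-1$, each with a private memory of $M$ words, exchange point-to-point messages of arbitrary length. A word stores one base-$s$ digit, $s\ge 2$. The elementary operations of a processor are the product or the sum of single digits (and carries), the extraction of the least or the most significant base-$s$ digit of such a value, and comparison of a digit with $0$; local data movement is free. Sending or receiving a message occupies both processors involved. The computation time $T$, the bandwidth cost $BW$ and the latency $L$ of an execution are, respectively, the largest numbers of elementary operations, of words exchanged and of messages exchanged along a chain of dependent events of the execution (critical path). An integer is *partitioned in $w$ digits* in a sequence of processors $\mathbf P=(\mathbf P[0],\mathbf P[1],\dots)$ if $\mathbf P[j]$ stores its digits number $jw,\dots,(j+1)w-1$, counted from the least significant one. **Algorithm.** COPSIM multiplies two $n$-digit integers partitioned in $n/P$ digits in a sequence of $P$ processors, where $n$ is a power of two and $P$ is a power of four, $n\ge P$. Write $A=A_0+s^{n/2}A_1$, $B=B_0+s^{n/2}B_1$, so that $AB=A_0B_0+s^{n/2}(A_0B_1+A_1B_0)+s^nA_1B_1$. * *Memory-independent mode* ($\mathrm{COPSIM}_{MI}$). If $P=1$, the product is computed locally by recursive long multiplication (four half-size products, then additions). If $P>1$,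 the four products $A_iB_j$ are computed recursively and in parallel, by the even- and the odd-index processors of the first half and of the second half of the sequence ($P/4$ processors each), after their inputs have been sent to them in three parallel communication steps. In five further parallel communication steps $A_0B_0$ is moved to the first half, $A_0B_1$ and $A_1B_0$ to the middle half, and $A_1B_1$ to the second half of the sequence, in $2n/P$ digits each; then they are added by three calls of SUM, operands being padded with zero digits. * *SUM* adds two integers partitioned in a sequence of processors: each half of the sequence recursively and in parallel adds its part of the operands, where every part but the least significant one is added speculatively for both values of the incoming carry; the processors of the lower half then send their outgoing carries to those of the upper half, which select the right result and send back the new outgoing carries. * *COPSIM*. With $M$ words of memory available per processor: if $M\ge 12n/\sqrt P$, run $\mathrm{COPSIM}_{MI}$. Otherwise perform a *depth-first step*: compute the four products $A_iB_j$ one after the other, each by a recursive call of COPSIM on all $P$ processors with $M-20n/P$ words available, after redistributing the inputs among the processors; move each product as above, and add them by three calls of SUM. **Theorem.** Let $s\ge2$, let $n$ be a power of two and $P$ a power of four with $P\le n$, and let $A,B$ be two $n$-digit nonnegative integers in base $s$ (i.e. $0\le A,B<s^n$), partitioned in $n/P$ digits among the $P$ processors. Assume that $$M\ \ge\ \max\Big\{\frac{80\,n}{P},\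 \log_2P\Big\},$$ and, in case that $M<12n/\sqrt P$ (when depth-first steps occur), also that $M\ge 24\sqrt P$. Put $M_0=\min\{M,\,12n/\sqrt P\}$. Then COPSIM runs within $M$ words of local memory on each processor, at its end the product $C=A\times B$ is partitioned in $2n/P$ digits among the $P$ processors, and $$T\le 196\,\frac{n^2}{P},\qquad BW\le 3530\,\frac{n^2}{M_0P},\qquad L\le 7012\,\frac{n^2\log_2^2P}{M_0^2P}.$$ In particular, for $M\le 12n/\sqrt P$ one has $BW\le 3530\,n^2/(MP)$ and $L\le 7012\,n^2\log_2^2P/(M^2P)$. -/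

import Mathlib

/-!
# A distributed-memory machine and the algorithm COPSIM

`P` processors, numbered `0, …, P - 1`, each with a private memory of `M` words, exchange
point-to-point messages.  A word holds one base-`s` digit.  Programs are straight-line lists of
instructions; an instruction acts on one processor, or sends one message between two of them.
-/

namespace Copsim

/-- Names of the variables of a processor.  A variable holds a string of base-`s` digits, least
significant digit first, each digit occupying one word.  `A d`, `B d`, `C d` and `Q i d` are the
inputs, the output and the four sub-products of the invocation at recursion depth `d`;
the others are temporaries of the additions. -/
inductive Var
  | A (d : ℕ)
  | B (d : ℕ)
  | C (d : ℕ)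
  | Q (i d : ℕ)
  | S0
  | S1
  | U0
  | U1
  | R0
  | R1
  | Z
  deriving DecidableEq

/-- One part of a message: `len` digits of the sender's variable `src`, from position `start` on,
to be appended to the receiver's variable `dst`. -/
structure Part where
  src : Var
  start : ℕ
  len : ℕ
  dst : Var

/-- The instructions.  Except for `send`, all of them are local to the processor `p`. -/
inductive Instr
  /-- append the constant digits `l` to `x` -/
  | put (p : ℕ) (x : Var) (l : List ℕ)
  /-- release the memory occupied by `x` -/
  | clear (p : ℕ) (x : Var)
  /-- append `len` digits of `x`, from position `start` on, to `y` -/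
  | copy (p : ℕ) (x : Var) (start len : ℕ) (y : Var)
  /-- rename `x` to `y` -/
  | move (p : ℕ) (x y : Var)
  /-- store the two digits of the product of the first digits of `x` and `y` in `z` -/
  | mul (p : ℕ) (x y z : Var)
  /-- form the sum of the digit `i` of `x`, the digit `j` of `y` and the carry `c`; append its least
  significant digit to `z` and keep its most significant digit in `c` -/
  | add (p : ℕ) (x : Var) (i : ℕ) (y : Var) (j : ℕ) (c z : Var)
  /-- let `z` be `x` if the flag `f` is `0`, and `y` otherwise -/
  | sel (p : ℕ) (f x y z : Var)
  /-- send one message from `p` to `q` -/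
  | send (p q : ℕ) (parts : List Part)

/-- The memory of all processors, and three clocks for every processor: `ops p`, `words p` and
`msgs p` are the largest numbers of digit operations, of words exchanged and of messages exchanged
along a chain of dependent events of the execution that ends at `p`. -/
structure Config where
  mem : ℕ → Var → List ℕ
  ops : ℕ → ℕ
  words : ℕ → ℕ
  msgs : ℕ → ℕ

/-- `len` entries of `l`, from position `start` on. -/
def slice (l : List ℕ) (start len : ℕ) : List ℕ := (l.drop start).take len

namespace Config

/-- Overwrite the variable `x` of the processor `p`. -/
def write (c : Config) (p : ℕ) (x : Var) (l : List ℕ) : Config :=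
  { c with mem := Function.update c.mem p (Function.update (c.mem p) x l) }

/-- Account for `t` elementary digit operations of the processor `p`. -/
def charge (c : Config) (p t : ℕ) : Config :=
  { c with ops := Function.update c.ops p (c.ops p + t) }

/-- The two processors that exchange a message of `k` words meet: both clocks of each metric
become the later one, plus the cost of the message. -/
def meet (c : Config) (p q k : ℕ) : Config :=
  { c with
    ops := fun r => if r = p ∨ r = q then max (c.ops p) (c.ops q) else c.ops r
    words := fun r => if r = p ∨ r = q then max (c.words p) (c.words q) + k else c.words r
    msgs := fun r => if r = p ∨ r = q then max (c.msgs p) (c.msgs q) + 1 else c.msgs r }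

/-- Append the digits of the parts of a message from `p` to the variables of `q`. -/
def deliver (p q : ℕ) : List Part → Config → Config
  | [], c => c
  | t :: ts, c =>
    deliver p q ts (c.write q t.dst (c.mem q t.dst ++ slice (c.mem p t.src) t.start t.len))

/-- Every processor uses at most `M` words of memory. -/
def Fits (P M : ℕ) (c : Config) : Prop :=
  ∀ p < P, ∀ F : Finset Var, ∑ x ∈ F, (c.mem p x).length ≤ M

end Config

/-- Number of words of a message of processor `p`. -/
def messageWords (c : Config) (p : ℕ) (parts : List Part) : ℕ :=
  (parts.map fun t => (slice (c.mem p t.src) t.start t.len).length).sum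

/-- Execution of one instruction in base `s`.  A digit-wise product or sum, and the extraction of
the least or of the most significant digit of its value, is one elementary operation each, and so
is the comparison in `sel`; local data movement is no digit operation. -/
def step (s : ℕ) (c : Config) : Instr → Config
  | .put p x l => c.write p x (c.mem p x ++ l)
  | .clear p x => c.write p x []
  | .copy p x start len y => c.write p y (c.mem p y ++ slice (c.mem p x) start len)
  | .move p x y => (c.write p y (c.mem p x)).write p x []
  | .mul p x y z =>
    let t := (c.mem p x).getD 0 0 * (c.mem p y).getD 0 0
    (c.write p z [t % s, t / s]).charge p 3
  | .add p x i y j k z =>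
    let t := (c.mem p x).getD i 0 + (c.mem p y).getD j 0 + (c.mem p k).getD 0 0
    ((c.write p z (c.mem p z ++ [t % s])).write p k [t / s]).charge p 3
  | .sel p f x y z =>
    (c.write p z (if (c.mem p f).getD 0 0 = 0 then c.mem p x else c.mem p y)).charge p 1
  | .send p q parts => (Config.deliver p q parts c).meet p q (messageWords c p parts)

/-- The processors involved in an instruction are among `0, …, P - 1`, and no processor sends a
message to itself. -/
def Instr.Ok (P : ℕ) : Instr → Prop
  | .put p _ _ => p < P
  | .clear p _ => p < P
  | .copy p _ _ _ _ => p < P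
  | .move p _ _ => p < P
  | .mul p _ _ _ => p < P
  | .add p _ _ _ _ _ _ => p < P
  | .sel p _ _ _ _ => p < P
  | .send p q _ => p < P ∧ q < P ∧ p ≠ q

/-- Execution of a program. -/
def run (s : ℕ) (prog : List Instr) (c : Config) : Config := prog.foldl (step s) c

/-- The program can be executed by `P` processors with local memories of `M` words: all its
instructions are admissible and no memory ever overflows. -/
def Executable (s P M : ℕ) : List Instr → Config → Prop
  | [], c => c.Fits P M
  | i :: is, c => c.Fits P M ∧ i.Ok P ∧ Executable s P M is (step s c i)

/-- Computation time: digit operations along the critical path. -/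
def compTime (P : ℕ) (c : Config) : ℕ := (Finset.range P).sup c.ops

/-- Bandwidth cost: words exchanged along the critical path. -/
def bandwidth (P : ℕ) (c : Config) : ℕ := (Finset.range P).sup c.words

/-- Latency: messages exchanged along the critical path. -/
def latency (P : ℕ) (c : Config) : ℕ := (Finset.range P).sup c.msgs

/-- The `j`-th block of `w` digits of the base-`s` expansion of `x`. -/
def block (s w j x : ℕ) : List ℕ := (List.range w).map fun i => x / s ^ (j * w + i) % s

/-- The integer `x` is partitioned in `w` digits in the variable `v` of the processors
`0, …, P - 1`: processor `j` holds the `j`-th block of `w` digits of `x`. -/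
def Partitioned (s w P : ℕ) (v : Var) (x : ℕ) (c : Config) : Prop :=
  ∀ j < P, c.mem j v = block s w j x

/-- The initial configuration: `a` and `b` are partitioned in `w` digits among the processors
`0, …, P - 1`, and there is nothing else in memory. -/
def initial (s w P a b : ℕ) : Config where
  mem := fun j x =>
    if j < P ∧ x = Var.A 0 then block s w j a
    else if j < P ∧ x = Var.B 0 then block s w j b
    else []
  ops := fun _ => 0
  words := fun _ => 0
  msgs := fun _ => 0

/-! ### Programs

A sequence of processors is given by a function `σ : ℕ → ℕ` and its length; `σ j` is its `j`-th
processor.  Instructions of different processors that do not depend on each other run in parallel,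
by the definition of the clocks. -/

/-- Concatenation of the programs `f 0, …, f (m - 1)`. -/
def par (m : ℕ) (f : ℕ → List Instr) : List Instr := (List.range m).flatMap f

/-- Local addition with carry `c` of `len` digits of `x` (from position `i`) and of `y` (from
position `j`); the digits of the sum are appended to `z`. -/
def ripple (p : ℕ) (x : Var) (i : ℕ) (y : Var) (j : ℕ) (c z : Var) (len : ℕ) : List Instr :=
  (List.range len).map fun t => Instr.add p x (i + t) y (j + t) c z

open Var Instr

/-- `C d := C d + s ^ m * C (d + 1)`, where `C d` has `4 * m` and `C (d + 1)` has `2 * m` digits. -/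
def addShifted (p m d : ℕ) : List Instr :=
  [put p (C (d + 1)) (List.replicate m 0), put p U0 [0], copy p (C d) 0 m Z] ++
  ripple p (C d) m (C (d + 1)) 0 U0 Z (3 * m) ++
  [clear p (C d), clear p (C (d + 1)), clear p U0, move p Z (C d)]

/-- SLIM: sequential recursive long multiplication by the processor `p` of the `2 ^ e`-digit
integers in `A d` and `B d`.  The product is left in `C d`. -/
def slim (p : ℕ) : ℕ → ℕ → List Instr
  | 0, d => [mul p (A d) (B d) (C d), clear p (A d), clear p (B d)]
  | e + 1, d =>
    let m := 2 ^ e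
    let sub (i j : ℕ) : List Instr :=
      [copy p (A d) (i * m) m (A (d + 1)), copy p (B d) (j * m) m (B (d + 1))] ++ slim p e (d + 1)
    let app : List Instr := [copy p (C (d + 1)) 0 (2 * m) (C d), clear p (C (d + 1))]
    sub 0 0 ++ app ++ sub 1 1 ++ app ++
    sub 0 1 ++ addShifted p m d ++ sub 1 0 ++ addShifted p m d ++
    [clear p (A d), clear p (B d)]

/-- SUMA: speculative parallel sum of the integers in `x` and `y`, partitioned in `w` digits in the
`2 ^ e` processors of `σ`.  The sums without and with an incoming carry are left in `S0` and `S1`,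
and every processor holds the corresponding outgoing carries in `U0` and `U1`.  The first carry
never exceeds the second one, so that `S1` and `U1` may be updated first, in place. -/
def suma (w : ℕ) (x y : Var) : ℕ → (ℕ → ℕ) → List Instr
  | 0, σ =>
    [put (σ 0) U0 [0]] ++ ripple (σ 0) x 0 y 0 U0 S0 w ++
    [put (σ 0) U1 [1]] ++ ripple (σ 0) x 0 y 0 U1 S1 w ++
    [clear (σ 0) x, clear (σ 0) y]
  | e + 1, σ =>
    let h := 2 ^ e
    suma w x y e σ ++ suma w x y e (fun j => σ (h + j)) ++
    par h (fun j => [send (σ j) (σ (h + j)) [⟨U0, 0, 1, R0⟩, ⟨U1, 0, 1, R1⟩],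
      clear (σ j) U0, clear (σ j) U1]) ++
    par h (fun j => [sel (σ (h + j)) R1 S0 S1 S1, sel (σ (h + j)) R0 S0 S1 S0,
      sel (σ (h + j)) R1 U0 U1 U1, sel (σ (h + j)) R0 U0 U1 U0,
      clear (σ (h + j)) R0, clear (σ (h + j)) R1]) ++
    par h (fun j => [send (σ (h + j)) (σ j) [⟨U0, 0, 1, U0⟩, ⟨U1, 0, 1, U1⟩]])

/-- SUM: parallel sum of the integers in `x` and `y`, partitioned in `w` digits in the `2 ^ e`
processors of `σ`.  The sum is left in `S0`, and every processor holds the last carry in `U0`. -/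
def sum (w : ℕ) (x y : Var) : ℕ → (ℕ → ℕ) → List Instr
  | 0, σ =>
    [put (σ 0) U0 [0]] ++ ripple (σ 0) x 0 y 0 U0 S0 w ++ [clear (σ 0) x, clear (σ 0) y]
  | e + 1, σ =>
    let h := 2 ^ e
    sum w x y e σ ++ suma w x y e (fun j => σ (h + j)) ++
    par h (fun j => [send (σ j) (σ (h + j)) [⟨U0, 0, 1, R0⟩], clear (σ j) U0]) ++
    par h (fun j => [sel (σ (h + j)) R0 S0 S1 S0, sel (σ (h + j)) R0 U0 U1 U0,
      clear (σ (h + j)) R0, clear (σ (h + j)) S1, clear (σ (h + j)) U1]) ++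
    par h (fun j => [send (σ (h + j)) (σ j) [⟨U0, 0, 1, U0⟩]])

/-- `z := x + y` by SUM; the last carry is dropped. -/
def sumInto (w e : ℕ) (x y z : Var) (σ : ℕ → ℕ) : List Instr :=
  sum w x y e σ ++ par (2 ^ e) fun j => [clear (σ j) U0, move (σ j) S0 z]

/-- The end of the recomposition on `4 ^ k` processors.  The sub-product in `Q 0 d` is partitioned
in `w` digits in the first half of `σ`, those in `Q 1 d` and `Q 2 d` in the middle half, that in
`Q 3 d` in the second half.  They are padded with zero digits, and the product is computed by three
invocations of SUM. -/
def combine (k w d : ℕ) (σ : ℕ → ℕ) : List Instr :=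
  let q := 4 ^ k / 4
  let pad (i : ℕ) (x : Var) : Instr := put (σ i) x (List.replicate w 0)
  par q (fun j => [pad (2 * q + j) (Q 0 d), pad (3 * q + j) (Q 0 d), pad j (Q 1 d),
    pad (3 * q + j) (Q 1 d), pad j (Q 2 d), pad (3 * q + j) (Q 2 d), pad j (Q 3 d),
    pad (q + j) (Q 3 d)]) ++
  sumInto w (2 * k) (Q 0 d) (Q 1 d) (Q 0 d) σ ++
  sumInto w (2 * k) (Q 0 d) (Q 2 d) (Q 0 d) σ ++
  sumInto w (2 * k) (Q 0 d) (Q 3 d) (C d) σ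

/-- COPSIM in the memory-independent mode, for `A d` and `B d` partitioned in `2 ^ r` digits in the
`4 ^ k` processors of `σ`.  The product is left in `C d`, partitioned in `2 * 2 ^ r` digits. -/
def copsimMI : ℕ → ℕ → (ℕ → ℕ) → ℕ → List Instr
  | 0, r, σ, d => slim (σ 0) r d
  | k + 1, r, σ, d =>
    let w := 2 ^ r
    let q := 4 ^ k
    let p0 := fun j => σ (2 * j)
    let p1 := fun j => σ (2 * j + 1)
    let p2 := fun j => σ (2 * q + 2 * j)
    let p3 := fun j => σ (2 * q + 2 * j + 1)
    -- splitting
    par q (fun j => [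
      copy (p0 j) (A d) 0 w (A (d + 1)), copy (p0 j) (B d) 0 w (B (d + 1)),
      send (p1 j) (p0 j) [⟨A d, 0, w, A (d + 1)⟩, ⟨B d, 0, w, B (d + 1)⟩],
      send (p2 j) (p3 j) [⟨A d, 0, w, A (d + 1)⟩, ⟨B d, 0, w, B (d + 1)⟩],
      copy (p3 j) (A d) 0 w (A (d + 1)), copy (p3 j) (B d) 0 w (B (d + 1))]) ++
    par (4 * q) (fun j => [clear (σ j) (A d), clear (σ j) (B d)]) ++
    par q (fun j => [
      send (p0 j) (p1 j) [⟨A (d + 1), 0, 2 * w, A (d + 1)⟩],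
      send (p3 j) (p2 j) [⟨A (d + 1), 0, 2 * w, A (d + 1)⟩]]) ++
    par q (fun j => [
      send (p0 j) (p2 j) [⟨B (d + 1), 0, 2 * w, B (d + 1)⟩],
      send (p3 j) (p1 j) [⟨B (d + 1), 0, 2 * w, B (d + 1)⟩]]) ++
    -- the four sub-problems, in parallel
    copsimMI k (r + 1) p0 (d + 1) ++ copsimMI k (r + 1) p1 (d + 1) ++
    copsimMI k (r + 1) p2 (d + 1) ++ copsimMI k (r + 1) p3 (d + 1) ++
    -- redistribution of the sub-products
    par q (fun j => [
      copy (p0 j) (C (d + 1)) 0 (2 * w) (Q 0 d),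
      send (p0 j) (p1 j) [⟨C (d + 1), 2 * w, 2 * w, Q 0 d⟩], clear (p0 j) (C (d + 1)),
      copy (p3 j) (C (d + 1)) (2 * w) (2 * w) (Q 3 d),
      send (p3 j) (p2 j) [⟨C (d + 1), 0, 2 * w, Q 3 d⟩], clear (p3 j) (C (d + 1))]) ++
    par q (fun j => [
      copy (p1 j) (C (d + 1)) (2 * w) (2 * w) (Q 1 d),
      send (p1 j) (p0 j) [⟨C (d + 1), 0, 2 * w, Q 1 d⟩], clear (p1 j) (C (d + 1)),
      copy (p2 j) (C (d + 1)) 0 (2 * w) (Q 2 d),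
      send (p2 j) (p3 j) [⟨C (d + 1), 2 * w, 2 * w, Q 2 d⟩], clear (p2 j) (C (d + 1))]) ++
    par q (fun j => [
      send (σ (q + j)) (σ (2 * q + j)) [⟨Q 1 d, 0, 2 * w, Q 1 d⟩], clear (σ (q + j)) (Q 1 d)]) ++
    par q (fun j => [
      send (σ (2 * q + j)) (σ (q + j)) [⟨Q 2 d, 0, 2 * w, Q 2 d⟩],
      clear (σ (2 * q + j)) (Q 2 d)]) ++
    par q (fun j => [
      send (σ j) (σ (q + j)) [⟨Q 1 d, 0, 2 * w, Q 1 d⟩], clear (σ j) (Q 1 d),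
      send (σ (3 * q + j)) (σ (2 * q + j)) [⟨Q 2 d, 0, 2 * w, Q 2 d⟩],
      clear (σ (3 * q + j)) (Q 2 d)]) ++
    combine (k + 1) (2 * w) d σ

/-- COPSIM for `A d` and `B d` partitioned in `2 ^ r` digits in the `4 ^ k` processors of `σ`, with
`M` words of local memory available: if `12 n / √P ≤ M`, where `n` is the number of digits and `P`
the number of processors, it runs in the memory-independent mode, and otherwise it performs a
depth-first step, with `M - 20 n / P` words available to the recursive invocations.  The product is
left in `C d`, partitioned in `2 * 2 ^ r` digits.  (Single digits cannot be halved, so that no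
depth-first step is possible for `r = 0`.) -/
def copsimRec (k : ℕ) : ℕ → ℕ → (ℕ → ℕ) → ℕ → List Instr
  | 0, _, σ, d => copsimMI k 0 σ d
  | r + 1, M, σ, d =>
    if 12 * (2 ^ (r + 1) * 4 ^ k) ≤ M * 2 ^ k then copsimMI k (r + 1) σ d
    else
      let v := 2 ^ r
      let w := 2 ^ (r + 1)
      let q := 4 ^ k / 4
      let h := 4 ^ k / 2
      let lo := fun j => σ j
      let hi := fun j => σ (h + j)
      let rec' : List Instr :=
        copsimRec k r (M - 20 * w) (fun j => if j % 2 = 0 then lo (j / 2) else hi (j / 2)) (d + 1)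
      -- the rearrangement of a middle sub-product
      let middle (x : Var) : List Instr :=
        par q (fun j => [
          copy (lo j) (C (d + 1)) 0 w x, clear (lo j) (C (d + 1)),
          send (hi j) (lo j) [⟨C (d + 1), 0, w, x⟩], clear (hi j) (C (d + 1)),
          send (lo (q + j)) (hi (q + j)) [⟨C (d + 1), 0, w, x⟩], clear (lo (q + j)) (C (d + 1)),
          copy (hi (q + j)) (C (d + 1)) 0 w x, clear (hi (q + j)) (C (d + 1))]) ++
        par q (fun j => [
          send (σ j) (σ (q + j)) [⟨x, 0, 2 * w, x⟩], clear (σ j) x,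
          send (σ (3 * q + j)) (σ (2 * q + j)) [⟨x, 0, 2 * w, x⟩], clear (σ (3 * q + j)) x])
      -- low half of `A` times low half of `B`
      par h (fun j => [
        copy (lo j) (A d) 0 v (A (d + 1)), copy (lo j) (B d) 0 v (B (d + 1)),
        send (lo j) (hi j) [⟨A d, v, v, A (d + 1)⟩, ⟨B d, v, v, B (d + 1)⟩]]) ++
      rec' ++
      par h (fun j => [
        copy (lo j) (C (d + 1)) 0 w (Q 0 d), clear (lo j) (C (d + 1)),
        send (hi j) (lo j) [⟨C (d + 1), 0, w, Q 0 d⟩], clear (hi j) (C (d + 1))]) ++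
      -- low half of `A` times high half of `B`
      par h (fun j => [
        copy (lo j) (A d) 0 v (A (d + 1)), copy (hi j) (B d) v v (B (d + 1)),
        send (lo j) (hi j) [⟨A d, v, v, A (d + 1)⟩],
        send (hi j) (lo j) [⟨B d, 0, v, B (d + 1)⟩]]) ++
      rec' ++ middle (Q 1 d) ++
      -- high half of `A` times low half of `B`
      par h (fun j => [
        copy (hi j) (A d) v v (A (d + 1)), copy (lo j) (B d) 0 v (B (d + 1)),
        send (lo j) (hi j) [⟨B d, v, v, B (d + 1)⟩],
        send (hi j) (lo j) [⟨A d, 0, v, A (d + 1)⟩]]) ++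
      rec' ++ middle (Q 2 d) ++
      -- high half of `A` times high half of `B`
      par h (fun j => [
        copy (hi j) (A d) v v (A (d + 1)), copy (hi j) (B d) v v (B (d + 1)),
        send (hi j) (lo j) [⟨A d, 0, v, A (d + 1)⟩, ⟨B d, 0, v, B (d + 1)⟩]]) ++
      rec' ++
      par h (fun j => [
        send (lo j) (hi j) [⟨C (d + 1), 0, w, Q 3 d⟩], clear (lo j) (C (d + 1)),
        copy (hi j) (C (d + 1)) 0 w (Q 3 d), clear (hi j) (C (d + 1))]) ++
      par (4 ^ k) (fun j => [clear (σ j) (A d), clear (σ j) (B d)]) ++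
      combine k (2 * w) d σ

/-- COPSIM for `n`-digit integers in the processors `0, …, P - 1` with `M` words of local memory;
`n` is a power of two, `P` a power of four, and `P ≤ n`. -/
def copsim (n P M : ℕ) : List Instr :=
  copsimRec (Nat.log 4 P) (Nat.log 2 (n / P)) M (fun j => j) 0

end Copsim

namespace Copsim

open Var Instr Function

/-! The proof is a Hoare logic with costs. A judgement `Tri` says that a program confined to the
processors of an index set turns one family of memory contents into another within a memory bound,
and that it raises any common upper bounds on their clocks by at most the stated amounts.
Consecutive programs on the same set add their costs (`Tri.seq`). Confined programs on disjoint sets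
cannot see each other, so listing them one after the other costs only as much as one of them
(`Tri.parallel`). A message brings two processors to a common clock (`Tri.message`). Critical paths
thus never appear explicitly: correctness, memory and all three costs are proved by a single
induction.

Correctness is schoolbook arithmetic (`mul_halves`). Residue and quotient by a power of the base
correspond to the blocks in the lower and upper half of the processors (`block_mod`, `block_div`),
and two neighbouring blocks form one block of double width (`block_append`). For a sum, the upper
half computes both candidate results, and the carry of the lower half, which is 0 or 1, selects one
of them (`halves_add`, `tri_suma`, `tri_sum`); each level costs a bounded number of selections,
words and messages.

Write n/P = 2^r and P = 4^k. A level of the memory-independent mode (`tri_copsimMI`) quarters the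
number of processors and doubles the digits in each, so n/√P = 2^(r+k) is invariant and bounds the
memory throughout. The moved words form a geometric sum of order n/√P, and k levels with O(k)
messages each give O(k²) messages.

A depth-first step (`tri_depthFirst`, `tri_copsimRec`) runs four sub-problems one after the other on
all processors. With w digits per processor it retains at most 10w words meanwhile: 2w for the
inputs and 8w for the sub-products. This is covered by the 20w words it gives up. The inequalities
80·2^r ≤ M and 12·2^k + 40·2^r ≤ M survive each such step, so the memory-independent mode is
available at the latest when one digit per processor is left.

Each cost satisfies F(r) = 4·F(r-1) + dfs(r) until the mode changes. A potential absorbs the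
inhomogeneous term, which leaves 4^l times the cost at the bottom after l steps (`recCost_le`).
Since the last step was still short of memory, 2^l·M is less than 48·n/√P (`depth_lt`). Hence the
bandwidth is of order 4^l·n/(2^l·√P), which is at most of order n²/(MP), and the latency is of order
4^l·k², at most of order n²k²/(M²P). The explicit constants are checked in `recTime_le`,
`recWords_le` and `recMsgs_le`. -/

/-- The memory of one processor. -/
abbrev Mem := Var → List ℕ

/-! ### Memory bounds and the locality of execution. -/

/-- At most `u` words are in use. -/
def Bnd (m : Mem) (u : ℕ) : Prop := ∀ F : Finset Var, ∑ x ∈ F, (m x).length ≤ u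

theorem Bnd.mono {m : Mem} {u v : ℕ} (h : Bnd m u) (huv : u ≤ v) : Bnd m v :=
  fun F => (h F).trans huv

/-- Overwriting frees the old contents, so only the difference of the two lengths has to be paid
for. The hypothesis avoids truncated subtraction. -/
theorem Bnd.update {m : Mem} {u v : ℕ} {x : Var} {l : List ℕ} (h : Bnd m u)
    (hv : u + l.length ≤ v + (m x).length) : Bnd (update m x l) v := by
  intro F
  -- The set `F` may miss `x`; the old bound is applied to a set that contains it, so that the old
  -- contents of `x` can be deducted.
  have h1 := h (insert x (F.erase x))
  rw [Finset.sum_insert (by simp)] at h1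
  have h2 : ∑ y ∈ F, (Function.update m x l y).length ≤
      ∑ y ∈ insert x (F.erase x), (Function.update m x l y).length :=
    Finset.sum_le_sum_of_subset (Finset.insert_erase_subset x F)
  rw [Finset.sum_insert (by simp), update_self] at h2
  have h3 : ∑ y ∈ F.erase x, (Function.update m x l y).length =
      ∑ y ∈ F.erase x, (m y).length :=
    Finset.sum_congr rfl fun y hy => by rw [update_of_ne (Finset.ne_of_mem_erase hy)]
  omega

theorem Bnd.set {m : Mem} {u a : ℕ} {x : Var} {l : List ℕ} (h : Bnd m u) (ha : l.length ≤ a) :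
    Bnd (Function.update m x l) (u + a) := h.update (by omega)

theorem Bnd.clear {m : Mem} {u : ℕ} {x : Var} (h : Bnd m u) : Bnd (Function.update m x []) u :=
  h.update (by simp)

theorem Bnd.length_le {m : Mem} {u : ℕ} (h : Bnd m u) (x : Var) : (m x).length ≤ u := by
  simpa using h {x}

/-- The processors involved in an instruction are in `D`; no processor sends to itself. -/
def _root_.Copsim.Instr.In (D : Set ℕ) : Instr → Prop
  | .put p _ _ => p ∈ D
  | .clear p _ => p ∈ D
  | .copy p _ _ _ _ => p ∈ D
  | .move p _ _ => p ∈ D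
  | .mul p _ _ _ => p ∈ D
  | .add p _ _ _ _ _ _ => p ∈ D
  | .sel p _ _ _ _ => p ∈ D
  | .send p q _ => p ∈ D ∧ q ∈ D ∧ p ≠ q

theorem Instr.In.mono {D E : Set ℕ} (h : D ⊆ E) {i : Instr} (hi : i.In D) : i.In E := by
  cases i <;> simp only [Instr.In] at hi ⊢ <;> first | exact h hi | exact ⟨h hi.1, h hi.2.1, hi.2.2⟩

/-- The local state of the processor `p`. -/
def view (c : Config) (p : ℕ) : Mem × ℕ × ℕ × ℕ := (c.mem p, c.ops p, c.words p, c.msgs p)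

theorem deliver_mem_of_ne {p q r : ℕ} (hr : r ≠ q) (ts : List Part) (c : Config) :
    (Config.deliver p q ts c).mem r = c.mem r := by
  induction ts generalizing c with
  | nil => rfl
  | cons t ts ih => rw [Config.deliver, ih]; simp [Config.write, hr]

theorem deliver_clocks {p q : ℕ} (ts : List Part) (c : Config) :
    (Config.deliver p q ts c).ops = c.ops ∧ (Config.deliver p q ts c).words = c.words ∧
    (Config.deliver p q ts c).msgs = c.msgs := by
  induction ts generalizing c with
  | nil => exact ⟨rfl, rfl, rfl⟩
  | cons t ts ih => rw [Config.deliver]; exact ih _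

/-- Locality: memory and clocks of a processor change only by instructions that involve it. This is
the source of all parallelism in the cost estimates. -/
theorem view_step_of_notMem {s : ℕ} {c : Config} {D : Set ℕ} {i : Instr} (hi : i.In D) {p : ℕ}
    (hp : p ∉ D) : view (step s c i) p = view c p := by
  cases i with
  | send a b ts =>
    obtain ⟨ha, hb, -⟩ := hi
    have h1 : p ≠ a := fun h => hp (h ▸ ha)
    have h2 : p ≠ b := fun h => hp (h ▸ hb)
    simp [view, step, Config.meet, h1, h2, deliver_mem_of_ne, deliver_clocks]
  | put a | clear a | copy a | move a | mul a | add a | sel a =>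
    have h1 : p ≠ a := fun h => hp (h ▸ hi)
    simp [view, step, Config.write, Config.charge, h1]

theorem run_append (s : ℕ) (L₁ L₂ : List Instr) (c : Config) :
    run s (L₁ ++ L₂) c = run s L₂ (run s L₁ c) := List.foldl_append ..

theorem view_run_of_notMem {s : ℕ} {D : Set ℕ} {L : List Instr} (hL : ∀ i ∈ L, i.In D) {p : ℕ}
    (hp : p ∉ D) (c : Config) : view (run s L c) p = view c p := by
  induction L generalizing c with
  | nil => rfl
  | cons i L ih =>
    exact (ih (fun j hj => hL j (by simp [hj])) _).trans (view_step_of_notMem (hL i (by simp)) hp)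

/-- The memory use of the processor `p` never exceeds `K` words in the execution of a program. -/
def Safe (s K p : ℕ) : List Instr → Config → Prop
  | [], c => Bnd (c.mem p) K
  | i :: L, c => Bnd (c.mem p) K ∧ Safe s K p L (step s c i)

theorem safe_append {s K p : ℕ} {L₁ L₂ : List Instr} {c : Config} (h₁ : Safe s K p L₁ c)
    (h₂ : Safe s K p L₂ (run s L₁ c)) : Safe s K p (L₁ ++ L₂) c := by
  induction L₁ generalizing c with
  | nil => exact h₂
  | cons i L ih => exact ⟨h₁.1, ih h₁.2 h₂⟩

theorem Safe.last {s K p : ℕ} {L : List Instr} {c : Config} (h : Safe s K p L c) :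
    Bnd ((run s L c).mem p) K := by
  induction L generalizing c with
  | nil => exact h
  | cons i L ih => exact ih h.2

theorem Safe.first {s K p : ℕ} {L : List Instr} {c : Config} (h : Safe s K p L c) :
    Bnd (c.mem p) K := by
  cases L with
  | nil => exact h
  | cons i L => exact h.1

theorem safe_of_notMem {s K p : ℕ} {D : Set ℕ} {L : List Instr} (hL : ∀ i ∈ L, i.In D)
    (hp : p ∉ D) {c : Config} (h : Bnd (c.mem p) K) : Safe s K p L c := by
  induction L generalizing c with
  | nil => exact h
  | cons i L ih =>
    refine ⟨h, ih (fun j hj => hL j (by simp [hj])) ?_⟩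
    have := congrArg Prod.fst (view_step_of_notMem (s := s) (c := c) (hL i (by simp)) hp)
    exact (show (step s c i).mem p = c.mem p from this) ▸ h

/-- Safety is proved for one processor at a time along the whole program; executability asks for all
processors at every instant. The two quantifiers are exchanged here. -/
theorem executable_of_safe {s P K : ℕ} {L : List Instr} {c : Config}
    (hL : ∀ i ∈ L, i.In {p | p < P}) (h : ∀ p < P, Safe s K p L c) : Executable s P K L c := by
  induction L generalizing c with
  | nil => exact h
  | cons i L ih =>
    refine ⟨fun p hp => (h p hp).1, ?_, ih (fun j hj => hL j (by simp [hj])) fun p hp => (h p hp).2⟩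
    have := hL i (by simp)
    cases i <;> exact this

/-! ### Hoare triples with costs for families of processors. -/

/-- The processors `σ j`, `j ∈ D`, have memory contents `f j` and clocks of at most `T`, `W`, `N`.
-/
def Holds (σ : ℕ → ℕ) (D : Set ℕ) (f : ℕ → Mem) (T W N : ℕ) (c : Config) : Prop :=
  ∀ j ∈ D, c.mem (σ j) = f j ∧ c.ops (σ j) ≤ T ∧ c.words (σ j) ≤ W ∧ c.msgs (σ j) ≤ N

/-- The program `L` runs on the processors `σ j`, `j ∈ D`, in `K` words of memory each, changes
their memory contents from `f j` to `g j`, and takes `t` operations, `w` words and `l` messages. -/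
def Tri (s K : ℕ) (σ : ℕ → ℕ) (D : Set ℕ) (f : ℕ → Mem) (L : List Instr) (g : ℕ → Mem)
    (t w l : ℕ) : Prop :=
  (∀ i ∈ L, i.In (σ '' D)) ∧ ∀ c T W N, Holds σ D f T W N c →
    Holds σ D g (T + t) (W + w) (N + l) (run s L c) ∧ ∀ j ∈ D, Safe s K (σ j) L c

section Rules

variable {s K : ℕ} {σ : ℕ → ℕ} {D E : Set ℕ} {f f' g g' h : ℕ → Mem} {L L₁ L₂ : List Instr}
  {t t' w w' l l' : ℕ}

theorem Tri.nil (hg : ∀ j ∈ D, g j = f j) (hK : ∀ j ∈ D, Bnd (f j) K) :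
    Tri s K σ D f [] g 0 0 0 := by
  refine ⟨by simp, fun c T W N hc => ⟨fun j hj => ?_, fun j hj => ?_⟩⟩
  · rw [hg j hj]; exact hc j hj
  · exact show Bnd (c.mem (σ j)) K from (hc j hj).1 ▸ hK j hj

/-- The clock bounds in `Tri` are arbitrary, so the bounds reached after the first program serve as
the starting bounds of the second. -/
theorem Tri.seq (h₁ : Tri s K σ D f L₁ g t w l) (h₂ : Tri s K σ D g L₂ h t' w' l') :
    Tri s K σ D f (L₁ ++ L₂) h (t + t') (w + w') (l + l') := by
  refine ⟨fun i hi => (List.mem_append.1 hi).elim (h₁.1 i) (h₂.1 i), fun c T W N hc => ?_⟩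
  obtain ⟨ha, hb⟩ := h₁.2 c T W N hc
  obtain ⟨hd, he⟩ := h₂.2 _ _ _ _ ha
  simp only [← add_assoc, run_append]
  exact ⟨hd, fun j hj => safe_append (hb j hj) (he j hj)⟩

theorem Tri.weaken (h₁ : Tri s K σ D f L g t w l) (ht : t ≤ t') (hw : w ≤ w') (hl : l ≤ l') :
    Tri s K σ D f L g t' w' l' := by
  refine ⟨h₁.1, fun c T W N hc => ⟨fun j hj => ?_, (h₁.2 c T W N hc).2⟩⟩
  obtain ⟨ha, hb, hd, he⟩ := (h₁.2 c T W N hc).1 j hj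
  exact ⟨ha, by omega, by omega, by omega⟩

theorem Tri.congr (h₁ : Tri s K σ D f L g t w l) (hf : ∀ j ∈ D, f' j = f j)
    (hg : ∀ j ∈ D, g' j = g j) : Tri s K σ D f' L g' t w l := by
  refine ⟨h₁.1, fun c T W N hc => ?_⟩
  have := h₁.2 c T W N fun j hj => hf j hj ▸ hc j hj
  exact ⟨fun j hj => hg j hj ▸ this.1 j hj, this.2⟩

/-- A sub-problem is solved on its own sequence of processors, numbered from 0; this transports the
result to the positions `ι j` in the surrounding sequence. -/
theorem Tri.reindex {ι : ℕ → ℕ}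
    (h₁ : Tri s K (fun j => σ (ι j)) D (fun j => f (ι j)) L (fun j => g (ι j)) t w l) :
    Tri s K σ (ι '' D) f L g t w l := by
  refine ⟨fun i hi => ?_, fun c T W N hc => ?_⟩
  · rw [← Set.image_comp]; exact h₁.1 i hi
  · have := h₁.2 c T W N fun j hj => hc _ (Set.mem_image_of_mem ι hj)
    exact ⟨Set.forall_mem_image.2 this.1, Set.forall_mem_image.2 this.2⟩

/-- Injectivity of `σ` turns disjoint index sets into disjoint sets of processors. By locality each
program then runs as if the other one were absent, and the costs are not added. -/
theorem Tri.parallel (hσ : Set.InjOn σ (D ∪ E)) (hDE : Disjoint D E)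
    (h₁ : Tri s K σ D f L₁ g t w l) (h₂ : Tri s K σ E f L₂ g t w l) :
    Tri s K σ (D ∪ E) f (L₁ ++ L₂) g t w l := by
  refine ⟨fun i hi => (List.mem_append.1 hi).elim (fun hi => (h₁.1 i hi).mono (by gcongr; simp))
    (fun hi => (h₂.1 i hi).mono (by gcongr; simp)), fun c T W N hc => ?_⟩
  have hD : ∀ j ∈ D, σ j ∉ σ '' E := by
    rintro j hj ⟨i, hi, hij⟩
    have := hσ (Or.inr hi) (Or.inl hj) hij
    exact Set.disjoint_left.1 hDE hj (this ▸ hi)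
  have hE : ∀ j ∈ E, σ j ∉ σ '' D := by
    rintro j hj ⟨i, hi, hij⟩
    have := hσ (Or.inl hi) (Or.inr hj) hij
    exact Set.disjoint_left.1 hDE hi (this ▸ hj)
  obtain ⟨ha, hb⟩ := h₁.2 c T W N fun j hj => hc j (Or.inl hj)
  -- After `L₁` the processors of `E` still obey the original clock bounds, not the increased ones.
  have hE' : Holds σ E f T W N (run s L₁ c) := fun j hj => by
    have hv := view_run_of_notMem (s := s) h₁.1 (hE j hj) c
    simp only [view, Prod.mk.injEq] at hv
    rw [hv.1, hv.2.1, hv.2.2.1, hv.2.2.2]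
    exact hc j (Or.inr hj)
  obtain ⟨hd, he⟩ := h₂.2 _ _ _ _ hE'
  rw [run_append]
  refine ⟨fun j hj => hj.elim (fun hj => ?_) (hd j), fun j hj => hj.elim (fun hj => ?_) fun hj =>
      ?_⟩
  · have hv := view_run_of_notMem (s := s) h₂.1 (hD j hj) (run s L₁ c)
    simp only [view, Prod.mk.injEq] at hv
    rw [hv.1, hv.2.1, hv.2.2.1, hv.2.2.2]
    exact ha j hj
  · exact safe_append (hb j hj) (safe_of_notMem h₂.1 (hD j hj) (hb j hj).last)
  · have hb := (he j hj).first
    rw [(hE' j hj).1, ← (hc j (Or.inr hj)).1] at hb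
    exact safe_append (safe_of_notMem h₁.1 (hE j hj) hb) (he j hj)

/-- Frame rule: idle processors run the empty program in parallel. Only their memory bound has to be
supplied. -/
theorem Tri.frame (hσ : Set.InjOn σ D) (hED : E ⊆ D) (h₁ : Tri s K σ E f L g t w l)
    (hg : ∀ j ∈ D, j ∉ E → g j = f j ∧ Bnd (f j) K) : Tri s K σ D f L g t w l := by
  have h₂ : Tri s K σ (D \ E) f [] g t w l :=
    (Tri.nil (fun j hj => (hg j hj.1 hj.2).1) fun j hj => (hg j hj.1 hj.2).2).weaken
      (Nat.zero_le _) (Nat.zero_le _) (Nat.zero_le _)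
  have h₃ := Tri.parallel (by rwa [Set.union_sdiff_cancel hED]) Set.disjoint_sdiff_right h₁ h₂
  rwa [Set.union_sdiff_cancel hED, List.append_nil] at h₃

theorem par_succ (m : ℕ) (F : ℕ → List Instr) : par (m + 1) F = par m F ++ F m := by
  simp [par, List.range_succ]

/-- The costs do not depend on `q`: one parallel communication step over any number of disjoint
groups costs as much as a single group. -/
theorem Tri.par {q : ℕ} {F : ℕ → List Instr} {E : ℕ → Set ℕ} (hσ : Set.InjOn σ D)
    (hE : ∀ a < q, E a ⊆ D) (hdisj : ∀ a < q, ∀ b < a, Disjoint (E b) (E a))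
    (h₁ : ∀ a < q, Tri s K σ (E a) f (F a) g t w l)
    (hg : ∀ j ∈ D, (∀ a < q, j ∉ E a) → g j = f j ∧ Bnd (f j) K) :
    Tri s K σ D f (par q F) g t w l := by
  have key : ∀ m ≤ q, Tri s K σ (⋃ a < m, E a) f (Copsim.par m F) g t w l := by
    intro m hm
    induction m with
    | zero =>
      exact (Tri.nil (by simp) (by simp)).weaken (Nat.zero_le _) (Nat.zero_le _) (Nat.zero_le _)
    | succ m ih =>
      rw [par_succ, Set.biUnion_lt_succ]
      refine Tri.parallel (hσ.mono ?_) ?_ (ih (by omega)) (h₁ m (by omega))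
      · refine Set.union_subset (Set.iUnion₂_subset fun a ha => hE a (by omega)) (hE m (by omega))
      · exact Set.disjoint_iUnion₂_left.2 fun a ha => hdisj m (by omega) a ha
  refine (key q le_rfl).frame hσ (Set.iUnion₂_subset hE) fun j hj hj' => hg j hj fun a ha haj => ?_
  exact hj' (Set.mem_biUnion (s := {a | a < q}) ha haj)

end Rules

/-! ### Local programs -/

/-- The effect of a local instruction on the memory of its processor. -/
def lstep (s : ℕ) (m : Mem) : Instr → Mem
  | .put _ x l => update m x (m x ++ l)
  | .clear _ x => update m x []
  | .copy _ x start len y => update m y (m y ++ slice (m x) start len)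
  | .move _ x y => update (update m y (m x)) x []
  | .mul _ x y z =>
    let t := (m x).getD 0 0 * (m y).getD 0 0
    update m z [t % s, t / s]
  | .add _ x i y j k z =>
    let t := (m x).getD i 0 + (m y).getD j 0 + (m k).getD 0 0
    update (update m z (m z ++ [t % s])) k [t / s]
  | .sel _ f x y z => update m z (if (m f).getD 0 0 = 0 then m x else m y)
  | .send _ _ _ => m

/-- The instruction is local to the processor `p`. -/
def _root_.Copsim.Instr.Local (p : ℕ) : Instr → Prop
  | .put r _ _ => r = p
  | .clear r _ => r = p
  | .copy r _ _ _ _ => r = p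
  | .move r _ _ => r = p
  | .mul r _ _ _ => r = p
  | .add r _ _ _ _ _ _ => r = p
  | .sel r _ _ _ _ => r = p
  | .send _ _ _ => False

/-- The number of digit operations of an instruction. -/
def _root_.Copsim.Instr.cost : Instr → ℕ
  | .mul _ _ _ _ => 3
  | .add _ _ _ _ _ _ _ => 3
  | .sel _ _ _ _ _ => 1
  | _ => 0

/-- The number of digit operations of a local program. -/
def lops (L : List Instr) : ℕ := (L.map Instr.cost).sum

/-- The effect of a local program on the memory of its processor. -/
def lrun (s : ℕ) (L : List Instr) (m : Mem) : Mem := L.foldl (lstep s) m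

/-- The memory use never exceeds `K` words in the execution of a local program. -/
def LSafe (s K : ℕ) : List Instr → Mem → Prop
  | [], m => Bnd m K
  | i :: L, m => Bnd m K ∧ LSafe s K L (lstep s m i)

/-- A local instruction depends on nothing but the memory of its own processor. Local programs can
therefore be studied as functions on a single memory. -/
theorem view_step_local {s p : ℕ} {i : Instr} (hi : i.Local p) (c : Config) :
    view (step s c i) p = (lstep s (c.mem p) i, c.ops p + i.cost, c.words p, c.msgs p) := by
  cases i <;> simp only [Instr.Local] at hi <;> subst hi <;>
    simp [view, step, lstep, Config.write, Config.charge, Instr.cost]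

theorem view_run_local {s p : ℕ} {L : List Instr} (hL : ∀ i ∈ L, i.Local p) (c : Config) :
    view (run s L c) p = (lrun s L (c.mem p), c.ops p + lops L, c.words p, c.msgs p) := by
  induction L generalizing c with
  | nil => simp [run, view, lrun, lops]
  | cons i L ih =>
    have h := view_step_local (s := s) (hL i (by simp)) c
    simp only [view, Prod.mk.injEq] at h
    refine (ih (fun j hj => hL j (by simp [hj])) _).trans ?_
    rw [h.1, h.2.1, h.2.2.1, h.2.2.2]
    simp [lrun, lops, add_assoc]

theorem LSafe.safe {s K p : ℕ} {L : List Instr} (hL : ∀ i ∈ L, i.Local p) {c : Config}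
    (h : LSafe s K L (c.mem p)) : Safe s K p L c := by
  induction L generalizing c with
  | nil => exact h
  | cons i L ih =>
    have hv := congrArg Prod.fst (view_step_local (s := s) (hL i (by simp)) c)
    exact ⟨h.1, ih (fun j hj => hL j (by simp [hj])) ((show (step s c i).mem p = _ from hv) ▸ h.2)⟩

theorem lrun_append (s : ℕ) (L₁ L₂ : List Instr) (m : Mem) :
    lrun s (L₁ ++ L₂) m = lrun s L₂ (lrun s L₁ m) := List.foldl_append ..

theorem lops_append (L₁ L₂ : List Instr) : lops (L₁ ++ L₂) = lops L₁ + lops L₂ := by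
  simp [lops]

theorem LSafe.append {s K : ℕ} {L₁ L₂ : List Instr} {m : Mem} (h₁ : LSafe s K L₁ m)
    (h₂ : LSafe s K L₂ (lrun s L₁ m)) : LSafe s K (L₁ ++ L₂) m := by
  induction L₁ generalizing m with
  | nil => exact h₂
  | cons i L ih => exact ⟨h₁.1, ih h₁.2 h₂⟩

theorem LSafe.mono {s K K' : ℕ} {L : List Instr} {m : Mem} (h : LSafe s K L m)
    (hK : K ≤ K') : LSafe s K' L m := by
  induction L generalizing m with
  | nil => exact Bnd.mono h hK
  | cons i L ih => exact ⟨h.1.mono hK, ih h.2⟩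

theorem Instr.Local.in {p : ℕ} {i : Instr} (hi : i.Local p) : i.In {p} := by
  cases i <;> simp_all [Instr.Local, Instr.In]

theorem Tri.local {s K : ℕ} {σ : ℕ → ℕ} {f g : ℕ → Mem} {L : List Instr} {t a : ℕ}
    (hL : ∀ i ∈ L, i.Local (σ a)) (hg : g a = lrun s L (f a)) (hK : LSafe s K L (f a))
    (ht : lops L ≤ t) : Tri s K σ {a} f L g t 0 0 := by
  refine ⟨fun i hi => by simpa using (hL i hi).in, fun c T W N hc => ?_⟩
  obtain ⟨h1, h2, h3, h4⟩ := hc a rfl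
  have hv := view_run_local (s := s) hL c
  simp only [view, Prod.mk.injEq] at hv
  refine ⟨?_, ?_⟩
  · rintro j rfl
    rw [hv.1, hv.2.1, hv.2.2.1, hv.2.2.2, hg, h1]
    exact ⟨rfl, by omega, by omega, by omega⟩
  · rintro j rfl
    exact LSafe.safe hL (h1 ▸ hK)

/-- Bookkeeping instructions: no digit operations. -/
def _root_.Copsim.Instr.Free : Instr → Prop
  | .put _ _ _ => True
  | .clear _ _ => True
  | .copy _ _ _ _ _ => True
  | .move _ _ _ => True
  | _ => False

/-- An upper bound for the number of words allocated by a bookkeeping instruction. -/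
def _root_.Copsim.Instr.grow : Instr → ℕ
  | .put _ _ l => l.length
  | .copy _ _ _ len _ => len
  | _ => 0

theorem slice_length_le (l : List ℕ) (a b : ℕ) : (slice l a b).length ≤ b := by
  simp [slice]

theorem Bnd.lstep {s u : ℕ} {m : Mem} {i : Instr} (hi : i.Free) (h : Bnd m u) :
    Bnd (lstep s m i) (u + i.grow) := by
  cases i with
  | put p x l => exact h.update (by simp [Instr.grow]; omega)
  | clear p x => exact h.clear
  | copy p x st len y =>
    exact h.update (by have := slice_length_le (m x) st len; simp [Instr.grow]; omega)
  | move p x y =>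
    have h0 := h.length_le x
    by_cases hxy : x = y
    · subst hxy; simpa [Copsim.lstep, Instr.grow] using h.clear
    -- Releasing `x` before filling `y` yields the same memory and shows that renaming allocates
    -- nothing, even though the instruction writes first.
    · have h1 : Bnd (Function.update m x []) (u - (m x).length) := h.update (by simp; omega)
      have h2 := h1.set (x := y) (l := m x) le_rfl
      rw [update_comm hxy] at h2
      exact h2.mono (by omega)
  | mul | add | sel | send => exact hi.elim

/-- A deliberately crude bound: allocations are summed and releases are ignored. The programs
concerned are short, so the loss is a bounded number of blocks. -/
theorem lsafe_of_free {s K u : ℕ} {L : List Instr} {m : Mem} (hL : ∀ i ∈ L, i.Free)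
    (h : Bnd m u) (hK : u + (L.map Instr.grow).sum ≤ K) :
    LSafe s K L m ∧ Bnd (lrun s L m) (u + (L.map Instr.grow).sum) ∧ lops L = 0 := by
  induction L generalizing m u with
  | nil => simpa [LSafe, lrun, lops] using ⟨h.mono (by simpa using hK), h⟩
  | cons i L ih =>
    have hi := hL i (by simp)
    have h1 := h.lstep (s := s) hi
    simp only [List.map_cons, List.sum_cons] at hK ⊢
    obtain ⟨ha, hb, hc⟩ := ih (fun j hj => hL j (by simp [hj])) h1 (by omega)
    refine ⟨⟨h.mono (by omega), ha⟩, ?_, ?_⟩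
    · rw [← add_assoc]; exact hb
    · simp only [lops, List.map_cons, List.sum_cons] at hc ⊢
      rw [hc]
      cases i <;> first | rfl | exact hi.elim

/-- A bookkeeping program of one processor. -/
theorem Tri.free {s K u : ℕ} {σ : ℕ → ℕ} {f g : ℕ → Mem} {L : List Instr} {a : ℕ}
    (hL : ∀ i ∈ L, i.Local (σ a) ∧ i.Free) (hb : Bnd (f a) u)
    (hK : u + (L.map Instr.grow).sum ≤ K) (hg : g a = lrun s L (f a)) :
    Tri s K σ {a} f L g 0 0 0 := by
  obtain ⟨h1, -, h2⟩ := lsafe_of_free (s := s) (fun i hi => (hL i hi).2) hb hK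
  exact Tri.local (fun i hi => (hL i hi).1) hg h1 h2.le

/-! ### Messages between two processors. -/

/-- The memory of the receiver after a message from a processor with memory `m`. -/
def recv (m : Mem) : List Part → Mem → Mem
  | [], m' => m'
  | t :: ts, m' => recv m ts (update m' t.dst (m' t.dst ++ slice (m t.src) t.start t.len))

/-- Since the sender differs from the receiver, its memory does not change during the delivery, and
every part of the message reads the same contents. -/
theorem deliver_mem {p q : ℕ} (hpq : p ≠ q) (ts : List Part) (c : Config) :
    (Config.deliver p q ts c).mem q = recv (c.mem p) ts (c.mem q) := by
  induction ts generalizing c with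
  | nil => rfl
  | cons t ts ih => rw [Config.deliver, ih]; simp [Config.write, hpq, recv]

theorem Bnd.recv {m m' : Mem} {u : ℕ} (h : Bnd m' u) (ts : List Part) :
    Bnd (recv m ts m') (u + (ts.map Part.len).sum) := by
  induction ts generalizing m' u with
  | nil => exact h
  | cons t ts ih =>
    have h1 : Bnd (Function.update m' t.dst (m' t.dst ++ slice (m t.src) t.start t.len))
        (u + t.len) := h.update (by have := slice_length_le (m t.src) t.start t.len; simp; omega)
    simpa [Copsim.recv, add_assoc] using ih h1

theorem messageWords_le (c : Config) (p : ℕ) (ts : List Part) :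
    messageWords c p ts ≤ (ts.map Part.len).sum := by
  unfold messageWords
  exact List.sum_le_sum fun t _ => slice_length_le _ _ _

/-- Both clocks become the later of two values below the same bound, so the meeting itself costs
nothing beyond the words and the one message. -/
theorem Tri.send {s K u : ℕ} {σ : ℕ → ℕ} {f g : ℕ → Mem} {a b : ℕ} {ts : List Part}
    (hσ : σ a ≠ σ b) (ha : Bnd (f a) K) (hb : Bnd (f b) u) (hK : u + (ts.map Part.len).sum ≤ K)
    (hga : g a = f a) (hgb : g b = recv (f a) ts (f b)) :
    Tri s K σ {a, b} f [Instr.send (σ a) (σ b) ts] g 0 (ts.map Part.len).sum 1 := by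
  refine ⟨?_, fun c T W N hc => ?_⟩
  · simp only [List.mem_singleton, forall_eq]
    exact ⟨⟨a, by simp, rfl⟩, ⟨b, by simp, rfl⟩, hσ⟩
  obtain ⟨a1, a2, a3, a4⟩ := hc a (by simp)
  obtain ⟨b1, b2, b3, b4⟩ := hc b (by simp)
  have hmw := messageWords_le c (σ a) ts
  have hma : (run s [.send (σ a) (σ b) ts] c).mem (σ a) = f a := by
    simp [run, step, Config.meet, deliver_mem_of_ne hσ, a1]
  have hmb : (run s [.send (σ a) (σ b) ts] c).mem (σ b) = recv (f a) ts (f b) := by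
    simp [run, step, Config.meet, deliver_mem hσ, a1, b1]
  refine ⟨?_, ?_⟩
  · rintro j (rfl | rfl)
    · refine ⟨hma.trans hga.symm, ?_, ?_, ?_⟩ <;>
        simp [run, step, Config.meet, deliver_clocks] <;> omega
    · refine ⟨hmb.trans hgb.symm, ?_, ?_, ?_⟩ <;>
        simp [run, step, Config.meet, deliver_clocks] <;> omega
  · rintro j (rfl | rfl)
    · exact ⟨a1 ▸ ha, show Bnd ((run s [.send (σ j) (σ b) ts] c).mem (σ j)) K from hma ▸ ha⟩
    · refine ⟨b1 ▸ hb.mono (by omega), ?_⟩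
      exact show Bnd ((run s [.send (σ a) (σ j) ts] c).mem (σ j)) K from
        hmb ▸ (hb.recv ts).mono hK

/-- A message from `σ a` to `σ b`, with bookkeeping before and after. -/
theorem Tri.message {s K ua ub : ℕ} {σ : ℕ → ℕ} {f g : ℕ → Mem} {a b : ℕ}
    {L₁ L₂ L₃ L₄ : List Instr} {ts : List Part} (hσ : σ a ≠ σ b)
    (h₁ : ∀ i ∈ L₁, i.Local (σ a) ∧ i.Free) (h₂ : ∀ i ∈ L₂, i.Local (σ b) ∧ i.Free)
    (h₃ : ∀ i ∈ L₃, i.Local (σ a) ∧ i.Free) (h₄ : ∀ i ∈ L₄, i.Local (σ b) ∧ i.Free)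
    (ha : Bnd (f a) ua) (hb : Bnd (f b) ub)
    (hKa : ua + (L₁.map Instr.grow).sum + (L₃.map Instr.grow).sum ≤ K)
    (hKb : ub + (L₂.map Instr.grow).sum + (ts.map Part.len).sum + (L₄.map Instr.grow).sum ≤ K)
    (hga : g a = lrun s L₃ (lrun s L₁ (f a)))
    (hgb : g b = lrun s L₄ (recv (lrun s L₁ (f a)) ts (lrun s L₂ (f b)))) :
    Tri s K σ {a, b} f (L₁ ++ L₂ ++ [Instr.send (σ a) (σ b) ts] ++ L₃ ++ L₄) g
      0 (ts.map Part.len).sum 1 := by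
  have hab : a ≠ b := fun h => hσ (h ▸ rfl)
  have hinj : Set.InjOn σ {a, b} := by
    rintro i (rfl | rfl) j (rfl | rfl) hij
    exacts [rfl, (hσ hij).elim, (hσ hij.symm).elim, rfl]
  obtain ⟨a1, a2, -⟩ := lsafe_of_free (s := s) (K := K) (fun i hi => (h₁ i hi).2) ha (by omega)
  obtain ⟨b1, b2, -⟩ := lsafe_of_free (s := s) (K := K) (fun i hi => (h₂ i hi).2) hb (by omega)
  let f₁ : ℕ → Mem := fun j => if j = a then lrun s L₁ (f a) else lrun s L₂ (f b)
  let f₂ : ℕ → Mem := fun j => if j = a then lrun s L₁ (f a) else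
    recv (lrun s L₁ (f a)) ts (lrun s L₂ (f b))
  have c1 : f₁ a = lrun s L₁ (f a) := by simp [f₁]
  have c2 : f₁ b = lrun s L₂ (f b) := by simp [f₁, hab.symm]
  have c3 : f₂ a = lrun s L₁ (f a) := by simp [f₂]
  have c4 : f₂ b = recv (lrun s L₁ (f a)) ts (lrun s L₂ (f b)) := by simp [f₂, hab.symm]
  have t1 : Tri s K σ {a, b} f (L₁ ++ L₂) f₁ 0 0 0 :=
    Tri.parallel (D := {a}) (E := {b}) hinj (by simpa using hab)
      (Tri.free h₁ ha (by omega) c1) (Tri.free h₂ hb (by omega) c2)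
  have t2 : Tri s K σ {a, b} f₁ [Instr.send (σ a) (σ b) ts] f₂ 0 (ts.map Part.len).sum 1 :=
    Tri.send hσ (by rw [c1]; exact a2.mono (by omega)) (by rw [c2]; exact b2) (by omega)
      (by rw [c1, c3]) (by rw [c1, c2, c4])
  have t3 : Tri s K σ {a, b} f₂ (L₃ ++ L₄) g 0 0 0 :=
    Tri.parallel (D := {a}) (E := {b}) hinj (by simpa using hab)
      (Tri.free h₃ (by rw [c3]; exact a2) (by omega) (by rw [c3, hga]))
      (Tri.free h₄ (by rw [c4]; exact b2.recv ts) (by omega) (by rw [c4, hgb]))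
  have := (t1.seq t2).seq t3
  rw [← List.append_assoc] at this
  exact this.weaken (by omega) (by omega) (by omega)

/-! ### Digits -/

/-- The `w` least significant base-`s` digits of `x`. -/
def dg (s w x : ℕ) : List ℕ := (List.range w).map fun i => x / s ^ i % s

@[simp] theorem dg_length (s w x : ℕ) : (dg s w x).length = w := by simp [dg]

@[simp] theorem dg_zero (s x : ℕ) : dg s 0 x = [] := rfl

theorem dg_succ (s w x : ℕ) : dg s (w + 1) x = dg s w x ++ [x / s ^ w % s] := by
  simp [dg, List.range_succ]

theorem dg_add (s a b x : ℕ) : dg s (a + b) x = dg s a x ++ dg s b (x / s ^ a) := by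
  simp [dg, List.range_add, Function.comp_def, pow_add, Nat.div_div_eq_div_mul]

theorem dg_getD {s w x t : ℕ} (ht : t < w) : (dg s w x).getD t 0 = x / s ^ t % s := by
  simp [dg, ht]

theorem slice_all {l : List ℕ} {b : ℕ} (h : l.length = b) : slice l 0 b = l := by
  simp [slice, ← h]

theorem slice_dg {s N x a b : ℕ} (h : a + b ≤ N) : slice (dg s N x) a b = dg s b (x / s ^ a) := by
  obtain ⟨k, rfl⟩ := Nat.exists_eq_add_of_le h
  rw [add_assoc, dg_add, dg_add]
  simp [slice]

/-- The digits in positions below `w` see only the residue modulo `s ^ w`. This is what makes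
dropped carries and truncated sums harmless. -/
theorem dg_congr {s w x y : ℕ} (h : x % s ^ w = y % s ^ w) : dg s w x = dg s w y := by
  simp only [dg, List.map_inj_left, List.mem_range]
  intro i hi
  have key : ∀ z, z / s ^ i % s = (z % s ^ w) / s ^ i % s := fun z => by
    obtain ⟨k, rfl⟩ := Nat.exists_eq_add_of_lt hi
    rw [show i + k + 1 = i + (1 + k) by ring, pow_add, Nat.mod_mul_right_div_self, pow_add, pow_one,
      Nat.mod_mul_right_mod]
  rw [key x, key y, h]

theorem dg_mod {s w x n : ℕ} (h : w ≤ n) : dg s w (x % s ^ n) = dg s w x :=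
  dg_congr (Nat.mod_mod_of_dvd _ (pow_dvd_pow _ h))

theorem dg_of_zero (s w : ℕ) : dg s w 0 = List.replicate w 0 := by
  simp [dg, List.map_const']

theorem block_eq (s w j x : ℕ) : block s w j x = dg s w (x / s ^ (j * w)) := by
  simp [block, dg, pow_add, Nat.div_div_eq_div_mul]

@[simp] theorem block_length (s w j x : ℕ) : (block s w j x).length = w := by simp [block]

theorem block_zero_left (s w x : ℕ) : block s w 0 x = dg s w x := by simp [block_eq]

/-- The reason for exchanging data between even and odd neighbours: in the recursion the number of
digits per processor changes by a factor of two. -/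
theorem block_append (s w j x : ℕ) :
    block s w (2 * j) x ++ block s w (2 * j + 1) x = block s (2 * w) j x := by
  rw [block_eq, block_eq, block_eq, two_mul w, dg_add, Nat.div_div_eq_div_mul, ← pow_add]
  ring_nf

theorem slice_block_lo (s w j x : ℕ) :
    slice (block s (2 * w) j x) 0 w = block s w (2 * j) x := by
  rw [← block_append]; simp [slice]

theorem slice_block_hi (s w j x : ℕ) :
    slice (block s (2 * w) j x) w w = block s w (2 * j + 1) x := by
  rw [← block_append]; simp [slice]

theorem slice_block (s w j x : ℕ) : slice (block s w j x) 0 w = block s w j x :=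
  slice_all (by simp)

/-- Together with `block_div`, this identifies the lower and upper half of a number with its blocks
in the lower and upper half of the processors. -/
theorem block_mod {s w j x n : ℕ} (h : (j + 1) * w ≤ n) :
    block s w j (x % s ^ n) = block s w j x := by
  obtain ⟨k, rfl⟩ := Nat.exists_eq_add_of_le h
  rw [block_eq, block_eq, add_mul, one_mul, add_assoc, pow_add, Nat.mod_mul_right_div_self,
    dg_mod (by omega)]

theorem block_div (s w i j x : ℕ) : block s w j (x / s ^ (i * w)) = block s w (i + j) x := by
  rw [block_eq, block_eq, Nat.div_div_eq_div_mul, ← pow_add, add_mul]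

/-- Multiplication by a power of the base moves blocks to later processors. Storing a sub-product in
the middle or second half of the sequence therefore realizes its shift for free. -/
theorem block_shift {s : ℕ} (hs : 0 < s) (w i j x : ℕ) :
    block s w (i + j) (s ^ (i * w) * x) = block s w j x := by
  rw [← block_div, Nat.mul_div_cancel_left _ (by positivity)]

theorem block_shift_of_lt {s : ℕ} (w : ℕ) {i j : ℕ} (h : j < i) (x : ℕ) :
    block s w j (s ^ (i * w) * x) = List.replicate w 0 := by
  rw [← block_mod (n := i * w) (Nat.mul_le_mul_right _ h), Nat.mul_mod_right, block_eq,
    Nat.zero_div, dg_of_zero]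

theorem block_of_lt {s w j x : ℕ} (h : x < s ^ (j * w)) :
    block s w j x = List.replicate w 0 := by
  rw [block_eq, Nat.div_eq_of_lt h, dg_of_zero]

/-! ### Additions -/

theorem lops_cons (i : Instr) (L : List Instr) : lops (i :: L) = i.cost + lops L := by simp [lops]

theorem ripple_succ (p : ℕ) (x : Var) (i : ℕ) (y : Var) (j : ℕ) (c z : Var) (len : ℕ) :
    ripple p x i y j c z (len + 1) =
      ripple p x i y j c z len ++ [Instr.add p x (i + len) y (j + len) c z] := by
  simp [ripple, List.range_succ]

theorem ripple_local {p : ℕ} {x : Var} {i : ℕ} {y : Var} {j : ℕ} {c z : Var} {len : ℕ} :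
    ∀ k ∈ ripple p x i y j c z len, k.Local p := by
  simp [ripple, Instr.Local]

theorem lops_ripple (p : ℕ) (x : Var) (i : ℕ) (y : Var) (j : ℕ) (c z : Var) (len : ℕ) :
    lops (ripple p x i y j c z len) = 3 * len := by
  induction len with
  | zero => rfl
  | succ n ih => rw [ripple_succ, lops_append, ih]; simp [lops, Instr.cost]; ring

/-- The invariant of long addition: the carry into position `t` is the quotient by `s ^ t` of the
sum of both residues and the initial carry. Splitting off the next digit of `X` and `Y` gives the
output digit and the next carry. -/
theorem carry_step (s X Y k t : ℕ) (hs : 0 < s) :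
    (X / s ^ t % s + Y / s ^ t % s + (X % s ^ t + Y % s ^ t + k) / s ^ t) % s =
      (X + Y + k) / s ^ t % s ∧
    (X / s ^ t % s + Y / s ^ t % s + (X % s ^ t + Y % s ^ t + k) / s ^ t) / s =
      (X % s ^ (t + 1) + Y % s ^ (t + 1) + k) / s ^ (t + 1) := by
  have hp : 0 < s ^ t := by positivity
  constructor
  · have h : (X + Y + k) / s ^ t = X / s ^ t + Y / s ^ t + (X % s ^ t + Y % s ^ t + k) / s ^ t := by
      conv_lhs => rw [← Nat.div_add_mod X (s ^ t), ← Nat.div_add_mod Y (s ^ t)]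
      rw [show s ^ t * (X / s ^ t) + X % s ^ t + (s ^ t * (Y / s ^ t) + Y % s ^ t) + k =
        X % s ^ t + Y % s ^ t + k + s ^ t * (X / s ^ t + Y / s ^ t) by ring,
        Nat.add_mul_div_left _ _ hp]
      ring
    rw [h]
    simp [Nat.add_mod]
  · rw [pow_succ, Nat.mod_mul, Nat.mod_mul, ← Nat.div_div_eq_div_mul]
    congr 1
    rw [show X % s ^ t + s ^ t * (X / s ^ t % s) + (Y % s ^ t + s ^ t * (Y / s ^ t % s)) + k =
        X % s ^ t + Y % s ^ t + k + s ^ t * (X / s ^ t % s + Y / s ^ t % s) by ring,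
        Nat.add_mul_div_left _ _ hp]
    ring

/-- Effect of a local addition. -/
theorem lrun_ripple {s : ℕ} (hs : 0 < s) {p : ℕ} {x : Var} {i : ℕ} {y : Var} {j : ℕ} {c z : Var}
    {X Y k : ℕ} (hxc : x ≠ c) (hxz : x ≠ z) (hyc : y ≠ c) (hyz : y ≠ z) (hcz : c ≠ z)
    (len : ℕ) {m : Mem}
    (hX : ∀ t < len, (m x).getD (i + t) 0 = X / s ^ t % s)
    (hY : ∀ t < len, (m y).getD (j + t) 0 = Y / s ^ t % s)
    (hk : m c = [k]) :
    lrun s (ripple p x i y j c z len) m =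
      update (update m z (m z ++ dg s len (X + Y + k))) c
        [(X % s ^ len + Y % s ^ len + k) / s ^ len] := by
  induction len with
  | zero =>
    simp [ripple, lrun, Nat.mod_one, ← hk]
  | succ n ih =>
    rw [ripple_succ, lrun_append, ih (fun t ht => hX t (by omega)) fun t ht => hY t (by omega)]
    obtain ⟨h1, h2⟩ := carry_step s X Y k n hs
    simp only [lrun, List.foldl_cons, List.foldl_nil, lstep, update_self, update_of_ne hxc,
      update_of_ne hxz, update_of_ne hyc, update_of_ne hyz, update_of_ne hcz.symm,
      hX n (by omega), hY n (by omega), List.getD_cons_zero, h1, h2]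
    rw [update_comm hcz, update_idem, update_idem, dg_succ, List.append_assoc]

/-- The carry is rewritten in place and always occupies exactly one word, so every digit addition
allocates a single word. That fact has to be part of the induction. -/
theorem lsafe_ripple {s : ℕ} {p : ℕ} {x : Var} {i : ℕ} {y : Var} {j : ℕ} {c z : Var}
    {u K len : ℕ} {m : Mem} (hcz : c ≠ z) (hm : Bnd m u) (hc : (m c).length = 1)
    (hK : u + len ≤ K) : LSafe s K (ripple p x i y j c z len) m := by
  suffices h : LSafe s K (ripple p x i y j c z len) m ∧
      Bnd (lrun s (ripple p x i y j c z len) m) (u + len) ∧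
      (lrun s (ripple p x i y j c z len) m c).length = 1 from h.1
  induction len with
  | zero => exact ⟨hm.mono hK, hm, hc⟩
  | succ n ih =>
    obtain ⟨h1, h2, h3⟩ := ih (by omega)
    rw [ripple_succ, lrun_append]
    set m' := lrun s (ripple p x i y j c z n) m
    have h4 : Bnd (lrun s [Instr.add p x (i + n) y (j + n) c z] m') (u + (n + 1)) := by
      simp only [lrun, List.foldl_cons, List.foldl_nil, lstep]
      refine Bnd.update (u := u + n + 1) (h2.update (by simp; omega)) ?_
      rw [update_of_ne hcz]
      simp; omega
    refine ⟨h1.append ⟨h2.mono (by omega), h4.mono hK⟩, h4, ?_⟩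
    simp [lrun, lstep]

/-! ### Variables by recursion depth, and sequential long multiplication. -/

/-- The variables that belong to invocations at depth less than `d`. -/
def Var.Below (d : ℕ) : Var → Prop
  | .A e => e < d
  | .B e => e < d
  | .C e => e < d
  | .Q _ e => e < d
  | _ => False

/-- The variables of the invocations at depth `d` and more, and the temporaries, are empty. -/
def Clean (d : ℕ) (m : Mem) : Prop := ∀ x : Var, ¬ x.Below d → m x = []

/-- Writing a variable of depth `d` leaves the memory clean only from depth `d + 1` on, which is
exactly what an invocation one level deeper needs. -/
theorem Clean.update {d d' : ℕ} {m : Mem} (h : Clean d m) (hd : d ≤ d') {x : Var}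
    (hx : x.Below d') (l : List ℕ) : Clean d' (update m x l) := by
  intro y hy
  rw [update_of_ne (by rintro rfl; exact hy hx)]
  refine h y fun hy' => hy ?_
  cases y <;> simp only [Var.Below] at hy' ⊢ <;> omega

theorem Clean.succ {d : ℕ} {m : Mem} (h : Clean d m) : Clean (d + 1) m := by
  intro y hy
  refine h y fun hy' => hy ?_
  cases y <;> simp only [Var.Below] at hy' ⊢ <;> omega

theorem update_nil {m : Mem} {x : Var} (h : m x = []) : update m x [] = m :=
  update_eq_self_iff.2 h.symm

theorem LSafe.last {s K : ℕ} {L : List Instr} {m : Mem} (h : LSafe s K L m) :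
    Bnd (lrun s L m) K := by
  induction L generalizing m with
  | nil => exact h
  | cons i L ih => exact ih h.2

/-- The local program `L` changes the memory contents `m` to `m'` and runs in `K` words. -/
def LTri (s K : ℕ) (m : Mem) (L : List Instr) (m' : Mem) : Prop :=
  lrun s L m = m' ∧ LSafe s K L m

theorem LTri.seq {s K : ℕ} {m m' m'' : Mem} {L₁ L₂ : List Instr} (h₁ : LTri s K m L₁ m')
    (h₂ : LTri s K m' L₂ m'') : LTri s K m (L₁ ++ L₂) m'' :=
  ⟨by rw [lrun_append, h₁.1, h₂.1], h₁.2.append (h₁.1 ▸ h₂.2)⟩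

theorem addShifted_local {p m d : ℕ} : ∀ i ∈ addShifted p m d, i.Local p := by
  simp only [addShifted, List.mem_append, or_imp, forall_and]
  refine ⟨⟨?_, ripple_local⟩, ?_⟩ <;> simp [Instr.Local]

theorem slim_local {p e d : ℕ} : ∀ i ∈ slim p e d, i.Local p := by
  induction e generalizing d with
  | zero => simp [slim, Instr.Local]
  | succ e ih =>
    simp only [slim, List.mem_append, or_imp, forall_and]
    have h1 := @ih (d + 1)
    have h2 := @addShifted_local p (2 ^ e) d
    refine ⟨⟨⟨⟨⟨⟨⟨⟨⟨?_, h1⟩, ?_⟩, ⟨?_, h1⟩⟩, ?_⟩, ⟨?_, h1⟩⟩, h2⟩, ⟨?_, h1⟩⟩, h2⟩, ?_⟩ <;>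
      simp [Instr.Local]

theorem lops_addShifted (p m d : ℕ) : lops (addShifted p m d) = 9 * m := by
  simp only [addShifted, lops_append, lops_ripple]
  simp [lops, Instr.cost]; ring

/-- The recurrence T(e+1) = 4·T(e) + 18·2^e comes from four half-size products and two additions of
9·2^e operations. With T(0) = 3 its exact solution is 12·4^e - 9·2^e; the equation is stated
additively to avoid truncated subtraction. -/
theorem lops_slim (p e d : ℕ) : lops (slim p e d) + 9 * 2 ^ e = 12 * 4 ^ e := by
  induction e generalizing d with
  | zero => simp [slim, lops, Instr.cost]
  | succ e ih =>
    have h := ih (d + 1)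
    simp only [slim, lops_append, lops_addShifted, lops_cons, Instr.cost]
    simp only [lops, List.map_nil, List.sum_nil] at h ⊢
    rw [pow_succ, pow_succ]
    omega

/-- The lowest `n` digits are unaffected by the shifted summand, and the remaining `3 * n` are a sum
with `W` padded by zeros. The padding is correct because `W` has at most `2 * n` digits; the
outgoing carry is dropped, since only `4 * n` digits are kept. -/
theorem lrun_addShifted {s : ℕ} (hs : 0 < s) {p n d V W : ℕ} {m : Mem} (hm : Clean (d + 1) m)
    (hV : m (C d) = dg s (4 * n) V) (hW : W < s ^ (2 * n)) :
    lrun s (addShifted p n d) (update m (C (d + 1)) (dg s (2 * n) W)) =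
      update m (C d) (dg s (4 * n) (V + s ^ n * W)) := by
  have hC := hm (C (d + 1)) (by simp [Var.Below])
  have hU := hm U0 (by simp [Var.Below])
  have hZ := hm Z (by simp [Var.Below])
  have hWpad : dg s (2 * n) W ++ List.replicate n 0 = dg s (3 * n) W := by
    rw [show 3 * n = 2 * n + n by ring, dg_add, Nat.div_eq_of_lt hW, dg_of_zero]
  have h1 : lrun s [put p (C (d + 1)) (List.replicate n 0), put p U0 [0], copy p (C d) 0 n Z]
      (update m (C (d + 1)) (dg s (2 * n) W)) =
      update (update (update m (C (d + 1)) (dg s (3 * n) W)) U0 [0]) Z (dg s n V) := by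
    have : slice (dg s (4 * n) V) 0 n = dg s n V := by
      simpa using slice_dg (s := s) (x := V) (show 0 + n ≤ 4 * n by omega)
    simp [lrun, lstep, hV, hU, hZ, hWpad, this]
  simp only [addShifted, lrun_append, h1]
  rw [lrun_ripple (X := V / s ^ n) (Y := W) (k := 0) hs (by simp) (by simp) (by simp) (by simp)
    (by simp) (3 * n)]
  · have hd : dg s n V ++ dg s (3 * n) (V / s ^ n + W + 0) = dg s (4 * n) (V + s ^ n * W) := by
      rw [show 4 * n = n + 3 * n by ring, dg_add, Nat.add_mul_div_left _ _ (by positivity)]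
      congr 1
      exact dg_congr (by simp)
    simp only [update_self, hd]
    ext1 x
    clear hWpad h1 hd hW
    simp [lrun, lstep, update_apply]
    split_ifs <;> simp_all
  · intro t ht
    have : (dg s (4 * n) V).getD (n + t) 0 = V / s ^ n / s ^ t % s := by
      rw [dg_getD (by omega), pow_add, Nat.div_div_eq_div_mul]
    simpa [hV] using this
  · intro t ht
    simpa using dg_getD (s := s) (x := W) ht
  · simp

/-- At the peak there are, besides the original contents, the padded summand of `3 * n` words, the
result of `4 * n` words and one carry. -/
theorem lsafe_addShifted {s : ℕ} {p n d u K : ℕ} {m : Mem} (hm : Clean (d + 1) m) (hu : Bnd m u)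
    (hK : u + 7 * n + 1 ≤ K) {l : List ℕ} (hl : l.length = 2 * n) :
    LSafe s K (addShifted p n d) (update m (C (d + 1)) l) := by
  have hC := hm (C (d + 1)) (by simp [Var.Below])
  have hU := hm U0 (by simp [Var.Below])
  have h0 : Bnd (update m (C (d + 1)) l) (u + 2 * n) := hu.set hl.le
  unfold addShifted
  set L₁ := [put p (C (d + 1)) (List.replicate n 0), put p U0 [0], copy p (C d) 0 n Z]
  obtain ⟨a1, a2, -⟩ := lsafe_of_free (s := s) (K := K) (L := L₁) (by simp [L₁, Instr.Free]) h0
    (by simp [L₁, Instr.grow]; omega)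
  have hg : (L₁.map Instr.grow).sum = 2 * n + 1 := by simp [L₁, Instr.grow]; ring
  rw [hg] at a2
  have b1 := lsafe_ripple (s := s) (p := p) (x := C d) (i := n) (y := C (d + 1)) (j := 0)
    (c := U0) (z := Z) (len := 3 * n) (K := K) (by simp) a2
    (by simp [L₁, lrun, lstep, hU]) (by omega)
  have b2 := (a1.append b1)
  exact b2.append (lsafe_of_free (by simp [Instr.Free]) b2.last (by simp [Instr.grow])).1


/-- The inputs of an invocation at depth `d`. -/
def inputs (d : ℕ) (m : Mem) (a b : List ℕ) : Mem := update (update m (A d) a) (B d) b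

theorem inputs_A (d : ℕ) (m : Mem) (a b : List ℕ) : inputs d m a b (A d) = a := by simp [inputs]

theorem inputs_B (d : ℕ) (m : Mem) (a b : List ℕ) : inputs d m a b (B d) = b := by simp [inputs]

theorem Clean.inputs {d : ℕ} {m : Mem} (h : Clean d m) (a b : List ℕ) :
    Clean (d + 1) (inputs d m a b) :=
  (h.update (Nat.le_succ d) (by simp [Var.Below]) a).update le_rfl (by simp [Var.Below]) b

theorem Bnd.inputs {d u n : ℕ} {m : Mem} (h : Bnd m u) {a b : List ℕ} (ha : a.length = n)
    (hb : b.length = n) : Bnd (inputs d m a b) (u + 2 * n) :=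
  ((h.set ha.le).set hb.le).mono (by omega)

/-- Effect and memory use of SLIM. -/
theorem ltri_slim {s : ℕ} (hs : 2 ≤ s) (p e : ℕ) : ∀ (d : ℕ) {X Y u : ℕ} {m : Mem},
    Clean d m → Bnd m u → X < s ^ 2 ^ e → Y < s ^ 2 ^ e →
    LTri s (u + 8 * 2 ^ e) (inputs d m (dg s (2 ^ e) X) (dg s (2 ^ e) Y)) (slim p e d)
      (update m (C d) (dg s (2 * 2 ^ e) (X * Y))) := by
  induction e with
  | zero =>
    intro d X Y u m hm hu hX hY
    have hA := hm (A d) (by simp [Var.Below])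
    have hB := hm (B d) (by simp [Var.Below])
    have hin : Bnd (inputs d m (dg s (2 ^ 0) X) (dg s (2 ^ 0) Y)) (u + 2) :=
      hu.inputs (n := 1) (by simp) (by simp)
    simp only [pow_zero, pow_one, mul_one] at *
    -- The two stored values are genuine digits because the product of two digits is less than the
    -- square of the base.
    have hm1 : lstep s (inputs d m (dg s 1 X) (dg s 1 Y)) (Instr.mul p (A d) (B d) (C d)) =
        update (inputs d m (dg s 1 X) (dg s 1 Y)) (C d) (dg s 2 (X * Y)) := by
      simp [lstep, inputs, dg, List.range_succ, Nat.mod_eq_of_lt hX, Nat.mod_eq_of_lt hY,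
        Nat.mod_eq_of_lt (Nat.div_lt_of_lt_mul (Nat.mul_lt_mul'' hX hY))]
    have hC' : Bnd (update (inputs d m (dg s 1 X) (dg s 1 Y)) (C d) (dg s 2 (X * Y)))
        (u + 4) := (hin.set (a := 2) (l := dg s 2 (X * Y)) (by simp)).mono (by omega)
    refine ⟨?_, ⟨hin.mono (by omega), ?_⟩⟩
    · rw [slim, lrun, List.foldl_cons, hm1]
      ext1 x
      simp [lstep, inputs, update_apply]
      split_ifs <;> simp_all
    · rw [hm1]
      exact (lsafe_of_free (by simp [Instr.Free]) hC' (by simp [Instr.grow])).1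
  | succ e ih =>
    intro d X Y u m hm hu hX hY
    have hs0 : 0 < s := by omega
    set n := 2 ^ e with hn
    have hn1 : 1 ≤ n := Nat.one_le_two_pow
    rw [show 2 ^ (e + 1) = n + n by rw [pow_succ]; ring] at hX hY ⊢
    have hA := hm (A d) (by simp [Var.Below])
    have hB := hm (B d) (by simp [Var.Below])
    have hC := hm (C d) (by simp [Var.Below])
    have hS : 0 < s ^ n := by positivity
    have hX0 : X % s ^ n < s ^ n := Nat.mod_lt _ hS
    have hY0 : Y % s ^ n < s ^ n := Nat.mod_lt _ hS
    rw [pow_add] at hX hY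
    have hX1 : X / s ^ n < s ^ n := Nat.div_lt_of_lt_mul hX
    have hY1 : Y / s ^ n < s ^ n := Nat.div_lt_of_lt_mul hY
    set M : List ℕ → Mem := fun l =>
      update (inputs d m (dg s (n + n) X) (dg s (n + n) Y)) (C d) l with hM
    have hMc : ∀ l, Clean (d + 1) (M l) := fun l =>
      (hm.inputs _ _).update le_rfl (by simp [Var.Below]) l
    -- At size `n + n` the inputs take `4 * n` words and the partial product at most `4 * n`. The
    -- recursive call needs another `8 * n`, so the constant 8 reproduces itself; an addition needs
    -- only `7 * n + 1` more, which fits because `n` is at least 1.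
    have hMb : ∀ l, l.length ≤ 4 * n → Bnd (M l) (u + 8 * n) := fun l hl =>
      ((hu.inputs (n := n + n) (by simp) (by simp)).set hl).mono (by omega)
    have hsub : ∀ (i j Xi Yj : ℕ) (l : List ℕ), l.length ≤ 4 * n → Xi < s ^ n → Yj < s ^ n →
        slice (dg s (n + n) X) (i * n) n = dg s n Xi →
        slice (dg s (n + n) Y) (j * n) n = dg s n Yj →
        LTri s (u + 8 * (n + n)) (M l) ([copy p (A d) (i * n) n (A (d + 1)),
          copy p (B d) (j * n) n (B (d + 1))] ++ slim p e (d + 1))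
          (update (M l) (C (d + 1)) (dg s (2 * n) (Xi * Yj))) := by
      intro i j Xi Yj l hl hXi hYj h1 h2
      have hA' := hMc l (A (d + 1)) (by simp [Var.Below])
      have hB' := hMc l (B (d + 1)) (by simp [Var.Below])
      have e1 : M l (A d) = dg s (n + n) X := by simp [hM, inputs]
      have e2 : M l (B d) = dg s (n + n) Y := by simp [hM, inputs]
      obtain ⟨r1, r2⟩ := ih (d + 1) (hMc l) (hMb l hl) hXi hYj
      refine LTri.seq (m' := inputs (d + 1) (M l) (dg s n Xi) (dg s n Yj)) ⟨?_, ?_⟩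
        ⟨r1, r2.mono (by omega)⟩
      · simp [lrun, lstep, hA', hB', e1, e2, h1, h2, Copsim.inputs]
      · exact (lsafe_of_free (by simp [Instr.Free]) (hMb l hl) (by simp [Instr.grow]; omega)).1
    have happ : ∀ l l' : List ℕ, l.length ≤ 4 * n → l'.length = 2 * n →
        LTri s (u + 8 * (n + n)) (update (M l) (C (d + 1)) l')
          [copy p (C (d + 1)) 0 (2 * n) (C d), clear p (C (d + 1))] (M (l ++ l')) := by
      intro l l' hl hl'
      have hC' := hMc l (C (d + 1)) (by simp [Var.Below])
      have e1 : slice l' 0 (2 * n) = l' := slice_all hl'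
      have e2 : M l (C d) = l := by simp [hM]
      have e3 : update (M l) (C d) (l ++ l') = M (l ++ l') := by simp [hM]
      constructor
      · rw [← e3]
        simp [lrun, lstep, e1, e2]
        rw [update_comm (by simp), update_idem, update_nil (by simpa using hC')]
      · exact (lsafe_of_free (by simp [Instr.Free]) ((hMb l hl).set hl'.le)
          (by simp [Instr.grow]; omega)).1
    have hadd : ∀ V W : ℕ, W < s ^ (2 * n) →
        LTri s (u + 8 * (n + n)) (update (M (dg s (4 * n) V)) (C (d + 1)) (dg s (2 * n) W))
          (addShifted p n d) (M (dg s (4 * n) (V + s ^ n * W))) := by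
      intro V W hW
      refine ⟨?_, lsafe_addShifted (hMc _) (hMb _ (by simp)) (by omega) (by simp)⟩
      rw [lrun_addShifted (V := V) hs0 (hMc _) (by simp [hM]) hW]
      simp [hM]
    have hlo : ∀ x, slice (dg s (n + n) x) (0 * n) n = dg s n (x % s ^ n) := fun x => by
      rw [slice_dg (by omega), dg_mod le_rfl]; simp
    have hhi : ∀ x, slice (dg s (n + n) x) (1 * n) n = dg s n (x / s ^ n) := fun x => by
      rw [slice_dg (by omega), one_mul]
    have hp : ∀ {x y : ℕ}, x < s ^ n → y < s ^ n → x * y < s ^ (2 * n) := fun hx hy => by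
      rw [two_mul, pow_add]; exact Nat.mul_lt_mul'' hx hy
    -- The products of the two low and of the two high halves occupy disjoint digit positions, so
    -- they are concatenated without any addition.
    have hcat : [] ++ dg s (2 * n) (X % s ^ n * (Y % s ^ n)) ++
        dg s (2 * n) (X / s ^ n * (Y / s ^ n)) = dg s (4 * n)
          (X % s ^ n * (Y % s ^ n) + s ^ (2 * n) * (X / s ^ n * (Y / s ^ n))) := by
      rw [show 4 * n = 2 * n + 2 * n by ring, dg_add, Nat.add_mul_div_left _ _ (by positivity),
        Nat.div_eq_of_lt (hp hX0 hY0), zero_add, List.nil_append]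
      congr 1
      exact dg_congr (by simp)
    have hprod : X % s ^ n * (Y % s ^ n) + s ^ (2 * n) * (X / s ^ n * (Y / s ^ n)) +
        s ^ n * (X % s ^ n * (Y / s ^ n)) + s ^ n * (X / s ^ n * (Y % s ^ n)) = X * Y := by
      conv_rhs => rw [← Nat.div_add_mod X (s ^ n), ← Nat.div_add_mod Y (s ^ n)]
      rw [two_mul, pow_add]; ring
    have h1 := ((hsub 0 0 _ _ [] (by simp) hX0 hY0 (hlo X) (hlo Y)).seq
      (happ [] _ (by simp) (by simp))).seq ((hsub 1 1 _ _ _ (by simp; omega)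
          hX1 hY1 (hhi X) (hhi Y)))
    have h2 := h1.seq (happ _ _ (by simp; omega) (by simp))
    rw [hcat] at h2
    have h3 := ((h2.seq (hsub 0 1 _ _ _ (by simp) hX0 hY1 (hlo X) (hhi Y))).seq
      (hadd _ _ (hp hX0 hY1))).seq (hsub 1 0 _ _ _ (by simp) hX1 hY0 (hhi X) (hlo Y))
    have h4 := h3.seq (hadd _ _ (hp hX1 hY0))
    rw [hprod] at h4
    have h5 : LTri s (u + 8 * (n + n)) (M (dg s (4 * n) (X * Y))) [clear p (A d), clear p (B d)]
        (update m (C d) (dg s (2 * (n + n)) (X * Y))) := by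
      refine ⟨?_, (lsafe_of_free (by simp [Instr.Free]) (hMb _ (by simp))
        (by simp [Instr.grow])).1⟩
      rw [show 2 * (n + n) = 4 * n by ring]
      clear h1 h2 h3 h4 hsub happ hadd hcat hprod hlo hhi hp hMc hMb
      ext1 x
      simp [lrun, lstep, hM, inputs, update_apply]
      split_ifs <;> simp_all
    have h0 : inputs d m (dg s (n + n) X) (dg s (n + n) Y) = M [] :=
      (update_nil (by simp [inputs, hC])).symm
    rw [h0]
    exact h4.seq h5

/-! ### Parallel addition with speculative carries. -/

theorem Var.Below.ne_temp {d : ℕ} {x : Var} (h : x.Below d) :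
    x ≠ S0 ∧ x ≠ S1 ∧ x ≠ U0 ∧ x ≠ U1 ∧ x ≠ R0 ∧ x ≠ R1 ∧ x ≠ Z := by
  refine ⟨?_, ?_, ?_, ?_, ?_, ?_, ?_⟩ <;> (rintro rfl; exact h)

/-- The memory after a speculative addition. -/
def sumaPost (m : Mem) (a b : List ℕ) (k l : ℕ) : Mem :=
  update (update (update (update m S0 a) S1 b) U0 [k]) U1 [l]

/-- The memory after an addition. -/
def sumPost (m : Mem) (a : List ℕ) (k : ℕ) : Mem := update (update m S0 a) U0 [k]

theorem Bnd.sumaPost {m : Mem} {u w : ℕ} (h : Bnd m u) {a b : List ℕ} (ha : a.length = w)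
    (hb : b.length = w) (k l : ℕ) : Bnd (sumaPost m a b k l) (u + 2 * w + 2) :=
  ((((h.set ha.le).set hb.le).set (a := 1) (by simp)).set (a := 1) (by simp)).mono (by omega)

theorem Bnd.sumPost {m : Mem} {u w : ℕ} (h : Bnd m u) {a : List ℕ} (ha : a.length = w)
    (k : ℕ) : Bnd (sumPost m a k) (u + w + 1) :=
  ((h.set ha.le).set (a := 1) (by simp)).mono (by omega)

section Leaf

variable {s w d u p : ℕ} {x y : Var} {m : Mem} {X Y : ℕ}

/-- The operands belong to an invocation, the carry and the result are temporaries; the `Below`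
hypotheses supply all the required distinctness at once. -/
theorem ltri_ripple (hs : 0 < s) (hx : x.Below d) (hy : y.Below d)
    {c z : Var} {k : ℕ} {F : Mem} (hc : ¬ c.Below d) (hz : ¬ z.Below d) (hcz : c ≠ z)
    (hFx : F x = dg s w X) (hFy : F y = dg s w Y)
    (hX : X < s ^ w) (hY : Y < s ^ w) (hFc : F c = []) (hFz : F z = []) (hF : Bnd F u) :
    LTri s (u + w + 1) F ([put p c [k]] ++ ripple p x 0 y 0 c z w)
      (update (update F z (dg s w (X + Y + k))) c [(X + Y + k) / s ^ w]) := by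
  have hxc : x ≠ c := fun h => hc (h ▸ hx)
  have hxz : x ≠ z := fun h => hz (h ▸ hx)
  have hyc : y ≠ c := fun h => hc (h ▸ hy)
  have hyz : y ≠ z := fun h => hz (h ▸ hy)
  refine LTri.seq (m' := update F c [k]) ⟨by simp [lrun, lstep, hFc],
    (lsafe_of_free (by simp [Instr.Free]) hF (by simp [Instr.grow])).1⟩ ⟨?_, ?_⟩
  · rw [lrun_ripple (X := X) (Y := Y) (k := k) hs hxc hxz hyc hyz hcz w]
    · rw [update_of_ne hcz.symm, hFz, Nat.mod_eq_of_lt hX, Nat.mod_eq_of_lt hY, update_comm hcz,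
        update_idem, List.nil_append]
    · intro t ht
      rw [update_of_ne hxc, hFx, zero_add, dg_getD ht]
    · intro t ht
      rw [update_of_ne hyc, hFy, zero_add, dg_getD ht]
    · simp
  · exact lsafe_ripple hcz (hF.set (a := 1) (by simp)) (by simp) (by omega)

theorem ltri_sum_leaf (hs : 0 < s) (hxy : x ≠ y) (hx : x.Below d) (hy : y.Below d)
    (hm : Clean d m) (hmx : m x = []) (hmy : m y = []) (hu : Bnd m u)
    (hX : X < s ^ w) (hY : Y < s ^ w) :
    LTri s (u + 3 * w + 1) (update (update m x (dg s w X)) y (dg s w Y))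
      ([put p U0 [0]] ++ ripple p x 0 y 0 U0 S0 w ++ [clear p x, clear p y])
      (sumPost m (dg s w (X + Y)) ((X + Y) / s ^ w)) := by
  have hS := hm S0 (by simp [Var.Below])
  have hU := hm U0 (by simp [Var.Below])
  obtain ⟨x1, x2, x3, x4, x5, x6, x7⟩ := hx.ne_temp
  obtain ⟨y1, y2, y3, y4, y5, y6, y7⟩ := hy.ne_temp
  have hF : Bnd (update (update m x (dg s w X)) y (dg s w Y)) (u + w + w) :=
    (hu.set (by simp)).set (by simp)
  have h1 := ltri_ripple (p := p) (c := U0) (z := S0) (k := 0) hs hx hy (by simp [Var.Below])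
    (by simp [Var.Below]) (by simp) (by simp [hxy]) (by simp) hX hY
    (by simp [x3.symm, y3.symm, hU]) (by simp [x1.symm, y1.symm, hS]) hF
  have h2 : LTri s (u + 3 * w + 1) _ _ _ := ⟨h1.1, h1.2.mono (by omega)⟩
  refine h2.seq ⟨?_, ?_⟩
  · simp only [lrun, lstep, List.foldl_cons, List.foldl_nil, sumPost, add_zero]
    ext1 v
    clear h1 h2 hF hX hY hu hm
    simp only [update_apply]
    split_ifs <;> simp_all
  · exact (lsafe_of_free (by simp [Instr.Free]) (h2.1 ▸ h2.2.last) (by simp [Instr.grow])).1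

theorem ltri_suma_leaf (hs : 0 < s) (hxy : x ≠ y) (hx : x.Below d) (hy : y.Below d)
    (hm : Clean d m) (hmx : m x = []) (hmy : m y = []) (hu : Bnd m u)
    (hX : X < s ^ w) (hY : Y < s ^ w) :
    LTri s (u + 4 * w + 2) (update (update m x (dg s w X)) y (dg s w Y))
      ([put p U0 [0]] ++ ripple p x 0 y 0 U0 S0 w ++ [put p U1 [1]] ++ ripple p x 0 y 0 U1 S1 w ++
        [clear p x, clear p y])
      (sumaPost m (dg s w (X + Y)) (dg s w (X + Y + 1)) ((X + Y) / s ^ w)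
        ((X + Y + 1) / s ^ w)) := by
  have hS0 := hm S0 (by simp [Var.Below])
  have hU0 := hm U0 (by simp [Var.Below])
  have hS1 := hm S1 (by simp [Var.Below])
  have hU1 := hm U1 (by simp [Var.Below])
  obtain ⟨x1, x2, x3, x4, x5, x6, x7⟩ := hx.ne_temp
  obtain ⟨y1, y2, y3, y4, y5, y6, y7⟩ := hy.ne_temp
  have hF : Bnd (update (update m x (dg s w X)) y (dg s w Y)) (u + w + w) :=
    (hu.set (by simp)).set (by simp)
  have h1 := ltri_ripple (p := p) (c := U0) (z := S0) (k := 0) hs hx hy (by simp [Var.Below])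
    (by simp [Var.Below]) (by simp) (by simp [hxy]) (by simp) hX hY
    (by simp [x3.symm, y3.symm, hU0]) (by simp [x1.symm, y1.symm, hS0]) hF
  have hF' := (hF.set (x := S0) (l := dg s w (X + Y + 0)) (a := w) (by simp)).set
    (x := U0) (l := [(X + Y + 0) / s ^ w]) (a := 1) (by simp)
  have h2 := ltri_ripple (p := p) (c := U1) (z := S1) (k := 1) hs hx hy (by simp [Var.Below])
    (by simp [Var.Below]) (by simp) (by simp [hxy, x1, x3]) (by simp [y1, y3]) hX hY
    (by simp [x4.symm, y4.symm, hU1]) (by simp [x2.symm, y2.symm, hS1]) hF'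
  have h3 : LTri s (u + 4 * w + 2) _ _ _ := LTri.seq ⟨h1.1, h1.2.mono (by omega)⟩
    ⟨h2.1, h2.2.mono (by omega)⟩
  rw [List.append_assoc _ [put p U1 [1]]]
  refine h3.seq ⟨?_, ?_⟩
  · simp only [lrun, lstep, List.foldl_cons, List.foldl_nil, sumaPost, add_zero]
    ext1 v
    clear h1 h2 h3 hF hF' hX hY hu hm
    simp only [update_apply]
    split_ifs <;> simp_all
  · exact (lsafe_of_free (by simp [Instr.Free]) (h3.1 ▸ h3.2.last) (by simp [Instr.grow])).1

end Leaf

theorem Bnd.sel {s u n p : ℕ} {m : Mem} {f x y z : Var} (h : Bnd m u)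
    (hx : (m x).length ≤ n) (hy : (m y).length ≤ n) :
    Bnd (Copsim.lstep s m (Instr.sel p f x y z)) (u + n) := by
  refine h.set ?_
  split_ifs <;> assumption

/-- The selections of SUMA. -/
theorem ltri_suma_sel {s d w u p : ℕ} {m : Mem} {a b : List ℕ} {k l r₀ r₁ : ℕ} (hm : Clean d m)
    (hu : Bnd m u) (ha : a.length = w) (hb : b.length = w) (hr : r₁ = 0 → r₀ = 0) :
    LTri s (u + 4 * w + 6) (update (update (sumaPost m a b k l) R0 [r₀]) R1 [r₁])
      [Instr.sel p R1 S0 S1 S1, Instr.sel p R0 S0 S1 S0, Instr.sel p R1 U0 U1 U1,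
        Instr.sel p R0 U0 U1 U0, clear p R0, clear p R1]
      (sumaPost m (if r₀ = 0 then a else b) (if r₁ = 0 then a else b) (if r₀ = 0 then k else l)
        (if r₁ = 0 then k else l)) := by
  have hR0 := hm R0 (by simp [Var.Below])
  have hR1 := hm R1 (by simp [Var.Below])
  constructor
  · ext1 v
    clear hu
    by_cases h0 : r₀ = 0 <;> by_cases h1 : r₁ = 0
    · simp [lrun, lstep, sumaPost, update_apply, h0, h1]
      split_ifs <;> simp_all
    · simp [lrun, lstep, sumaPost, update_apply, h0, h1]
      split_ifs <;> simp_all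
    -- This is the one case in which updating `S1` first would destroy the value that `S0` has to
    -- take. Monotonicity of the carry rules it out.
    · exact (h0 (hr h1)).elim
    · simp [lrun, lstep, sumaPost, update_apply, h0, h1]
      split_ifs <;> simp_all
  · have b0 : Bnd (update (update (sumaPost m a b k l) R0 [r₀]) R1 [r₁]) (u + 2 * w + 4) :=
      (((hu.sumaPost ha hb k l).set (a := 1) (by simp)).set (a := 1) (by simp)).mono (by omega)
    have b1 := b0.sel (s := s) (p := p) (f := R1) (x := S0) (y := S1) (z := S1) (n := w)
      (by simp [sumaPost, ha]) (by simp [sumaPost, hb])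
    have b2 := b1.sel (s := s) (p := p) (f := R0) (x := S0) (y := S1) (z := S0) (n := w)
      (by simp [lstep, sumaPost, ha]) (by simp [lstep, sumaPost]; split_ifs <;> simp [ha, hb])
    have b3 := b2.sel (s := s) (p := p) (f := R1) (x := U0) (y := U1) (z := U1) (n := 1)
      (by simp [lstep, sumaPost]) (by simp [lstep, sumaPost])
    have b4 := b3.sel (s := s) (p := p) (f := R0) (x := U0) (y := U1) (z := U0) (n := 1)
      (by simp [lstep, sumaPost]) (by simp [lstep, sumaPost]; split_ifs <;> simp)
    exact ⟨b0.mono (by omega), b1.mono (by omega), b2.mono (by omega), b3.mono (by omega),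
      (lsafe_of_free (by simp [Instr.Free]) b4 (by simp [Instr.grow]; omega)).1⟩

/-- The selections of SUM. -/
theorem ltri_sum_sel {s d w u p : ℕ} {m : Mem} {a b : List ℕ} {k l r₀ : ℕ} (hm : Clean d m)
    (hu : Bnd m u) (ha : a.length = w) (hb : b.length = w) :
    LTri s (u + 4 * w + 6) (update (sumaPost m a b k l) R0 [r₀])
      [Instr.sel p R0 S0 S1 S0, Instr.sel p R0 U0 U1 U0, clear p R0, clear p S1, clear p U1]
      (sumPost m (if r₀ = 0 then a else b) (if r₀ = 0 then k else l)) := by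
  have hR0 := hm R0 (by simp [Var.Below])
  have hS1 := hm S1 (by simp [Var.Below])
  have hU1 := hm U1 (by simp [Var.Below])
  constructor
  · ext1 v
    clear hu
    by_cases h0 : r₀ = 0
    · simp [lrun, lstep, sumaPost, sumPost, update_apply, h0]
      split_ifs <;> simp_all
    · simp [lrun, lstep, sumaPost, sumPost, update_apply, h0]
      split_ifs <;> simp_all
  · have b0 : Bnd (update (sumaPost m a b k l) R0 [r₀]) (u + 2 * w + 3) :=
      ((hu.sumaPost ha hb k l).set (a := 1) (by simp)).mono (by omega)
    have b1 := b0.sel (s := s) (p := p) (f := R0) (x := S0) (y := S1) (z := S0) (n := w)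
      (by simp [sumaPost, ha]) (by simp [sumaPost, hb])
    have b2 := b1.sel (s := s) (p := p) (f := R0) (x := U0) (y := U1) (z := U0) (n := 1)
      (by simp [lstep, sumaPost]) (by simp [lstep, sumaPost])
    exact ⟨b0.mono (by omega), b1.mono (by omega),
      (lsafe_of_free (by simp [Instr.Free]) b2 (by simp [Instr.grow]; omega)).1⟩

/-- The pairs `{a, h + a}` partition `{0, …, 2 * h - 1}`. -/
theorem Tri.par_pairs {s K h : ℕ} {σ : ℕ → ℕ} {f g : ℕ → Mem} {F : ℕ → List Instr} {t w l : ℕ}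
    (hσ : Set.InjOn σ {j | j < 2 * h})
    (h₁ : ∀ a < h, Tri s K σ {a, h + a} f (F a) g t w l) :
    Tri s K σ {j | j < 2 * h} f (Copsim.par h F) g t w l := by
  refine Tri.par (E := fun a => {a, h + a}) hσ ?_ ?_ h₁ ?_
  · rintro a ha j (rfl | rfl) <;> simp <;> omega
  · intro a ha b hb
    simp [Set.disjoint_left]; omega
  · intro j hj hj'
    simp only [Set.mem_insert_iff, Set.mem_singleton_iff, Set.mem_ofPred_eq] at hj hj'
    by_cases hjh : j < h
    · exact (hj' j hjh (Or.inl rfl)).elim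
    · exact (hj' (j - h) (by omega) (Or.inr (by omega))).elim

/-- Independent programs of the processors `0, …, q - 1` of a longer sequence. -/
theorem Tri.par_local {s K n q : ℕ} {σ : ℕ → ℕ} {ι : ℕ → ℕ} {f g : ℕ → Mem}
    {F : ℕ → List Instr} {t w l : ℕ} (hσ : Set.InjOn σ {j | j < n})
    (hι : ∀ a < q, ι a < n ∧ ∀ b < a, ι b ≠ ι a)
    (h₁ : ∀ a < q, Tri s K σ {ι a} f (F a) g t w l)
    (hg : ∀ j < n, (∀ a < q, j ≠ ι a) → g j = f j ∧ Bnd (f j) K) :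
    Tri s K σ {j | j < n} f (Copsim.par q F) g t w l := by
  refine Tri.par (E := fun a => {ι a}) hσ ?_ ?_ h₁ hg
  · rintro a ha j rfl; exact (hι a ha).1
  · intro a ha b hb
    simpa using (hι a ha).2 b hb

/-- Both recursive calls of a sum share one budget: the depth of the recursion counts, not the
number of calls. -/
theorem Tri.halves {s K h : ℕ} {σ : ℕ → ℕ} {f g : ℕ → Mem} {L₁ L₂ : List Instr} {t w l : ℕ}
    (hσ : Set.InjOn σ {j | j < 2 * h}) (h₁ : Tri s K σ {j | j < h} f L₁ g t w l)
    (h₂ : Tri s K (fun j => σ (h + j)) {j | j < h} (fun j => f (h + j)) L₂ (fun j => g (h + j))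
      t w l) : Tri s K σ {j | j < 2 * h} f (L₁ ++ L₂) g t w l := by
  have hD : {j | j < 2 * h} = {j | j < h} ∪ (fun j => h + j) '' {j | j < h} := by
    ext j
    simp only [Set.mem_ofPred_eq, Set.mem_union, Set.mem_image]
    constructor
    · intro hj
      by_cases hjh : j < h
      · exact Or.inl hjh
      · exact Or.inr ⟨j - h, by omega, by omega⟩
    · rintro (hj | ⟨i, hi, rfl⟩) <;> omega
  rw [hD] at hσ ⊢
  refine Tri.parallel hσ ?_ h₁ (Tri.reindex (ι := fun j => h + j) h₂)
  rw [Set.disjoint_left]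
  rintro j hj ⟨i, hi, rfl⟩
  simp at hj

theorem injOn_shift {σ : ℕ → ℕ} {h : ℕ} (hσ : Set.InjOn σ {j | j < 2 * h}) :
    Set.InjOn (fun j => σ (h + j)) {j | j < h} := by
  intro i hi j hj hij
  have := hσ (x₁ := h + i) (x₂ := h + j) (by simp at hi ⊢; omega) (by simp at hj ⊢; omega) hij
  omega

/-- Splitting both summands at `S` leaves the lower blocks of the sum unchanged, and the lower half
influences the upper half only through its carry. -/
theorem halves_add {s S : ℕ} {h w : ℕ} (hs : 0 < s) (hS : S = s ^ (h * w)) (X Y c : ℕ) :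
    (X + Y + c) / S = X / S + Y / S + (X % S + Y % S + c) / S ∧
    ∀ j < h, block s w j (X % S + Y % S + c) = block s w j (X + Y + c) := by
  have hS0 : 0 < S := by rw [hS]; positivity
  have e : X + Y + c = X % S + Y % S + c + S * (X / S + Y / S) := by
    conv_lhs => rw [← Nat.div_add_mod X S, ← Nat.div_add_mod Y S]
    ring
  constructor
  · rw [e, Nat.add_mul_div_left _ _ hS0]
    conv_rhs => rw [add_comm]
  · intro j hj
    have hjw : (j + 1) * w ≤ h * w := Nat.mul_le_mul_right _ hj
    rw [← block_mod hjw, ← block_mod (x := X + Y + c) hjw, e, ← hS, Nat.add_mul_mod_self_left]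

/-- Two summands below `S` and a carry of at most 1 add up to less than `2 * S`. Hence two
speculative results suffice. -/
theorem carry_le_one {S X Y c : ℕ} (hX : X < S) (hY : Y < S) (hc : c ≤ 1) : (X + Y + c) / S ≤ 1 :=
  Nat.lt_succ_iff.1 (Nat.div_lt_of_lt_mul (by omega))

section SpeculativeSum

variable {s w d K u : ℕ} {x y : Var}

/-- A leaf performs two long additions, at `3 * w` operations each. Every level of the recursion
then adds four selections and two messages of two words, one with the carries of the lower half and
one with the new carries coming back. -/
theorem tri_suma (hs : 2 ≤ s) (hxy : x ≠ y) (hx : x.Below d) (hy : y.Below d)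
    (hK : u + 4 * w + 6 ≤ K) (e : ℕ) :
    ∀ (σ : ℕ → ℕ) (m : ℕ → Mem) (X Y : ℕ), Set.InjOn σ {j | j < 2 ^ e} →
    X < s ^ (2 ^ e * w) → Y < s ^ (2 ^ e * w) →
    (∀ j < 2 ^ e, Clean d (m j) ∧ m j x = [] ∧ m j y = [] ∧ Bnd (m j) u) →
    Tri s K σ {j | j < 2 ^ e}
      (fun j => update (update (m j) x (block s w j X)) y (block s w j Y)) (suma w x y e σ)
      (fun j => sumaPost (m j) (block s w j (X + Y)) (block s w j (X + Y + 1))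
        ((X + Y) / s ^ (2 ^ e * w)) ((X + Y + 1) / s ^ (2 ^ e * w)))
      (6 * w + 4 * e) (4 * e) (2 * e) := by
  have hs0 : 0 < s := by omega
  induction e with
  | zero =>
    intro σ m X Y hσ hX hY hm
    have hD : {j | j < 2 ^ 0} = {0} := by ext j; simp
    obtain ⟨h1, h2, h3, h4⟩ := hm 0 (by simp)
    simp only [pow_zero, one_mul] at hX hY
    obtain ⟨r1, r2⟩ := ltri_suma_leaf (p := σ 0) (w := w) hs0 hxy hx hy h1 h2 h3 h4 hX hY
    rw [hD, suma]
    simp only [pow_zero, one_mul]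
    refine (Tri.local ?_ ?_ ?_ le_rfl).weaken ?_ (by omega) (by omega)
    · simp only [List.mem_append, or_imp, forall_and]
      refine ⟨⟨⟨⟨?_, ripple_local⟩, ?_⟩, ripple_local⟩, ?_⟩ <;> simp [Instr.Local]
    · simp only [block_zero_left]; exact r1.symm
    · simp only [block_zero_left]; exact r2.mono (by omega)
    · simp only [lops_append, lops_ripple]; simp [lops, Instr.cost]; omega
  | succ e ih =>
    intro σ m X Y hσ hX hY hm
    set h := 2 ^ e with hh
    have h2 : 2 ^ (e + 1) = 2 * h := by rw [pow_succ]; ring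
    rw [h2] at hσ hX hY hm ⊢
    set S := s ^ (h * w) with hS
    have hSS : s ^ (2 * h * w) = S * S := by rw [hS, ← pow_add]; ring_nf
    rw [hSS] at hX hY ⊢
    have hS0 : 0 < S := by positivity
    have hX0 : X % S < S := Nat.mod_lt _ hS0
    have hY0 : Y % S < S := Nat.mod_lt _ hS0
    have hX1 : X / S < S := Nat.div_lt_of_lt_mul hX
    have hY1 : Y / S < S := Nat.div_lt_of_lt_mul hY
    obtain ⟨c0, b0⟩ := halves_add (w := w) hs0 hS X Y 0
    obtain ⟨c1, b1⟩ := halves_add (w := w) hs0 hS X Y 1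
    simp only [add_zero] at c0 b0
    have k0 : (X % S + Y % S) / S ≤ 1 := carry_le_one (c := 0) hX0 hY0 (by omega)
    have k1 : (X % S + Y % S + 1) / S ≤ 1 := carry_le_one hX0 hY0 le_rfl
    -- The carry without an incoming carry never exceeds the carry with one; this licenses the
    -- in-place selections.
    have k01 : (X % S + Y % S) / S ≤ (X % S + Y % S + 1) / S := Nat.div_le_div_right (by omega)
    set r₀ := (X % S + Y % S) / S
    set r₁ := (X % S + Y % S + 1) / S
    have hσ1 : Set.InjOn σ {j | j < h} := hσ.mono fun j hj => by simp at hj ⊢; omega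
    -- In the upper half these are still the results for `X / S` and `Y / S` alone, indexed from the
    -- beginning of that half; the selections turn them into blocks of the whole sum.
    let g₁ : ℕ → Mem := fun j => if j < h then
        sumaPost (m j) (block s w j (X + Y)) (block s w j (X + Y + 1)) r₀ r₁
      else sumaPost (m j) (block s w (j - h) (X / S + Y / S))
          (block s w (j - h) (X / S + Y / S + 1))
        ((X / S + Y / S) / S) ((X / S + Y / S + 1) / S)
    let g₂ : ℕ → Mem := fun j => if j < h then
        update (update (m j) S0 (block s w j (X + Y))) S1 (block s w j (X + Y + 1))
      else update (update (g₁ j) R0 [r₀]) R1 [r₁]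
    let g₃ : ℕ → Mem := fun j => if j < h then g₂ j else
      sumaPost (m j) (block s w j (X + Y)) (block s w j (X + Y + 1))
        ((X + Y) / (S * S)) ((X + Y + 1) / (S * S))
    have t1 := Tri.halves (f := fun j => update (update (m j) x (block s w j X)) y (block s w j Y))
      (g := g₁) (L₁ := suma w x y e σ) (L₂ := suma w x y e (fun j => σ (h + j))) hσ
      ((ih σ m (X % S) (Y % S) hσ1 hX0 hY0 fun j hj => hm j (by omega)).congr
        (fun j hj => by
          have : (j + 1) * w ≤ h * w := Nat.mul_le_mul_right _ hj
          rw [hS, block_mod this, block_mod this])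
        (fun j hj => by
          have hj' : j < h := hj
          simp only [g₁, hj', if_true, b0 j hj', b1 j hj']; rfl))
      ((ih (fun j => σ (h + j)) (fun j => m (h + j)) (X / S) (Y / S) (injOn_shift hσ) hX1 hY1
        fun j hj => hm (h + j) (by omega)).congr
        (fun j hj => by rw [hS, block_div, block_div])
        (fun j hj => by simp [g₁, hS]))
    have t2 : Tri s K σ {j | j < 2 * h} g₁ (par h fun j => [send (σ j) (σ (h + j))
        [⟨U0, 0, 1, R0⟩, ⟨U1, 0, 1, R1⟩], clear (σ j) U0, clear (σ j) U1]) g₂ 0 2 1 := by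
      refine Tri.par_pairs hσ fun a ha => ?_
      have hna : ¬ h + a < h := by omega
      have hne : σ a ≠ σ (h + a) := fun he => by
        have := hσ (x₁ := a) (x₂ := h + a) (by simp; omega) (by simp; omega) he
        omega
      obtain ⟨m1, m2, m3, m4⟩ := hm a (by omega)
      obtain ⟨n1, n2, n3, n4⟩ := hm (h + a) (by omega)
      refine Tri.message (L₁ := []) (L₂ := []) (L₃ := [clear (σ a) U0, clear (σ a) U1]) (L₄ := [])
        (ua := u + 2 * w + 2) (ub := u + 2 * w + 2) hne (by simp) (by simp)
        (by simp [Instr.Local, Instr.Free]) (by simp) ?_ ?_ (by simp [Instr.grow]; omega)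
        (by simp; omega) ?_ ?_
      · simp only [g₁, ha, if_true]; exact m4.sumaPost (by simp) (by simp) _ _
      · simp only [g₁, hna, if_false]; exact n4.sumaPost (by simp) (by simp) _ _
      · have := m1 U0 (by simp [Var.Below])
        have := m1 U1 (by simp [Var.Below])
        simp only [g₁, g₂, ha, if_true]
        ext1 v
        simp [lrun, lstep, sumaPost, update_apply]
        split_ifs <;> simp_all
      · have e1 := n1 R0 (by simp [Var.Below])
        have e2 := n1 R1 (by simp [Var.Below])
        simp only [g₂, hna, if_false]
        simp [g₁, ha, recv, lrun, sumaPost, e1, e2, slice]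
    have t3 : Tri s K σ {j | j < 2 * h} g₂ (par h fun j => [sel (σ (h + j)) R1 S0 S1 S1,
        sel (σ (h + j)) R0 S0 S1 S0, sel (σ (h + j)) R1 U0 U1 U1, sel (σ (h + j)) R0 U0 U1 U0,
        clear (σ (h + j)) R0, clear (σ (h + j)) R1]) g₃ 4 0 0 := by
      refine Tri.par_local (ι := fun a => h + a) hσ (fun a ha => ⟨by omega, fun b hb => by omega⟩)
        (fun a ha => ?_) fun j hj hj' => ?_
      · have hna : ¬ h + a < h := by omega
        obtain ⟨n1, n2, n3, n4⟩ := hm (h + a) (by omega)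
        obtain ⟨q1, q2⟩ := ltri_suma_sel (s := s) (p := σ (h + a)) (a := block s w a (X / S + Y /
            S))
          (b := block s w a (X / S + Y / S + 1)) (k := (X / S + Y / S) / S)
          (l := (X / S + Y / S + 1) / S) (r₀ := r₀) (r₁ := r₁) (w := w) n1 n4 (by simp) (by simp)
          fun h => Nat.le_zero.1 (h ▸ k01)
        have e2 : g₂ (h + a) = update (update (sumaPost (m (h + a)) (block s w a (X / S + Y / S))
          (block s w a (X / S + Y / S + 1)) ((X / S + Y / S) / S) ((X / S + Y / S + 1) / S))
          R0 [r₀]) R1 [r₁] := by simp [g₂, g₁]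
        have e3 : g₃ (h + a) = sumaPost (m (h + a))
            (if r₀ = 0 then block s w a (X / S + Y / S) else block s w a (X / S + Y / S + 1))
            (if r₁ = 0 then block s w a (X / S + Y / S) else block s w a (X / S + Y / S + 1))
            (if r₀ = 0 then (X / S + Y / S) / S else (X / S + Y / S + 1) / S)
            (if r₁ = 0 then (X / S + Y / S) / S else (X / S + Y / S + 1) / S) := by
          simp only [g₃, hna, if_false, ← Nat.div_div_eq_div_mul, ← block_div, ← hS, c0, c1]
          rcases Nat.le_one_iff_eq_zero_or_eq_one.1 k0 with h0 | h0 <;>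
            rcases Nat.le_one_iff_eq_zero_or_eq_one.1 k1 with h1 | h1 <;> simp [h0, h1]
        refine Tri.local (by simp [Instr.Local]) ?_ ?_ (by simp [lops, Instr.cost])
        · rw [e2, q1, e3]
        · rw [e2]; exact q2.mono (by omega)
      · have hjh : j < h := by
          by_contra hjh
          exact hj' (j - h) (by omega) (Nat.add_sub_of_le (by omega)).symm
        obtain ⟨n1, n2, n3, n4⟩ := hm j (by omega)
        simp only [g₃, hjh, if_true, true_and]
        simp only [g₂, hjh, if_true]
        exact ((n4.set (a := w) (by simp)).set (a := w) (by simp)).mono (by omega)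
    have t4 : Tri s K σ {j | j < 2 * h} g₃ (par h fun j => [send (σ (h + j)) (σ j)
        [⟨U0, 0, 1, U0⟩, ⟨U1, 0, 1, U1⟩]]) (fun j => sumaPost (m j) (block s w j (X + Y))
        (block s w j (X + Y + 1)) ((X + Y) / (S * S)) ((X + Y + 1) / (S * S))) 0 2 1 := by
      refine Tri.par_pairs hσ fun a ha => ?_
      have hna : ¬ h + a < h := by omega
      have hne : σ (h + a) ≠ σ a := fun he => by
        have := hσ (x₁ := h + a) (x₂ := a) (by simp; omega) (by simp; omega) he
        omega
      obtain ⟨m1, m2, m3, m4⟩ := hm a (by omega)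
      obtain ⟨n1, n2, n3, n4⟩ := hm (h + a) (by omega)
      rw [Set.pair_comm]
      refine Tri.message (L₁ := []) (L₂ := []) (L₃ := []) (L₄ := [])
        (ua := u + 2 * w + 2) (ub := u + 2 * w) hne (by simp) (by simp)
        (by simp) (by simp) ?_ ?_ (by simp; omega)
        (by simp; omega) ?_ ?_
      · simp only [g₃, hna, if_false]; exact n4.sumaPost (by simp) (by simp) _ _
      · simp only [g₃, g₂, ha, if_true]
        exact ((m4.set (a := w) (by simp)).set (a := w) (by simp)).mono (by omega)
      · simp [g₃, lrun]
      · have e1 := m1 U0 (by simp [Var.Below])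
        have e2 := m1 U1 (by simp [Var.Below])
        simp [g₃, g₂, ha, recv, lrun, sumaPost, e1, e2, slice]
    exact (((t1.seq t2).seq t3).seq t4).weaken (by omega) (by omega) (by omega)

end SpeculativeSum

section Sum

variable {s w d K u : ℕ} {x y : Var}

/-- Only the lower half recurses without speculation. The upper half runs `suma`, which dominates
the cost, so the bounds are those of `tri_suma`. -/
theorem tri_sum (hs : 2 ≤ s) (hxy : x ≠ y) (hx : x.Below d) (hy : y.Below d)
    (hK : u + 4 * w + 6 ≤ K) (e : ℕ) :
    ∀ (σ : ℕ → ℕ) (m : ℕ → Mem) (X Y : ℕ), Set.InjOn σ {j | j < 2 ^ e} →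
    X < s ^ (2 ^ e * w) → Y < s ^ (2 ^ e * w) →
    (∀ j < 2 ^ e, Clean d (m j) ∧ m j x = [] ∧ m j y = [] ∧ Bnd (m j) u) →
    Tri s K σ {j | j < 2 ^ e}
      (fun j => update (update (m j) x (block s w j X)) y (block s w j Y)) (sum w x y e σ)
      (fun j => sumPost (m j) (block s w j (X + Y)) ((X + Y) / s ^ (2 ^ e * w)))
      (6 * w + 4 * e) (4 * e) (2 * e) := by
  have hs0 : 0 < s := by omega
  induction e with
  | zero =>
    intro σ m X Y hσ hX hY hm
    have hD : {j | j < 2 ^ 0} = {0} := by ext j; simp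
    obtain ⟨h1, h2, h3, h4⟩ := hm 0 (by simp)
    simp only [pow_zero, one_mul] at hX hY
    obtain ⟨r1, r2⟩ := ltri_sum_leaf (p := σ 0) (w := w) hs0 hxy hx hy h1 h2 h3 h4 hX hY
    rw [hD, sum]
    simp only [pow_zero, one_mul]
    refine (Tri.local ?_ ?_ ?_ le_rfl).weaken ?_ (by omega) (by omega)
    · simp only [List.mem_append, or_imp, forall_and]
      refine ⟨⟨?_, ripple_local⟩, ?_⟩ <;> simp [Instr.Local]
    · simp only [block_zero_left]; exact r1.symm
    · simp only [block_zero_left]; exact r2.mono (by omega)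
    · simp only [lops_append, lops_ripple]; simp [lops, Instr.cost]; omega
  | succ e ih =>
    intro σ m X Y hσ hX hY hm
    set h := 2 ^ e with hh
    have h2 : 2 ^ (e + 1) = 2 * h := by rw [pow_succ]; ring
    rw [h2] at hσ hX hY hm ⊢
    set S := s ^ (h * w) with hS
    have hSS : s ^ (2 * h * w) = S * S := by rw [hS, ← pow_add]; ring_nf
    rw [hSS] at hX hY ⊢
    have hS0 : 0 < S := by positivity
    have hX0 : X % S < S := Nat.mod_lt _ hS0
    have hY0 : Y % S < S := Nat.mod_lt _ hS0
    have hX1 : X / S < S := Nat.div_lt_of_lt_mul hX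
    have hY1 : Y / S < S := Nat.div_lt_of_lt_mul hY
    obtain ⟨c0, b0⟩ := halves_add (w := w) hs0 hS X Y 0
    simp only [add_zero] at c0 b0
    have k0 : (X % S + Y % S) / S ≤ 1 := carry_le_one (c := 0) hX0 hY0 (by omega)
    set r₀ := (X % S + Y % S) / S
    have hσ1 : Set.InjOn σ {j | j < h} := hσ.mono fun j hj => by simp at hj ⊢; omega
    let g₁ : ℕ → Mem := fun j => if j < h then sumPost (m j) (block s w j (X + Y)) r₀
      else sumaPost (m j) (block s w (j - h) (X / S + Y / S))
          (block s w (j - h) (X / S + Y / S + 1))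
        ((X / S + Y / S) / S) ((X / S + Y / S + 1) / S)
    let g₂ : ℕ → Mem := fun j => if j < h then update (m j) S0 (block s w j (X + Y))
      else update (g₁ j) R0 [r₀]
    let g₃ : ℕ → Mem := fun j => if j < h then g₂ j else
      sumPost (m j) (block s w j (X + Y)) ((X + Y) / (S * S))
    have t1 := Tri.halves (f := fun j => update (update (m j) x (block s w j X)) y (block s w j Y))
      (g := g₁) (L₁ := sum w x y e σ) (L₂ := suma w x y e (fun j => σ (h + j))) hσ
      ((ih σ m (X % S) (Y % S) hσ1 hX0 hY0 fun j hj => hm j (by omega)).congr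
        (fun j hj => by
          have : (j + 1) * w ≤ h * w := Nat.mul_le_mul_right _ hj
          rw [hS, block_mod this, block_mod this])
        (fun j hj => by
          have hj' : j < h := hj
          simp only [g₁, hj', if_true, b0 j hj']; rfl))
      ((tri_suma hs hxy hx hy hK e (fun j => σ (h + j)) (fun j => m (h + j)) (X / S) (Y / S)
        (injOn_shift hσ) hX1 hY1 fun j hj => hm (h + j) (by omega)).congr
        (fun j hj => by rw [hS, block_div, block_div])
        (fun j hj => by simp [g₁, hS]; rfl))
    have t2 : Tri s K σ {j | j < 2 * h} g₁ (par h fun j => [send (σ j) (σ (h + j))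
        [⟨U0, 0, 1, R0⟩], clear (σ j) U0]) g₂ 0 2 1 := by
      refine Tri.par_pairs hσ fun a ha => ?_
      have hna : ¬ h + a < h := by omega
      have hne : σ a ≠ σ (h + a) := fun he => by
        have := hσ (x₁ := a) (x₂ := h + a) (by simp; omega) (by simp; omega) he
        omega
      obtain ⟨m1, m2, m3, m4⟩ := hm a (by omega)
      obtain ⟨n1, n2, n3, n4⟩ := hm (h + a) (by omega)
      refine (Tri.message (L₁ := []) (L₂ := []) (L₃ := [clear (σ a) U0]) (L₄ := [])
        (ua := u + w + 1) (ub := u + 2 * w + 2) hne (by simp) (by simp)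
        (by simp [Instr.Local, Instr.Free]) (by simp) ?_ ?_ (by simp [Instr.grow]; omega)
        (by simp; omega) ?_ ?_).weaken (by omega) (by simp) le_rfl
      · simp only [g₁, ha, if_true]; exact m4.sumPost (by simp) _
      · simp only [g₁, hna, if_false]; exact n4.sumaPost (by simp) (by simp) _ _
      · have e1 := m1 U0 (by simp [Var.Below])
        simp only [g₁, g₂, ha, if_true]
        simp only [lrun, List.foldl_cons, List.foldl_nil, lstep, sumPost, update_idem]
        exact (update_nil (by simp [e1])).symm
      · have e1 := n1 R0 (by simp [Var.Below])
        simp only [g₂, hna, if_false]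
        simp [g₁, ha, recv, lrun, sumaPost, sumPost, e1, slice]
    have t3 : Tri s K σ {j | j < 2 * h} g₂ (par h fun j => [sel (σ (h + j)) R0 S0 S1 S0,
        sel (σ (h + j)) R0 U0 U1 U0, clear (σ (h + j)) R0, clear (σ (h + j)) S1,
        clear (σ (h + j)) U1]) g₃ 4 0 0 := by
      refine Tri.par_local (ι := fun a => h + a) hσ (fun a ha => ⟨by omega, fun b hb => by omega⟩)
        (fun a ha => ?_) fun j hj hj' => ?_
      · have hna : ¬ h + a < h := by omega
        obtain ⟨n1, n2, n3, n4⟩ := hm (h + a) (by omega)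
        obtain ⟨q1, q2⟩ := ltri_sum_sel (s := s) (p := σ (h + a)) (a := block s w a (X / S + Y / S))
          (b := block s w a (X / S + Y / S + 1)) (k := (X / S + Y / S) / S)
          (l := (X / S + Y / S + 1) / S) (r₀ := r₀) (w := w) n1 n4 (by simp) (by simp)
        have e2 : g₂ (h + a) = update (sumaPost (m (h + a)) (block s w a (X / S + Y / S))
          (block s w a (X / S + Y / S + 1)) ((X / S + Y / S) / S) ((X / S + Y / S + 1) / S))
          R0 [r₀] := by simp [g₂, g₁]
        have e3 : g₃ (h + a) = sumPost (m (h + a))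
            (if r₀ = 0 then block s w a (X / S + Y / S) else block s w a (X / S + Y / S + 1))
            (if r₀ = 0 then (X / S + Y / S) / S else (X / S + Y / S + 1) / S) := by
          simp only [g₃, hna, if_false, ← Nat.div_div_eq_div_mul, ← block_div, ← hS, c0]
          rcases Nat.le_one_iff_eq_zero_or_eq_one.1 k0 with h0 | h0 <;> simp [h0]
        refine Tri.local (by simp [Instr.Local]) ?_ ?_ (by simp [lops, Instr.cost])
        · rw [e2, q1, e3]
        · rw [e2]; exact q2.mono (by omega)
      · have hjh : j < h := by
          by_contra hjh
          exact hj' (j - h) (by omega) (Nat.add_sub_of_le (by omega)).symm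
        obtain ⟨n1, n2, n3, n4⟩ := hm j (by omega)
        simp only [g₃, hjh, if_true, true_and]
        simp only [g₂, hjh, if_true]
        exact (n4.set (a := w) (by simp)).mono (by omega)
    have t4 : Tri s K σ {j | j < 2 * h} g₃ (par h fun j => [send (σ (h + j)) (σ j)
        [⟨U0, 0, 1, U0⟩]]) (fun j => sumPost (m j) (block s w j (X + Y))
        ((X + Y) / (S * S))) 0 2 1 := by
      refine Tri.par_pairs hσ fun a ha => ?_
      have hna : ¬ h + a < h := by omega
      have hne : σ (h + a) ≠ σ a := fun he => by
        have := hσ (x₁ := h + a) (x₂ := a) (by simp; omega) (by simp; omega) he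
        omega
      obtain ⟨m1, m2, m3, m4⟩ := hm a (by omega)
      obtain ⟨n1, n2, n3, n4⟩ := hm (h + a) (by omega)
      rw [Set.pair_comm]
      refine (Tri.message (L₁ := []) (L₂ := []) (L₃ := []) (L₄ := [])
        (ua := u + w + 1) (ub := u + w) hne (by simp) (by simp)
        (by simp) (by simp) ?_ ?_ (by simp; omega)
        (by simp; omega) ?_ ?_).weaken (by omega) (by simp) le_rfl
      · simp only [g₃, hna, if_false]; exact n4.sumPost (by simp) _
      · simp only [g₃, g₂, ha, if_true]
        exact m4.set (a := w) (by simp)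
      · simp [g₃, lrun]
      · have e1 := m1 U0 (by simp [Var.Below])
        simp [g₃, g₂, ha, recv, lrun, sumPost, e1, slice]
    exact (((t1.seq t2).seq t3).seq t4).weaken (by omega) (by omega) (by omega)

/-- The target may be one of the operands, because both have been released when the sum is renamed.
-/
theorem tri_sumInto (hs : 2 ≤ s) (hxy : x ≠ y) (hx : x.Below d) (hy : y.Below d) {z : Var}
    (hz : z.Below d) (hK : u + 4 * w + 6 ≤ K) {e : ℕ} {σ : ℕ → ℕ} {m : ℕ → Mem} {X Y : ℕ}
    (hσ : Set.InjOn σ {j | j < 2 ^ e}) (hX : X < s ^ (2 ^ e * w)) (hY : Y < s ^ (2 ^ e * w))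
    (hm : ∀ j < 2 ^ e, Clean d (m j) ∧ m j x = [] ∧ m j y = [] ∧ Bnd (m j) u) :
    Tri s K σ {j | j < 2 ^ e}
      (fun j => update (update (m j) x (block s w j X)) y (block s w j Y)) (sumInto w e x y z σ)
      (fun j => update (m j) z (block s w j (X + Y))) (6 * w + 4 * e) (4 * e) (2 * e) := by
  refine (tri_sum hs hxy hx hy hK e σ m X Y hσ hX hY hm).seq (t' := 0) (w' := 0) (l' := 0)
    (Tri.par_local (ι := id) hσ (fun a ha => ⟨ha, fun b hb => hb.ne⟩) (fun a ha => ?_)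
      fun j hj hj' => (hj' j hj rfl).elim)
  obtain ⟨m1, m2, m3, m4⟩ := hm a ha
  refine Tri.free (u := u + w + 1) (by simp [Instr.Local, Instr.Free]) (m4.sumPost (by simp) _)
    (by simp [Instr.grow]; omega) ?_
  have e1 := m1 U0 (by simp [Var.Below])
  have e2 := m1 S0 (by simp [Var.Below])
  obtain ⟨z1, z2, z3, z4, z5, z6, z7⟩ := hz.ne_temp
  clear hm m1 m2 m3 m4 hX hY hσ hK
  ext1 v
  simp [lrun, lstep, sumPost, update_apply]
  split_ifs <;> simp_all

end Sum

/-! ### Recomposition: padding and three sums. -/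

/-- The first processor of an instruction. -/
def _root_.Copsim.Instr.proc : Instr → ℕ
  | .put p _ _ => p
  | .clear p _ => p
  | .copy p _ _ _ _ => p
  | .move p _ _ => p
  | .mul p _ _ _ => p
  | .add p _ _ _ _ _ _ => p
  | .sel p _ _ _ _ => p
  | .send p _ _ => p

@[simp] theorem Instr.proc_put (p : ℕ) (x : Var) (l : List ℕ) : (put p x l).proc = p := rfl

theorem Instr.Free.local {i : Instr} (h : i.Free) : i.Local i.proc := by
  cases i <;> first | rfl | exact h.elim

/-- A bookkeeping program of several processors. -/
theorem Tri.free_many {s K : ℕ} {σ : ℕ → ℕ} {D : Set ℕ} (hσ : Set.InjOn σ D) {L : List Instr}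
    {f g : ℕ → Mem} (hL : ∀ i ∈ L, i.Free ∧ i.proc ∈ σ '' D) (u : ℕ → ℕ)
    (hu : ∀ j ∈ D, Bnd (f j) (u j) ∧
      u j + ((L.filter fun i => i.proc = σ j).map Instr.grow).sum ≤ K)
    (hg : ∀ j ∈ D, g j = lrun s (L.filter fun i => i.proc = σ j) (f j)) :
    Tri s K σ D f L g 0 0 0 := by
  induction L generalizing f u with
  | nil => exact Tri.nil hg fun j hj => (hu j hj).1.mono (by simpa using (hu j hj).2)
  | cons i L ih =>
    obtain ⟨hi, a, ha, hia⟩ := hL i (by simp)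
    -- Instructions of different processors are interleaved here. They are peeled off one at a time,
    -- each framed by the idle processors.
    let f' : ℕ → Mem := fun j => if i.proc = σ j then lstep s (f j) i else f j
    have t1 : Tri s K σ D f [i] f' 0 0 0 := by
      refine Tri.frame (E := {a}) hσ (by simpa using ha)
          (Tri.free (u := u a) ?_ (hu a ha).1 ?_ ?_) ?_
      · simpa [hi] using hia ▸ hi.local
      · have := (hu a ha).2
        rw [List.filter_cons_of_pos (by simp [hia])] at this
        simp at this ⊢; omega
      · simp [f', hia, lrun]
      · intro j hj hja
        have hne : i.proc ≠ σ j := fun h => hja (hσ hj ha (h ▸ hia.symm))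
        have := hu j hj
        exact ⟨by simp [f', hne], this.1.mono (by omega)⟩
    refine t1.seq (ih (fun k hk => hL k (by simp [hk]))
      (fun j => u j + if i.proc = σ j then i.grow else 0) (fun j hj => ?_) fun j hj => ?_)
    · obtain ⟨h1, h2⟩ := hu j hj
      by_cases hij : i.proc = σ j
      · rw [List.filter_cons_of_pos (by simp [hij])] at h2
        simp only [f', hij, if_true]
        refine ⟨h1.lstep hi, ?_⟩
        simp at h2 ⊢; omega
      · rw [List.filter_cons_of_neg (by simp [hij])] at h2
        simp only [f', hij, if_false]
        exact ⟨h1, h2⟩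
    · rw [hg j hj]
      by_cases hij : i.proc = σ j
      · rw [List.filter_cons_of_pos (by simp [hij])]
        simp [f', hij, lrun]
      · rw [List.filter_cons_of_neg (by simp [hij])]
        simp [f', hij]

/-- The four sub-products. -/
def prods (d : ℕ) (m : Mem) (l₀ l₁ l₂ l₃ : List ℕ) : Mem :=
  update (update (update (update m (Q 0 d) l₀) (Q 1 d) l₁) (Q 2 d) l₂) (Q 3 d) l₃

section Prods

variable {d : ℕ} {m : Mem} {l₀ l₁ l₂ l₃ l : List ℕ}

theorem prods_Q0 : prods d m l₀ l₁ l₂ l₃ (Q 0 d) = l₀ := by simp [prods]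

theorem prods_Q1 : prods d m l₀ l₁ l₂ l₃ (Q 1 d) = l₁ := by simp [prods]

theorem prods_Q2 : prods d m l₀ l₁ l₂ l₃ (Q 2 d) = l₂ := by simp [prods]

theorem prods_Q3 : prods d m l₀ l₁ l₂ l₃ (Q 3 d) = l₃ := by simp [prods]

theorem update_prods_Q0 : update (prods d m l₀ l₁ l₂ l₃) (Q 0 d) l = prods d m l l₁ l₂ l₃ := by
  ext1 v; simp only [prods, update_apply]; split_ifs <;> simp_all

theorem update_prods_Q1 : update (prods d m l₀ l₁ l₂ l₃) (Q 1 d) l = prods d m l₀ l l₂ l₃ := by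
  ext1 v; simp only [prods, update_apply]; split_ifs <;> simp_all

theorem update_prods_Q2 : update (prods d m l₀ l₁ l₂ l₃) (Q 2 d) l = prods d m l₀ l₁ l l₃ := by
  ext1 v; simp only [prods, update_apply]; split_ifs <;> simp_all

theorem update_prods_Q3 : update (prods d m l₀ l₁ l₂ l₃) (Q 3 d) l = prods d m l₀ l₁ l₂ l := by
  rw [prods, update_idem, prods]

end Prods

theorem Bnd.prods {d u w : ℕ} {m : Mem} (h : Bnd m u) {l₀ l₁ l₂ l₃ : List ℕ}
    (h₀ : l₀.length ≤ w) (h₁ : l₁.length ≤ w) (h₂ : l₂.length ≤ w) (h₃ : l₃.length ≤ w) :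
    Bnd (prods d m l₀ l₁ l₂ l₃) (u + 4 * w) :=
  ((((h.set h₀).set h₁).set h₂).set h₃).mono (by omega)

/-- The quadruples `{a, q + a, 2 * q + a, 3 * q + a}` partition `{0, …, 4 * q - 1}`. -/
theorem Tri.par_quads {s K q : ℕ} {σ : ℕ → ℕ} {f g : ℕ → Mem} {F : ℕ → List Instr} {t w l : ℕ}
    (hσ : Set.InjOn σ {j | j < 4 * q})
    (h₁ : ∀ a < q, Tri s K σ {a, q + a, 2 * q + a, 3 * q + a} f (F a) g t w l) :
    Tri s K σ {j | j < 4 * q} f (Copsim.par q F) g t w l := by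
  refine Tri.par (E := fun a => {a, q + a, 2 * q + a, 3 * q + a}) hσ ?_ ?_ h₁ ?_
  · rintro a ha j (rfl | rfl | rfl | rfl) <;> simp <;> omega
  · intro a ha b hb
    simp [Set.disjoint_left]; omega
  · intro j hj hj'
    simp only [Set.mem_insert_iff, Set.mem_singleton_iff, Set.mem_ofPred_eq] at hj hj'
    rcases Nat.lt_or_ge j q with h | h
    · exact (hj' j h (Or.inl rfl)).elim
    rcases Nat.lt_or_ge j (2 * q) with h | h
    · exact (hj' (j - q) (by omega) (by omega)).elim
    rcases Nat.lt_or_ge j (3 * q) with h | h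
    · exact (hj' (j - 2 * q) (by omega) (by omega)).elim
    · exact (hj' (j - 3 * q) (by omega) (by omega)).elim

/-- The memory before the end of the recomposition. -/
def parts (s w q d : ℕ) (P₀ P₁ P₂ P₃ : ℕ) (m : ℕ → Mem) (j : ℕ) : Mem :=
  prods d (m j) (if j < 2 * q then block s w j P₀ else [])
    (if q ≤ j ∧ j < 3 * q then block s w (j - q) P₁ else [])
    (if q ≤ j ∧ j < 3 * q then block s w (j - q) P₂ else [])
    (if 2 * q ≤ j then block s w (j - 2 * q) P₃ else [])

/-- Padding the sub-products with zeros. -/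
theorem tri_pad {s q w d K u : ℕ} (hs0 : 0 < s) {σ : ℕ → ℕ} {m : ℕ → Mem}
    {P₀ P₁ P₂ P₃ : ℕ} (hσ : Set.InjOn σ {j | j < 4 * q}) (hK : u + 7 * w ≤ K)
    (hm : ∀ j < 4 * q, Bnd (m j) u)
    (h₀ : P₀ < s ^ (2 * q * w)) (h₁ : P₁ < s ^ (2 * q * w)) (h₂ : P₂ < s ^ (2 * q * w)) :
    Tri s K σ {j | j < 4 * q} (parts s w q d P₀ P₁ P₂ P₃ m)
      (par q (fun j => [put (σ (2 * q + j)) (Q 0 d) (List.replicate w 0),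
        put (σ (3 * q + j)) (Q 0 d) (List.replicate w 0), put (σ j) (Q 1 d) (List.replicate w 0),
        put (σ (3 * q + j)) (Q 1 d) (List.replicate w 0), put (σ j) (Q 2 d) (List.replicate w 0),
        put (σ (3 * q + j)) (Q 2 d) (List.replicate w 0), put (σ j) (Q 3 d) (List.replicate w 0),
        put (σ (q + j)) (Q 3 d) (List.replicate w 0)]))
      (fun j => prods d (m j) (block s w j P₀) (block s w j (s ^ (q * w) * P₁))
        (block s w j (s ^ (q * w) * P₂)) (block s w j (s ^ (2 * q * w) * P₃))) 0 0 0 := by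
  refine Tri.par_quads hσ fun a ha => ?_
  have hinj : Set.InjOn σ {a, q + a, 2 * q + a, 3 * q + a} := hσ.mono (by
    rintro j (rfl | rfl | rfl | rfl) <;> simp <;> omega)
  have hne : ∀ {i j}, i < 4 * q → j < 4 * q → i ≠ j → σ i ≠ σ j := fun hi hj hij h =>
    hij (hσ hi hj h)
  have n1 : σ a ≠ σ (q + a) := hne (by omega) (by omega) (by omega)
  have n2 : σ a ≠ σ (2 * q + a) := hne (by omega) (by omega) (by omega)
  have n3 : σ a ≠ σ (3 * q + a) := hne (by omega) (by omega) (by omega)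
  have n4 : σ (q + a) ≠ σ (2 * q + a) := hne (by omega) (by omega) (by omega)
  have n5 : σ (q + a) ≠ σ (3 * q + a) := hne (by omega) (by omega) (by omega)
  have n6 : σ (2 * q + a) ≠ σ (3 * q + a) := hne (by omega) (by omega) (by omega)
  refine Tri.free_many hinj (by simp [Instr.Free]) (fun _ => u + 4 * w) ?_ ?_
  · intro j hj
    have hj4 : j < 4 * q := by
      rcases hj with rfl | rfl | rfl | rfl <;> omega
    -- Four sub-products take `4 * w` words, and no processor receives more than three zero blocks;
    -- this explains `7 * w`.
    refine ⟨(hm j hj4).prods ?_ ?_ ?_ ?_, ?_⟩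
    iterate 4 split_ifs <;> simp
    rcases hj with rfl | rfl | rfl | rfl <;>
      simp [n1, n2, n3, n4, n5, n6, n1.symm, n2.symm, n3.symm, n4.symm, n5.symm,
        n6.symm, Instr.grow] <;> omega
  -- Above the top of a product its blocks vanish by size (`z0`, `z1`), and below its shift they
  -- vanish by divisibility. In both cases the inserted zeros are the true blocks of the shifted
  -- product.
  · have z0 : ∀ j, 2 * q ≤ j → block s w j P₀ = List.replicate w 0 := fun j hj =>
      block_of_lt (h₀.trans_le (Nat.pow_le_pow_right hs0 (Nat.mul_le_mul_right _ hj)))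
    have z1 : ∀ j P, P < s ^ (2 * q * w) → 2 * q ≤ j → block s w (q + j) (s ^ (q * w) * P) =
        List.replicate w 0 := fun j P hP hj => by
      rw [block_shift hs0]
      exact block_of_lt (hP.trans_le (Nat.pow_le_pow_right hs0 (Nat.mul_le_mul_right _ hj)))
    rintro j (rfl | rfl | rfl | rfl)
    · have b1 : j < 2 * q := by omega
      have b2 : ¬ q ≤ j := by omega
      have b3 : ¬ 2 * q ≤ j := by omega
      simp only [List.filter_cons, List.filter_nil, decide_true, decide_false, Bool.false_eq_true,
        Instr.proc_put, n1.symm, n2.symm, n3.symm, parts, b1, b2, b3, if_true, if_false,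
        false_and, block_shift_of_lt w ha, block_shift_of_lt w b1]
      simp [lrun, lstep, prods_Q1, prods_Q2, prods_Q3, update_prods_Q1, update_prods_Q2,
        update_prods_Q3]
    · have b1 : q + a < 2 * q := by omega
      have b2 : q ≤ q + a := by omega
      have b3 : ¬ 2 * q ≤ q + a := by omega
      have b4 : q + a < 3 * q := by omega
      simp only [List.filter_cons, List.filter_nil, decide_true, decide_false, Bool.false_eq_true,
        Instr.proc_put, n1, n4.symm, n5.symm, parts, b1, b2, b3, b4, if_true, if_false,
        true_and, block_shift_of_lt w b1, block_shift hs0, Nat.add_sub_cancel_left]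
      simp [lrun, lstep, prods_Q3, update_prods_Q3]
    · have b1 : ¬ 2 * q + a < 2 * q := by omega
      have b2 : q ≤ 2 * q + a := by omega
      have b3 : 2 * q ≤ 2 * q + a := by omega
      have b4 : 2 * q + a < 3 * q := by omega
      have b5 : 2 * q + a - q = q + a := by omega
      have e1 : ∀ P, block s w (2 * q + a) (s ^ (q * w) * P) = block s w (q + a) P := fun P => by
        rw [show 2 * q + a = q + (q + a) by ring, block_shift hs0]
      simp only [List.filter_cons, List.filter_nil, decide_true, decide_false, Bool.false_eq_true,
        Instr.proc_put, n2, n4, n6.symm, parts, b1, b2, b3, b4, b5, if_true, if_false,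
        true_and, e1, block_shift hs0, Nat.add_sub_cancel_left, z0 _ b3]
      simp [lrun, lstep, prods_Q0, update_prods_Q0]
    · have b1 : ¬ 3 * q + a < 2 * q := by omega
      have b3 : 2 * q ≤ 3 * q + a := by omega
      have b4 : ¬ 3 * q + a < 3 * q := by omega
      have b5 : 3 * q + a - 2 * q = q + a := by omega
      have e1 : ∀ P, P < s ^ (2 * q * w) →
          block s w (3 * q + a) (s ^ (q * w) * P) = List.replicate w 0 := fun P hP => by
        rw [show 3 * q + a = q + (2 * q + a) by ring, z1 _ _ hP (by omega)]
      have e2 : ∀ P, block s w (3 * q + a) (s ^ (2 * q * w) * P) = block s w (q + a) P :=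
        fun P => by rw [show 3 * q + a = 2 * q + (q + a) by ring, block_shift hs0]
      simp only [List.filter_cons, List.filter_nil, decide_true, decide_false, Bool.false_eq_true,
        Instr.proc_put, n3, n5, n6, parts, b1, b3, b4, b5, if_true, if_false,
        and_false, e1 _ h₁, e1 _ h₂, e2, z0 _ b3]
      simp [lrun, lstep, prods_Q0, prods_Q1, prods_Q2, update_prods_Q0, update_prods_Q1,
        update_prods_Q2]

/-- Every partial sum is at most the total, so `hlt` alone excludes overflow and the dropped carries
are zero. The sums run on `2 ^ (2 * (k + 1))` processors, so each contributes `6 * w + 8 * (k + 1)`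
operations. The products not yet added count as ordinary occupied memory. -/
theorem tri_combine {s k w d K u : ℕ} (hs : 2 ≤ s) {σ : ℕ → ℕ} {m : ℕ → Mem}
    {P₀ P₁ P₂ P₃ : ℕ} (hσ : Set.InjOn σ {j | j < 4 ^ (k + 1)}) (hK : u + 7 * w + 6 ≤ K)
    (hm : ∀ j < 4 ^ (k + 1), Clean d (m j) ∧ Bnd (m j) u)
    (h₀ : P₀ < s ^ (2 * 4 ^ k * w)) (h₁ : P₁ < s ^ (2 * 4 ^ k * w))
    (h₂ : P₂ < s ^ (2 * 4 ^ k * w))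
    (hlt : P₀ + s ^ (4 ^ k * w) * P₁ + s ^ (4 ^ k * w) * P₂ + s ^ (2 * 4 ^ k * w) * P₃ <
      s ^ (4 * 4 ^ k * w)) :
    Tri s K σ {j | j < 4 ^ (k + 1)} (parts s w (4 ^ k) d P₀ P₁ P₂ P₃ m) (combine (k + 1) w d σ)
      (fun j => update (m j) (C d) (block s w j
        (P₀ + s ^ (4 ^ k * w) * P₁ + s ^ (4 ^ k * w) * P₂ + s ^ (2 * 4 ^ k * w) * P₃)))
      (18 * w + 24 * (k + 1)) (24 * (k + 1)) (12 * (k + 1)) := by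
  have hs0 : 0 < s := by omega
  have hq4 : 4 ^ (k + 1) / 4 = 4 ^ k := by rw [pow_succ]; simp
  have h4 : 4 ^ (k + 1) = 2 ^ (2 * (k + 1)) := by rw [pow_mul]; norm_num
  have h4' : 4 ^ (k + 1) = 4 * 4 ^ k := by rw [pow_succ]; ring
  set q := 4 ^ k with hq
  set f₁ : ℕ → Mem := fun j => prods d (m j) (block s w j P₀) (block s w j (s ^ (q * w) * P₁))
    (block s w j (s ^ (q * w) * P₂)) (block s w j (s ^ (2 * q * w) * P₃)) with hf₁
  have t0 := tri_pad (d := d) (m := m) (P₃ := P₃) (w := w) (K := K) hs0 (h4' ▸ hσ) (by omega)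
    (fun j hj => (hm j (by omega)).2) h₀ h₁ h₂
  rw [← h4'] at t0
  rw [h4] at hσ hm t0 ⊢
  have hpow : ∀ X, X < s ^ (4 * q * w) → X < s ^ (2 ^ (2 * (k + 1)) * w) := fun X hX => by
    rwa [← h4, h4']
  have hS2 : s ^ (2 * q * w) ≤ s ^ (4 * q * w) :=
    Nat.pow_le_pow_right hs0 (Nat.mul_le_mul_right _ (by omega))
  -- The operands are variables of depth `d`, hence the sums are instantiated one depth higher,
  -- where these count as data of a caller.
  have t1 := tri_sumInto (d := d + 1) (u := u + 2 * w) (w := w) (x := Q 0 d) (y := Q 1 d) hs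
    (by simp) (by simp [Var.Below]) (by simp [Var.Below]) (z := Q 0 d) (by simp [Var.Below])
    (by omega) (m := fun j => update (update (m j) (Q 2 d) (block s w j (s ^ (q * w) * P₂)))
      (Q 3 d) (block s w j (s ^ (2 * q * w) * P₃))) (X := P₀) (Y := s ^ (q * w) * P₁) hσ
    (hpow _ (by omega)) (hpow _ (by omega)) (K := K) (fun j hj => ⟨?_, ?_, ?_, ?_⟩)
  · have t2 := tri_sumInto (d := d + 1) (u := u + w) (w := w) (x := Q 0 d) (y := Q 2 d) hs
      (by simp) (by simp [Var.Below]) (by simp [Var.Below]) (z := Q 0 d) (by simp [Var.Below])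
      (by omega) (m := fun j => update (m j) (Q 3 d) (block s w j (s ^ (2 * q * w) * P₃)))
      (X := P₀ + s ^ (q * w) * P₁) (Y := s ^ (q * w) * P₂) hσ
      (hpow _ (by omega)) (hpow _ (by omega)) (K := K) (fun j hj => ⟨?_, ?_, ?_, ?_⟩)
    · have t3 := tri_sumInto (d := d + 1) (u := u) (w := w) (x := Q 0 d) (y := Q 3 d) hs
        (by simp) (by simp [Var.Below]) (by simp [Var.Below]) (z := C d) (by simp [Var.Below])
        (by omega) (m := m)
        (X := P₀ + s ^ (q * w) * P₁ + s ^ (q * w) * P₂) (Y := s ^ (2 * q * w) * P₃) hσ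
        (hpow _ (by omega)) (hpow _ (by omega)) (K := K) (fun j hj => ⟨(hm j hj).1.succ,
          (hm j hj).1 _ (by simp [Var.Below]), (hm j hj).1 _ (by simp [Var.Below]), (hm j hj).2⟩)
      have := ((t0.seq (t1.congr (f' := f₁) (fun j hj => ?_) (fun j hj => rfl))).seq (t2.congr
        (fun j hj => ?_) (fun j hj => rfl))).seq (t3.congr (fun j hj => ?_) (fun j hj => rfl))
      · rw [combine, hq4]
        exact this.weaken (by omega) (by omega) (by omega)
      · ext1 v; simp only [hf₁, prods, update_apply]; split_ifs <;> simp_all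
      · ext1 v; simp only [update_apply]; split_ifs <;> simp_all
      · ext1 v; simp only [update_apply]; split_ifs <;> simp_all
    · exact (hm j hj).1.update (Nat.le_succ d) (by simp [Var.Below]) _
    · simpa using (hm j hj).1 _ (by simp [Var.Below])
    · simpa using (hm j hj).1 _ (by simp [Var.Below])
    · exact (hm j hj).2.set (by simp)
  · exact ((hm j hj).1.update (Nat.le_succ d) (by simp [Var.Below]) _).update le_rfl
      (by simp [Var.Below]) _
  · simpa using (hm j hj).1 _ (by simp [Var.Below])
  · simpa using (hm j hj).1 _ (by simp [Var.Below])
  · exact (((hm j hj).2.set (a := w) (by simp)).set (a := w) (by simp)).mono (by omega)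

/-! ### Families of processors by parity and by quarters. -/

section Families

variable {s K q n : ℕ} {σ : ℕ → ℕ} {f g : ℕ → Mem} {F G : ℕ → List Instr} {t w l : ℕ}

/-- Two independent pairs of processors in each of the `q` blocks of a program. -/
theorem Tri.par_two {α β γ δ : ℕ → ℕ} (hσ : Set.InjOn σ {j | j < n})
    (hlt : ∀ a < q, α a < n ∧ β a < n ∧ γ a < n ∧ δ a < n)
    (hne : ∀ a < q, ∀ b < q, α a ≠ β b ∧ α a ≠ γ b ∧ α a ≠ δ b ∧ β a ≠ γ b ∧ β a ≠ δ b ∧ γ a ≠ δ b)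
    (hself : ∀ a < q, ∀ b < a, α b ≠ α a ∧ β b ≠ β a ∧ γ b ≠ γ a ∧ δ b ≠ δ a)
    (hcov : ∀ j < n, ∃ a < q, j = α a ∨ j = β a ∨ j = γ a ∨ j = δ a)
    (h₁ : ∀ a < q, Tri s K σ {α a, β a} f (F a) g t w l)
    (h₂ : ∀ a < q, Tri s K σ {γ a, δ a} f (G a) g t w l) :
    Tri s K σ {j | j < n} f (Copsim.par q fun a => F a ++ G a) g t w l := by
  have hE : ∀ a < q, ({α a, β a} ∪ {γ a, δ a} : Set ℕ) ⊆ {j | j < n} := by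
    rintro a ha j ((rfl | rfl) | (rfl | rfl)) <;> simp [hlt a ha]
  refine Tri.par (E := fun a => {α a, β a} ∪ {γ a, δ a}) hσ hE ?_ (fun a ha => ?_) ?_
  · intro a ha b hb
    have h1 := hne a ha b (hb.trans ha)
    have h2 := hne b (hb.trans ha) a ha
    have h3 := hself a ha b hb
    simp only [Set.disjoint_left]
    rintro j ((rfl | rfl) | (rfl | rfl)) ((h | h) | (h | h)) <;> simp_all
  · have h1 := hne a ha a ha
    refine Tri.parallel (hσ.mono (hE a ha)) ?_ (h₁ a ha) (h₂ a ha)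
    simp only [Set.disjoint_left]
    rintro j (rfl | rfl) (h | h) <;> simp_all
  · intro j hj hj'
    obtain ⟨a, ha, h⟩ := hcov j hj
    refine (hj' a ha ?_).elim
    simp only [Set.mem_union, Set.mem_insert_iff, Set.mem_singleton_iff]
    tauto

/-- One pair of processors in each of the `q` blocks of a program. -/
theorem Tri.par_one {α β : ℕ → ℕ} (hσ : Set.InjOn σ {j | j < n})
    (hlt : ∀ a < q, α a < n ∧ β a < n) (hne : ∀ a < q, ∀ b < q, α a ≠ β b)
    (hself : ∀ a < q, ∀ b < a, α b ≠ α a ∧ β b ≠ β a)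
    (h₁ : ∀ a < q, Tri s K σ {α a, β a} f (F a) g t w l)
    (hg : ∀ j < n, (∀ a < q, j ≠ α a ∧ j ≠ β a) → g j = f j ∧ Bnd (f j) K) :
    Tri s K σ {j | j < n} f (Copsim.par q F) g t w l := by
  refine Tri.par (E := fun a => {α a, β a}) hσ ?_ ?_ h₁ ?_
  · rintro a ha j (rfl | rfl) <;> simp [hlt a ha]
  · intro a ha b hb
    have h1 := hne a ha b (hb.trans ha)
    have h2 := hne b (hb.trans ha) a ha
    have h3 := hself a ha b hb
    simp only [Set.disjoint_left]
    rintro j (rfl | rfl) (h | h) <;> simp_all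
  · intro j hj hj'
    exact hg j hj fun a ha => by simpa using hj' a ha

/-- A family over `{0, …, 4 * q - 1}`, by parity and halves. -/
def quad (q : ℕ) (x₀ x₁ x₂ x₃ : ℕ → Mem) (j : ℕ) : Mem :=
  if j < 2 * q then (if j % 2 = 0 then x₀ (j / 2) else x₁ (j / 2))
  else (if j % 2 = 0 then x₂ (j / 2 - q) else x₃ (j / 2 - q))

/-- A family over `{0, …, 4 * q - 1}`, by quarters. -/
def quar (q : ℕ) (x₀ x₁ x₂ x₃ : ℕ → Mem) (j : ℕ) : Mem :=
  if j < q then x₀ j else if j < 2 * q then x₁ (j - q)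
  else if j < 3 * q then x₂ (j - 2 * q) else x₃ (j - 3 * q)

variable {a : ℕ} {x₀ x₁ x₂ x₃ : ℕ → Mem}

theorem quad_0 (ha : a < q) : quad q x₀ x₁ x₂ x₃ (2 * a) = x₀ a := by
  simp [quad, ha]

theorem quad_1 (ha : a < q) : quad q x₀ x₁ x₂ x₃ (2 * a + 1) = x₁ a := by
  rw [quad, if_pos (by omega), if_neg (by omega), show (2 * a + 1) / 2 = a by omega]

theorem quad_2 : quad q x₀ x₁ x₂ x₃ (2 * q + 2 * a) = x₂ a := by
  rw [quad, if_neg (by omega), if_pos (by omega), show (2 * q + 2 * a) / 2 - q = a by omega]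

theorem quad_3 : quad q x₀ x₁ x₂ x₃ (2 * q + 2 * a + 1) = x₃ a := by
  rw [quad, if_neg (by omega), if_neg (by omega), show (2 * q + 2 * a + 1) / 2 - q = a by omega]

theorem quar_0 (ha : a < q) : quar q x₀ x₁ x₂ x₃ a = x₀ a := by
  simp [quar, ha]

theorem quar_1 (ha : a < q) : quar q x₀ x₁ x₂ x₃ (q + a) = x₁ a := by
  rw [quar, if_neg (by omega), if_pos (by omega), show q + a - q = a by omega]

theorem quar_2 (ha : a < q) : quar q x₀ x₁ x₂ x₃ (2 * q + a) = x₂ a := by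
  rw [quar, if_neg (by omega), if_neg (by omega), if_pos (by omega),
    show 2 * q + a - 2 * q = a by omega]

theorem quar_3 : quar q x₀ x₁ x₂ x₃ (3 * q + a) = x₃ a := by
  rw [quar, if_neg (by omega), if_neg (by omega), if_neg (by omega),
    show 3 * q + a - 3 * q = a by omega]

theorem quad_cases {p : ℕ → Prop} (h0 : ∀ a < q, p (2 * a)) (h1 : ∀ a < q, p (2 * a + 1))
    (h2 : ∀ a < q, p (2 * q + 2 * a)) (h3 : ∀ a < q, p (2 * q + 2 * a + 1)) {j : ℕ}
    (hj : j < 4 * q) : p j := by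
  rcases Nat.lt_or_ge j (2 * q) with h | h <;> rcases Nat.mod_two_eq_zero_or_one j with h' | h'
  · rw [show j = 2 * (j / 2) by omega]; exact h0 _ (by omega)
  · rw [show j = 2 * (j / 2) + 1 by omega]; exact h1 _ (by omega)
  · rw [show j = 2 * q + 2 * (j / 2 - q) by omega]; exact h2 _ (by omega)
  · rw [show j = 2 * q + 2 * (j / 2 - q) + 1 by omega]; exact h3 _ (by omega)

theorem quar_cases {p : ℕ → Prop} (h0 : ∀ a < q, p a) (h1 : ∀ a < q, p (q + a))
    (h2 : ∀ a < q, p (2 * q + a)) (h3 : ∀ a < q, p (3 * q + a)) {j : ℕ} (hj : j < 4 * q) : p j := by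
  rcases Nat.lt_or_ge j q with h | h
  · exact h0 _ h
  rcases Nat.lt_or_ge j (2 * q) with h | h
  · rw [show j = q + (j - q) by omega]; exact h1 _ (by omega)
  rcases Nat.lt_or_ge j (3 * q) with h | h
  · rw [show j = 2 * q + (j - 2 * q) by omega]; exact h2 _ (by omega)
  · rw [show j = 3 * q + (j - 3 * q) by omega]; exact h3 _ (by omega)

/-- Four independent programs on the four classes of `quad`. -/
theorem Tri.quads {L₀ L₁ L₂ L₃ : List Instr} (hσ : Set.InjOn σ {j | j < 4 * q})
    (h₀ : Tri s K (fun j => σ (2 * j)) {j | j < q} (fun j => f (2 * j)) L₀ (fun j => g (2 * j))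
      t w l)
    (h₁ : Tri s K (fun j => σ (2 * j + 1)) {j | j < q} (fun j => f (2 * j + 1)) L₁
      (fun j => g (2 * j + 1)) t w l)
    (h₂ : Tri s K (fun j => σ (2 * q + 2 * j)) {j | j < q} (fun j => f (2 * q + 2 * j)) L₂
      (fun j => g (2 * q + 2 * j)) t w l)
    (h₃ : Tri s K (fun j => σ (2 * q + 2 * j + 1)) {j | j < q} (fun j => f (2 * q + 2 * j + 1)) L₃
      (fun j => g (2 * q + 2 * j + 1)) t w l) :
    Tri s K σ {j | j < 4 * q} f (L₀ ++ L₁ ++ L₂ ++ L₃) g t w l := by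
  let D : Set ℕ := {j | j < q}
  have hD : {j | j < 4 * q} = (fun j => 2 * j) '' D ∪ (fun j => 2 * j + 1) '' D ∪
      (fun j => 2 * q + 2 * j) '' D ∪ (fun j => 2 * q + 2 * j + 1) '' D := by
    ext j
    simp only [Set.mem_ofPred_eq, Set.mem_union, Set.mem_image, D]
    constructor
    · intro hj
      refine quad_cases (p := fun j => (((∃ x < q, 2 * x = j) ∨ ∃ x < q, 2 * x + 1 = j) ∨
        ∃ x < q, 2 * q + 2 * x = j) ∨ ∃ x < q, 2 * q + 2 * x + 1 = j) (fun a ha => ?_)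
            (fun a ha => ?_)
        (fun a ha => ?_) (fun a ha => ?_) hj
      exacts [.inl (.inl (.inl ⟨a, ha, rfl⟩)), .inl (.inl (.inr ⟨a, ha, rfl⟩)),
        .inl (.inr ⟨a, ha, rfl⟩), .inr ⟨a, ha, rfl⟩]
    · rintro (((⟨a, ha, rfl⟩ | ⟨a, ha, rfl⟩) | ⟨a, ha, rfl⟩) | ⟨a, ha, rfl⟩) <;> omega
  rw [hD] at hσ ⊢
  have hs1 := hσ.mono Set.subset_union_left
  have hs2 := hs1.mono Set.subset_union_left
  refine Tri.parallel hσ ?_ (Tri.parallel hs1 ?_ (Tri.parallel hs2 ?_ (Tri.reindex h₀)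
    (Tri.reindex h₁)) (Tri.reindex h₂)) (Tri.reindex (ι := fun j => 2 * q + 2 * j + 1) h₃)
  · rw [Set.disjoint_left]
    rintro j ((⟨a, ha, rfl⟩ | ⟨a, ha, rfl⟩) | ⟨a, ha, rfl⟩) ⟨b, hb, h⟩ <;>
      simp [D] at ha hb h <;> omega
  · rw [Set.disjoint_left]
    rintro j (⟨a, ha, rfl⟩ | ⟨a, ha, rfl⟩) ⟨b, hb, h⟩ <;> simp [D] at ha hb h <;> omega
  · rw [Set.disjoint_left]
    rintro j ⟨a, ha, rfl⟩ ⟨b, hb, h⟩; simp [D] at ha hb h; omega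

theorem ne_of_injOn (hσ : Set.InjOn σ {j | j < n}) {i j : ℕ} (hi : i < n) (hj : j < n)
    (hij : i ≠ j) : σ i ≠ σ j := fun h => hij (hσ hi hj h)

end Families

/-! ### Memory layouts of inputs and sub-products. -/

section Layout

variable {d u : ℕ} {m : Mem} {a b l l₀ l₁ l₂ l₃ c : List ℕ} {x : Var}

theorem inputs_nil (hm : Clean d m) : inputs d m [] [] = m := by
  rw [inputs, update_nil (hm _ (by simp [Var.Below])), update_nil (hm _ (by simp [Var.Below]))]

theorem update_inputs_A : update (inputs d m a b) (A d) l = inputs d m l b := by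
  ext1 v; simp only [inputs, update_apply]; split_ifs <;> simp_all

theorem update_inputs_B : update (inputs d m a b) (B d) l = inputs d m a l := by
  simp [inputs]

theorem inputs_of_ne (h₁ : x ≠ A d) (h₂ : x ≠ B d) : inputs d m a b x = m x := by
  simp [inputs, h₁, h₂]

theorem update_inputs_of_ne (h₁ : x ≠ A d) (h₂ : x ≠ B d) :
    update (inputs d m a b) x l = inputs d (update m x l) a b := by
  ext1 v; simp only [inputs, update_apply]; split_ifs <;> simp_all

/-- The memory of a processor during the recomposition at depth `d`. -/
def mid (d : ℕ) (m : Mem) (c l₀ l₁ l₂ l₃ : List ℕ) : Mem :=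
  prods d (update m (C (d + 1)) c) l₀ l₁ l₂ l₃

theorem mid_nil (hm : Clean (d + 1) m) : mid d m [] l₀ l₁ l₂ l₃ = prods d m l₀ l₁ l₂ l₃ := by
  rw [mid, update_nil (hm _ (by simp [Var.Below]))]

theorem mid_C : mid d m c l₀ l₁ l₂ l₃ (C (d + 1)) = c := by simp [mid, prods]

theorem mid_Q0 : mid d m c l₀ l₁ l₂ l₃ (Q 0 d) = l₀ := by simp [mid, prods]

theorem mid_Q1 : mid d m c l₀ l₁ l₂ l₃ (Q 1 d) = l₁ := by simp [mid, prods]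

theorem mid_Q2 : mid d m c l₀ l₁ l₂ l₃ (Q 2 d) = l₂ := by simp [mid, prods]

theorem mid_Q3 : mid d m c l₀ l₁ l₂ l₃ (Q 3 d) = l₃ := by simp [mid, prods]

theorem update_mid_C : update (mid d m c l₀ l₁ l₂ l₃) (C (d + 1)) l = mid d m l l₀ l₁ l₂ l₃ := by
  ext1 v; simp only [mid, prods, update_apply]; split_ifs <;> simp_all

theorem update_mid_Q0 : update (mid d m c l₀ l₁ l₂ l₃) (Q 0 d) l = mid d m c l l₁ l₂ l₃ := by
  rw [mid, update_prods_Q0, mid]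

theorem update_mid_Q1 : update (mid d m c l₀ l₁ l₂ l₃) (Q 1 d) l = mid d m c l₀ l l₂ l₃ := by
  rw [mid, update_prods_Q1, mid]

theorem update_mid_Q2 : update (mid d m c l₀ l₁ l₂ l₃) (Q 2 d) l = mid d m c l₀ l₁ l l₃ := by
  rw [mid, update_prods_Q2, mid]

theorem update_mid_Q3 : update (mid d m c l₀ l₁ l₂ l₃) (Q 3 d) l = mid d m c l₀ l₁ l₂ l := by
  rw [mid, update_prods_Q3, mid]

theorem Bnd.mid {v w : ℕ} (h : Bnd m u) (hc : c.length ≤ v) (h₀ : l₀.length ≤ w)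
    (h₁ : l₁.length ≤ w) (h₂ : l₂.length ≤ w) (h₃ : l₃.length ≤ w) :
    Bnd (mid d m c l₀ l₁ l₂ l₃) (u + v + 4 * w) := (h.set hc).prods h₀ h₁ h₂ h₃

end Layout

/-! ### Distribution of the inputs in the memory-independent mode. -/

section Split

variable {s w q d K u X Y : ℕ} {σ : ℕ → ℕ} {m : ℕ → Mem}

theorem block_append_half (s w q a x : ℕ) :
    block s w (2 * q + 2 * a) x ++ block s w (2 * q + 2 * a + 1) x = block s (2 * w) (q + a) x := by
  rw [← block_append, mul_add]

/-- The distribution of the inputs in the memory-independent mode. -/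
theorem tri_split (hσ : Set.InjOn σ {j | j < 4 * q}) (hK : u + 10 * w ≤ K)
    (hm : ∀ j < 4 * q, Clean d (m j) ∧ Bnd (m j) u) :
    Tri s K σ {j | j < 4 * q} (fun j => inputs d (m j) (block s w j X) (block s w j Y))
      (par q (fun j => [
        copy (σ (2 * j)) (A d) 0 w (A (d + 1)), copy (σ (2 * j)) (B d) 0 w (B (d + 1)),
        send (σ (2 * j + 1)) (σ (2 * j)) [⟨A d, 0, w, A (d + 1)⟩, ⟨B d, 0, w, B (d + 1)⟩],
        send (σ (2 * q + 2 * j)) (σ (2 * q + 2 * j + 1))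
          [⟨A d, 0, w, A (d + 1)⟩, ⟨B d, 0, w, B (d + 1)⟩],
        copy (σ (2 * q + 2 * j + 1)) (A d) 0 w (A (d + 1)),
        copy (σ (2 * q + 2 * j + 1)) (B d) 0 w (B (d + 1))]) ++
      par (4 * q) (fun j => [clear (σ j) (A d), clear (σ j) (B d)]) ++
      par q (fun j => [
        send (σ (2 * j)) (σ (2 * j + 1)) [⟨A (d + 1), 0, 2 * w, A (d + 1)⟩],
        send (σ (2 * q + 2 * j + 1)) (σ (2 * q + 2 * j)) [⟨A (d + 1), 0, 2 * w, A (d + 1)⟩]]) ++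
      par q (fun j => [
        send (σ (2 * j)) (σ (2 * q + 2 * j)) [⟨B (d + 1), 0, 2 * w, B (d + 1)⟩],
        send (σ (2 * q + 2 * j + 1)) (σ (2 * j + 1)) [⟨B (d + 1), 0, 2 * w, B (d + 1)⟩]]))
      (quad q
        (fun a => inputs (d + 1) (m (2 * a)) (block s (2 * w) a X) (block s (2 * w) a Y))
        (fun a => inputs (d + 1) (m (2 * a + 1)) (block s (2 * w) a X) (block s (2 * w) (q + a) Y))
        (fun a => inputs (d + 1) (m (2 * q + 2 * a)) (block s (2 * w) (q + a) X)
          (block s (2 * w) a Y))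
        (fun a => inputs (d + 1) (m (2 * q + 2 * a + 1)) (block s (2 * w) (q + a) X)
          (block s (2 * w) (q + a) Y))) 0 (6 * w) 3 := by
  set f₀ : ℕ → Mem := fun j => inputs d (m j) (block s w j X) (block s w j Y) with hf₀
  -- The underlying memory is a parameter: `f₁ f₀` still contains the old inputs, `f₁ m` no longer
  -- does, and the clearing step is the passage from one to the other.
  let f₁ : (ℕ → Mem) → ℕ → Mem := fun b => quad q
    (fun a => inputs (d + 1) (b (2 * a)) (block s (2 * w) a X) (block s (2 * w) a Y))
    (fun a => inputs (d + 1) (b (2 * a + 1)) [] [])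
    (fun a => inputs (d + 1) (b (2 * q + 2 * a)) [] [])
    (fun a => inputs (d + 1) (b (2 * q + 2 * a + 1)) (block s (2 * w) (q + a) X)
      (block s (2 * w) (q + a) Y))
  let f₃ : ℕ → Mem := quad q
    (fun a => inputs (d + 1) (m (2 * a)) (block s (2 * w) a X) (block s (2 * w) a Y))
    (fun a => inputs (d + 1) (m (2 * a + 1)) (block s (2 * w) a X) [])
    (fun a => inputs (d + 1) (m (2 * q + 2 * a)) (block s (2 * w) (q + a) X) [])
    (fun a => inputs (d + 1) (m (2 * q + 2 * a + 1)) (block s (2 * w) (q + a) X)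
      (block s (2 * w) (q + a) Y))
  let f₄ : ℕ → Mem := quad q
        (fun a => inputs (d + 1) (m (2 * a)) (block s (2 * w) a X) (block s (2 * w) a Y))
        (fun a => inputs (d + 1) (m (2 * a + 1)) (block s (2 * w) a X) (block s (2 * w) (q + a) Y))
        (fun a => inputs (d + 1) (m (2 * q + 2 * a)) (block s (2 * w) (q + a) X)
          (block s (2 * w) a Y))
        (fun a => inputs (d + 1) (m (2 * q + 2 * a + 1)) (block s (2 * w) (q + a) X)
          (block s (2 * w) (q + a) Y))
  have hc : ∀ j < 4 * q, Clean (d + 1) (f₀ j) := fun j hj => (hm j hj).1.inputs _ _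
  have hb : ∀ j < 4 * q, Bnd (f₀ j) (u + 2 * w) := fun j hj =>
    (hm j hj).2.inputs (by simp) (by simp)
  have hA : ∀ j, f₀ j (A d) = block s w j X := fun j => inputs_A ..
  have hB : ∀ j, f₀ j (B d) = block s w j Y := fun j => inputs_B ..
  have h0 : ∀ j < 4 * q, f₀ j = inputs (d + 1) (f₀ j) [] [] := fun j hj => (inputs_nil (hc j
      hj)).symm
  have hclr : ∀ j < 4 * q, update (update (f₀ j) (A d) []) (B d) [] = m j := fun j hj => by
    simp only [hf₀, update_inputs_A, update_inputs_B, inputs_nil (hm j hj).1]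
  -- The family becomes opaque, so that later simplifications see only the new inputs at depth `d +
  -- 1` on top of it.
  clear_value f₀
  have hne : ∀ {i j : ℕ}, i < 4 * q → j < 4 * q → i ≠ j → σ i ≠ σ j := fun hi hj hij =>
    ne_of_injOn hσ hi hj hij
  have t1 : Tri s K σ {j | j < 4 * q} f₀ (par q (fun j => [
        copy (σ (2 * j)) (A d) 0 w (A (d + 1)), copy (σ (2 * j)) (B d) 0 w (B (d + 1)),
        send (σ (2 * j + 1)) (σ (2 * j)) [⟨A d, 0, w, A (d + 1)⟩, ⟨B d, 0, w, B (d + 1)⟩]] ++ [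
        send (σ (2 * q + 2 * j)) (σ (2 * q + 2 * j + 1))
          [⟨A d, 0, w, A (d + 1)⟩, ⟨B d, 0, w, B (d + 1)⟩],
        copy (σ (2 * q + 2 * j + 1)) (A d) 0 w (A (d + 1)),
        copy (σ (2 * q + 2 * j + 1)) (B d) 0 w (B (d + 1))])) (f₁ f₀) 0 (2 * w) 1 := by
    refine Tri.par_two (α := fun a => 2 * a + 1) (β := fun a => 2 * a)
      (γ := fun a => 2 * q + 2 * a) (δ := fun a => 2 * q + 2 * a + 1) hσ (fun a ha => by omega)
      (fun a ha b hb => by omega) (fun a ha b hb => by omega) (fun j hj => ?_) (fun a ha => ?_)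
      (fun a ha => ?_)
    · exact quad_cases (p := fun j => ∃ a < q, j = 2 * a + 1 ∨ j = 2 * a ∨ j = 2 * q + 2 * a ∨
        j = 2 * q + 2 * a + 1) (fun a ha => ⟨a, ha, by simp⟩) (fun a ha => ⟨a, ha, by simp⟩)
        (fun a ha => ⟨a, ha, by simp⟩) (fun a ha => ⟨a, ha, by simp⟩) hj
    · refine (Tri.message (L₁ := []) (L₂ := [copy (σ (2 * a)) (A d) 0 w (A (d + 1)),
        copy (σ (2 * a)) (B d) 0 w (B (d + 1))]) (L₃ := []) (L₄ := [])
        (hne (by omega) (by omega) (by omega)) (by simp) (by simp [Instr.Local, Instr.Free])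
        (by simp) (by simp) (hb _ (by omega)) (hb _ (by omega)) (by simp; omega)
        (by simp [Instr.grow]; omega) ?_ ?_).weaken le_rfl (by simp; omega) le_rfl
      · simp only [f₁, quad_1 ha, lrun, List.foldl_nil]
        exact (h0 _ (by omega)).symm
      · rw [h0 (2 * a) (by omega)]
        simp [f₁, quad_0 ha, lrun, lstep, recv, inputs_A, inputs_B, update_inputs_A,
          update_inputs_B, inputs_of_ne, hA, hB, slice_block, block_append]
    · refine (Tri.message (L₁ := []) (L₄ := [copy (σ (2 * q + 2 * a + 1)) (A d) 0 w (A (d + 1)),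
        copy (σ (2 * q + 2 * a + 1)) (B d) 0 w (B (d + 1))]) (L₃ := []) (L₂ := [])
        (hne (by omega) (by omega) (by omega)) (by simp) (by simp)
        (by simp) (by simp [Instr.Local, Instr.Free]) (hb _ (by omega)) (hb _ (by omega))
        (by simp; omega) (by simp [Instr.grow]; omega) ?_ ?_).weaken le_rfl (by simp; omega) le_rfl
      · simp only [f₁, quad_2, lrun, List.foldl_nil]
        exact (h0 _ (by omega)).symm
      · rw [h0 (2 * q + 2 * a + 1) (by omega)]
        simp [f₁, quad_3, lrun, lstep, recv, inputs_A, inputs_B, update_inputs_A,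
          update_inputs_B, inputs_of_ne, hA, hB, slice_block, block_append_half]
  have h12 : ∀ j < 4 * q, ∃ p r : List ℕ, p.length ≤ 2 * w ∧ r.length ≤ 2 * w ∧
      f₁ f₀ j = inputs (d + 1) (f₀ j) p r ∧ f₁ m j = inputs (d + 1) (m j) p r := by
    intro j hj
    refine quad_cases (p := fun j => ∃ p r : List ℕ, p.length ≤ 2 * w ∧ r.length ≤ 2 * w ∧
      f₁ f₀ j = inputs (d + 1) (f₀ j) p r ∧ f₁ m j = inputs (d + 1) (m j) p r)
      (fun a ha => ?_) (fun a ha => ?_) (fun a ha => ?_) (fun a ha => ?_) hj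
    · exact ⟨_, _, (block_length ..).le, (block_length ..).le, quad_0 ha, quad_0 ha⟩
    · exact ⟨_, _, by simp, by simp, quad_1 ha, quad_1 ha⟩
    · exact ⟨_, _, by simp, by simp, quad_2, quad_2⟩
    · exact ⟨_, _, (block_length ..).le, (block_length ..).le, quad_3, quad_3⟩
  have b1 : ∀ j < 4 * q, Bnd (f₁ m j) (u + 4 * w) := by
    intro j hj
    obtain ⟨p, r, hp, hr, h1, h2⟩ := h12 j hj
    rw [h2]
    exact (((hm j hj).2.set hp).set hr).mono (by omega)
  have t2 : Tri s K σ {j | j < 4 * q} (f₁ f₀)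
      (par (4 * q) (fun j => [clear (σ j) (A d), clear (σ j) (B d)])) (f₁ m) 0 0 0 := by
    refine Tri.par_local (ι := id) hσ (fun a ha => ⟨ha, fun b hb => hb.ne⟩) (fun a ha => ?_)
      fun j hj hj' => (hj' j hj rfl).elim
    obtain ⟨p, r, hp, hr, h1, h2⟩ := h12 a ha
    refine Tri.free (u := u + 6 * w) (by simp [Instr.Local, Instr.Free]) ?_
      (by simp [Instr.grow]; omega) ?_
    · simp only [id, h1]
      exact (((hb a ha).set hp).set hr).mono (by omega)
    · simp only [id, h1, h2, lrun, lstep, List.foldl_cons, List.foldl_nil]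
      rw [update_inputs_of_ne (by simp) (by simp), update_inputs_of_ne (by simp) (by simp)]
      congr 1
      exact (hclr a ha).symm
  have t3 : Tri s K σ {j | j < 4 * q} (f₁ m) (par q (fun j => [
        send (σ (2 * j)) (σ (2 * j + 1)) [⟨A (d + 1), 0, 2 * w, A (d + 1)⟩]] ++ [
        send (σ (2 * q + 2 * j + 1)) (σ (2 * q + 2 * j)) [⟨A (d + 1), 0, 2 * w, A (d + 1)⟩]]))
      f₃ 0 (2 * w) 1 := by
    refine Tri.par_two (α := fun a => 2 * a) (β := fun a => 2 * a + 1)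
      (γ := fun a => 2 * q + 2 * a + 1) (δ := fun a => 2 * q + 2 * a) hσ (fun a ha => by omega)
      (fun a ha b hb => by omega) (fun a ha b hb => by omega) (fun j hj => ?_) (fun a ha => ?_)
      (fun a ha => ?_)
    · exact quad_cases (p := fun j => ∃ a < q, j = 2 * a ∨ j = 2 * a + 1 ∨ j = 2 * q + 2 * a + 1 ∨
        j = 2 * q + 2 * a) (fun a ha => ⟨a, ha, by simp⟩) (fun a ha => ⟨a, ha, by simp⟩)
        (fun a ha => ⟨a, ha, by simp⟩) (fun a ha => ⟨a, ha, by simp⟩) hj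
    · refine (Tri.message (L₁ := []) (L₂ := []) (L₃ := []) (L₄ := [])
        (hne (by omega) (by omega) (by omega)) (by simp) (by simp)
        (by simp) (by simp) (b1 _ (by omega)) (b1 _ (by omega)) (by simp; omega)
        (by simp; omega) ?_ ?_).weaken le_rfl (by simp) le_rfl
      · simp [f₁, f₃, quad_0 ha, lrun]
      · simp [f₁, f₃, quad_0 ha, quad_1 ha, lrun, recv, inputs_A, update_inputs_A, slice_block]
    · refine (Tri.message (L₁ := []) (L₂ := []) (L₃ := []) (L₄ := [])
        (hne (by omega) (by omega) (by omega)) (by simp) (by simp)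
        (by simp) (by simp) (b1 _ (by omega)) (b1 _ (by omega)) (by simp; omega)
        (by simp; omega) ?_ ?_).weaken le_rfl (by simp) le_rfl
      · simp [f₁, f₃, quad_3, lrun]
      · simp [f₁, f₃, quad_2, quad_3, lrun, recv, inputs_A, update_inputs_A, slice_block]
  have b3 : ∀ j < 4 * q, Bnd (f₃ j) (u + 4 * w) := by
    intro j hj
    refine quad_cases (p := fun j => Bnd (f₃ j) (u + 4 * w))
      (fun a ha => ?_) (fun a ha => ?_) (fun a ha => ?_) (fun a ha => ?_) hj
    · simp only [f₃, quad_0 ha]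
      exact (((hm _ (by omega)).2.set (a := 2 * w) (by simp)).set (a := 2 * w) (by simp)).mono
        (by omega)
    · simp only [f₃, quad_1 ha]
      exact (((hm _ (by omega)).2.set (a := 2 * w) (by simp)).set (a := 2 * w) (by simp)).mono
        (by omega)
    · simp only [f₃, quad_2]
      exact (((hm _ (by omega)).2.set (a := 2 * w) (by simp)).set (a := 2 * w) (by simp)).mono
        (by omega)
    · simp only [f₃, quad_3]
      exact (((hm _ (by omega)).2.set (a := 2 * w) (by simp)).set (a := 2 * w) (by simp)).mono
        (by omega)
  have t4 : Tri s K σ {j | j < 4 * q} f₃ (par q (fun j => [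
        send (σ (2 * j)) (σ (2 * q + 2 * j)) [⟨B (d + 1), 0, 2 * w, B (d + 1)⟩]] ++ [
        send (σ (2 * q + 2 * j + 1)) (σ (2 * j + 1)) [⟨B (d + 1), 0, 2 * w, B (d + 1)⟩]]))
      f₄ 0 (2 * w) 1 := by
    refine Tri.par_two (α := fun a => 2 * a) (β := fun a => 2 * q + 2 * a)
      (γ := fun a => 2 * q + 2 * a + 1) (δ := fun a => 2 * a + 1) hσ (fun a ha => by omega)
      (fun a ha b hb => by omega) (fun a ha b hb => by omega) (fun j hj => ?_) (fun a ha => ?_)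
      (fun a ha => ?_)
    · exact quad_cases (p := fun j => ∃ a < q, j = 2 * a ∨ j = 2 * q + 2 * a ∨
        j = 2 * q + 2 * a + 1 ∨ j = 2 * a + 1) (fun a ha => ⟨a, ha, by simp⟩)
        (fun a ha => ⟨a, ha, by simp⟩) (fun a ha => ⟨a, ha, by simp⟩)
        (fun a ha => ⟨a, ha, by simp⟩) hj
    · refine (Tri.message (L₁ := []) (L₂ := []) (L₃ := []) (L₄ := [])
        (hne (by omega) (by omega) (by omega)) (by simp) (by simp)
        (by simp) (by simp) (b3 _ (by omega)) (b3 _ (by omega)) (by simp; omega)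
        (by simp; omega) ?_ ?_).weaken le_rfl (by simp) le_rfl
      · simp [f₃, f₄, quad_0 ha, lrun]
      · simp [f₃, f₄, quad_0 ha, quad_2, lrun, recv, inputs_B, update_inputs_B, slice_block]
    · refine (Tri.message (L₁ := []) (L₂ := []) (L₃ := []) (L₄ := [])
        (hne (by omega) (by omega) (by omega)) (by simp) (by simp)
        (by simp) (by simp) (b3 _ (by omega)) (b3 _ (by omega)) (by simp; omega)
        (by simp; omega) ?_ ?_).weaken le_rfl (by simp) le_rfl
      · simp [f₃, f₄, quad_3, lrun]
      · simp [f₃, f₄, quad_1 ha, quad_3, lrun, recv, inputs_B, update_inputs_B, slice_block]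
  exact (((t1.seq t2).seq t3).seq t4).weaken (by omega) (by omega) (by omega)

end Split

/-! ### Redistribution of the sub-products in the memory-independent mode. -/

section Redistribute

variable {s v q d K u P₀ P₁ P₂ P₃ : ℕ} {σ : ℕ → ℕ} {m : ℕ → Mem}

theorem quad_prop {q : ℕ} {x₀ x₁ x₂ x₃ : ℕ → Mem} {p : Mem → Prop} (h₀ : ∀ a < q, p (x₀ a))
    (h₁ : ∀ a < q, p (x₁ a)) (h₂ : ∀ a < q, p (x₂ a)) (h₃ : ∀ a < q, p (x₃ a)) :
    ∀ j < 4 * q, p (quad q x₀ x₁ x₂ x₃ j) := fun _ hj =>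
  quad_cases (p := fun j => p (quad q x₀ x₁ x₂ x₃ j)) (fun a ha => by rw [quad_0 ha]; exact h₀ a ha)
    (fun a ha => by rw [quad_1 ha]; exact h₁ a ha) (fun a ha => by rw [quad_2]; exact h₂ a ha)
    (fun a ha => by rw [quad_3]; exact h₃ a ha) hj

theorem quar_prop {q : ℕ} {x₀ x₁ x₂ x₃ : ℕ → Mem} {p : Mem → Prop} (h₀ : ∀ a < q, p (x₀ a))
    (h₁ : ∀ a < q, p (x₁ a)) (h₂ : ∀ a < q, p (x₂ a)) (h₃ : ∀ a < q, p (x₃ a)) :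
    ∀ j < 4 * q, p (quar q x₀ x₁ x₂ x₃ j) := fun _ hj =>
  quar_cases (p := fun j => p (quar q x₀ x₁ x₂ x₃ j)) (fun a ha => by rw [quar_0 ha]; exact h₀ a ha)
    (fun a ha => by rw [quar_1 ha]; exact h₁ a ha) (fun a ha => by rw [quar_2 ha]; exact h₂ a ha)
    (fun a ha => by rw [quar_3]; exact h₃ a ha) hj

/-- The redistribution of the sub-products in the memory-independent mode. -/
theorem tri_redistribute (hσ : Set.InjOn σ {j | j < 4 * q}) (hK : u + 8 * v ≤ K)
    (hm : ∀ j < 4 * q, Bnd (m j) u) :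
    Tri s K σ {j | j < 4 * q}
      (quad q (fun a => mid d (m (2 * a)) (block s (2 * v) a P₀) [] [] [] [])
        (fun a => mid d (m (2 * a + 1)) (block s (2 * v) a P₁) [] [] [] [])
        (fun a => mid d (m (2 * q + 2 * a)) (block s (2 * v) a P₂) [] [] [] [])
        (fun a => mid d (m (2 * q + 2 * a + 1)) (block s (2 * v) a P₃) [] [] [] []))
      (par q (fun j => [
        copy (σ (2 * j)) (C (d + 1)) 0 v (Q 0 d),
        send (σ (2 * j)) (σ (2 * j + 1)) [⟨C (d + 1), v, v, Q 0 d⟩], clear (σ (2 * j)) (C (d + 1)),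
        copy (σ (2 * q + 2 * j + 1)) (C (d + 1)) v v (Q 3 d),
        send (σ (2 * q + 2 * j + 1)) (σ (2 * q + 2 * j)) [⟨C (d + 1), 0, v, Q 3 d⟩],
        clear (σ (2 * q + 2 * j + 1)) (C (d + 1))]) ++
      par q (fun j => [
        copy (σ (2 * j + 1)) (C (d + 1)) v v (Q 1 d),
        send (σ (2 * j + 1)) (σ (2 * j)) [⟨C (d + 1), 0, v, Q 1 d⟩],
        clear (σ (2 * j + 1)) (C (d + 1)),
        copy (σ (2 * q + 2 * j)) (C (d + 1)) 0 v (Q 2 d),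
        send (σ (2 * q + 2 * j)) (σ (2 * q + 2 * j + 1)) [⟨C (d + 1), v, v, Q 2 d⟩],
        clear (σ (2 * q + 2 * j)) (C (d + 1))]) ++
      par q (fun j => [
        send (σ (q + j)) (σ (2 * q + j)) [⟨Q 1 d, 0, v, Q 1 d⟩], clear (σ (q + j)) (Q 1 d)]) ++
      par q (fun j => [
        send (σ (2 * q + j)) (σ (q + j)) [⟨Q 2 d, 0, v, Q 2 d⟩],
        clear (σ (2 * q + j)) (Q 2 d)]) ++
      par q (fun j => [
        send (σ j) (σ (q + j)) [⟨Q 1 d, 0, v, Q 1 d⟩], clear (σ j) (Q 1 d),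
        send (σ (3 * q + j)) (σ (2 * q + j)) [⟨Q 2 d, 0, v, Q 2 d⟩],
        clear (σ (3 * q + j)) (Q 2 d)]))
      (fun j => mid d (m j) [] (if j < 2 * q then block s v j P₀ else [])
        (if q ≤ j ∧ j < 3 * q then block s v (j - q) P₁ else [])
        (if q ≤ j ∧ j < 3 * q then block s v (j - q) P₂ else [])
        (if 2 * q ≤ j then block s v (j - 2 * q) P₃ else [])) 0 (5 * v) 5 := by
  let f₅ : ℕ → Mem := quad q (fun a => mid d (m (2 * a)) (block s (2 * v) a P₀) [] [] [] [])
    (fun a => mid d (m (2 * a + 1)) (block s (2 * v) a P₁) [] [] [] [])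
    (fun a => mid d (m (2 * q + 2 * a)) (block s (2 * v) a P₂) [] [] [] [])
    (fun a => mid d (m (2 * q + 2 * a + 1)) (block s (2 * v) a P₃) [] [] [] [])
  let f₆ : ℕ → Mem := quad q (fun a => mid d (m (2 * a)) [] (block s v (2 * a) P₀) [] [] [])
    (fun a => mid d (m (2 * a + 1)) (block s (2 * v) a P₁) (block s v (2 * a + 1) P₀) [] [] [])
    (fun a => mid d (m (2 * q + 2 * a)) (block s (2 * v) a P₂) [] [] [] (block s v (2 * a) P₃))
    (fun a => mid d (m (2 * q + 2 * a + 1)) [] [] [] [] (block s v (2 * a + 1) P₃))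
  -- After two exchanges between neighbours the products 0 and 1 lie in order in the lower half, the
  -- products 2 and 3 in the upper half. Product 1 still has to move up and product 2 down, by one
  -- quarter each.
  let f₇ : ℕ → Mem := fun j => if j < 2 * q then
      mid d (m j) [] (block s v j P₀) (block s v j P₁) [] []
    else mid d (m j) [] [] [] (block s v (j - 2 * q) P₂) (block s v (j - 2 * q) P₃)
  let f₈ : ℕ → Mem := quar q (fun a => mid d (m a) [] (block s v a P₀) (block s v a P₁) [] [])
    (fun a => mid d (m (q + a)) [] (block s v (q + a) P₀) [] [] [])
    (fun a => mid d (m (2 * q + a)) [] [] (block s v (q + a) P₁) (block s v a P₂) (block s v a P₃))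
    (fun a => mid d (m (3 * q + a)) [] [] [] (block s v (q + a) P₂) (block s v (q + a) P₃))
  let f₉ : ℕ → Mem := quar q (fun a => mid d (m a) [] (block s v a P₀) (block s v a P₁) [] [])
    (fun a => mid d (m (q + a)) [] (block s v (q + a) P₀) [] (block s v a P₂) [])
    (fun a => mid d (m (2 * q + a)) [] [] (block s v (q + a) P₁) [] (block s v a P₃))
    (fun a => mid d (m (3 * q + a)) [] [] [] (block s v (q + a) P₂) (block s v (q + a) P₃))
  have hne : ∀ {i j : ℕ}, i < 4 * q → j < 4 * q → i ≠ j → σ i ≠ σ j := fun hi hj hij =>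
    ne_of_injOn hσ hi hj hij
  have hbm : ∀ j < 4 * q, ∀ {c l₀ l₁ l₂ l₃ : List ℕ}, c.length ≤ 2 * v → l₀.length ≤ v →
      l₁.length ≤ v → l₂.length ≤ v → l₃.length ≤ v →
      Bnd (mid d (m j) c l₀ l₁ l₂ l₃) (u + 6 * v) := fun j hj _ _ _ _ _ h h0 h1 h2 h3 =>
    ((hm j hj).mid h h0 h1 h2 h3).mono (by omega)
  have b5 : ∀ j < 4 * q, Bnd (f₅ j) (u + 6 * v) := by
    refine quad_prop (p := fun M => Bnd M (u + 6 * v)) ?_ ?_ ?_ ?_ <;>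
        intro a ha <;> apply hbm <;> (try simp) <;> omega
  have b6 : ∀ j < 4 * q, Bnd (f₆ j) (u + 6 * v) := by
    refine quad_prop (p := fun M => Bnd M (u + 6 * v)) ?_ ?_ ?_ ?_ <;>
        intro a ha <;> apply hbm <;> (try simp) <;> omega
  have b7 : ∀ j < 4 * q, Bnd (f₇ j) (u + 6 * v) := by
    intro j hj
    simp only [f₇]
    split_ifs <;> apply hbm <;> simp [hj]
  have b8 : ∀ j < 4 * q, Bnd (f₈ j) (u + 6 * v) := by
    refine quar_prop (p := fun M => Bnd M (u + 6 * v)) ?_ ?_ ?_ ?_ <;>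
        intro a ha <;> apply hbm <;> (try simp) <;> omega
  have b9 : ∀ j < 4 * q, Bnd (f₉ j) (u + 6 * v) := by
    refine quar_prop (p := fun M => Bnd M (u + 6 * v)) ?_ ?_ ?_ ?_ <;>
        intro a ha <;> apply hbm <;> (try simp) <;> omega
  have e7lo : ∀ j < 2 * q, f₇ j = mid d (m j) [] (block s v j P₀) (block s v j P₁) [] [] :=
    fun j hj => if_pos hj
  have e7hi : ∀ j, f₇ (2 * q + j) =
      mid d (m (2 * q + j)) [] [] [] (block s v j P₂) (block s v j P₃) := fun j => by
    simp only [f₇]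
    rw [if_neg (by omega), Nat.add_sub_cancel_left]
  have e7hi' : ∀ a, f₇ (3 * q + a) =
      mid d (m (3 * q + a)) [] [] [] (block s v (q + a) P₂) (block s v (q + a) P₃) := fun a => by
    rw [show 3 * q + a = 2 * q + (q + a) by ring, e7hi]
  have t6 : Tri s K σ {j | j < 4 * q} f₅ (par q (fun j => [
        copy (σ (2 * j)) (C (d + 1)) 0 v (Q 0 d),
        send (σ (2 * j)) (σ (2 * j + 1)) [⟨C (d + 1), v, v, Q 0 d⟩],
        clear (σ (2 * j)) (C (d + 1))] ++ [
        copy (σ (2 * q + 2 * j + 1)) (C (d + 1)) v v (Q 3 d),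
        send (σ (2 * q + 2 * j + 1)) (σ (2 * q + 2 * j)) [⟨C (d + 1), 0, v, Q 3 d⟩],
        clear (σ (2 * q + 2 * j + 1)) (C (d + 1))])) f₆ 0 v 1 := by
    refine Tri.par_two (α := fun a => 2 * a) (β := fun a => 2 * a + 1)
      (γ := fun a => 2 * q + 2 * a + 1) (δ := fun a => 2 * q + 2 * a) hσ (fun a ha => by omega)
      (fun a ha b hb => by omega) (fun a ha b hb => by omega) (fun j hj => ?_) (fun a ha => ?_)
      (fun a ha => ?_)
    · exact quad_cases (p := fun j => ∃ a < q, j = 2 * a ∨ j = 2 * a + 1 ∨ j = 2 * q + 2 * a + 1 ∨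
        j = 2 * q + 2 * a) (fun a ha => ⟨a, ha, by simp⟩) (fun a ha => ⟨a, ha, by simp⟩)
        (fun a ha => ⟨a, ha, by simp⟩) (fun a ha => ⟨a, ha, by simp⟩) hj
    · refine (Tri.message (L₁ := [copy (σ (2 * a)) (C (d + 1)) 0 v (Q 0 d)]) (L₂ := [])
        (L₃ := [clear (σ (2 * a)) (C (d + 1))]) (L₄ := [])
        (hne (by omega) (by omega) (by omega)) (by simp [Instr.Local, Instr.Free]) (by simp)
        (by simp [Instr.Local, Instr.Free]) (by simp) (b5 _ (by omega)) (b5 _ (by omega))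
        (by simp [Instr.grow]; omega) (by simp; omega) ?_ ?_).weaken le_rfl (by simp) le_rfl
      · simp [f₅, f₆, quad_0 ha, lrun, lstep, mid_C, mid_Q0, update_mid_C, update_mid_Q0,
          slice_block_lo]
      · simp [f₅, f₆, quad_0 ha, quad_1 ha, lrun, lstep, recv, mid_C, mid_Q0, update_mid_Q0,
          slice_block_hi]
    · refine (Tri.message (L₁ := [copy (σ (2 * q + 2 * a + 1)) (C (d + 1)) v v (Q 3 d)]) (L₂ := [])
        (L₃ := [clear (σ (2 * q + 2 * a + 1)) (C (d + 1))]) (L₄ := [])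
        (hne (by omega) (by omega) (by omega)) (by simp [Instr.Local, Instr.Free]) (by simp)
        (by simp [Instr.Local, Instr.Free]) (by simp) (b5 _ (by omega)) (b5 _ (by omega))
        (by simp [Instr.grow]; omega) (by simp; omega) ?_ ?_).weaken le_rfl (by simp) le_rfl
      · simp [f₅, f₆, quad_3, lrun, lstep, mid_C, mid_Q3, update_mid_C, update_mid_Q3,
          slice_block_hi]
      · simp [f₅, f₆, quad_2, quad_3, lrun, lstep, recv, mid_C, mid_Q3, update_mid_Q3,
          slice_block_lo]
  have t7 : Tri s K σ {j | j < 4 * q} f₆ (par q (fun j => [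
        copy (σ (2 * j + 1)) (C (d + 1)) v v (Q 1 d),
        send (σ (2 * j + 1)) (σ (2 * j)) [⟨C (d + 1), 0, v, Q 1 d⟩],
        clear (σ (2 * j + 1)) (C (d + 1))] ++ [
        copy (σ (2 * q + 2 * j)) (C (d + 1)) 0 v (Q 2 d),
        send (σ (2 * q + 2 * j)) (σ (2 * q + 2 * j + 1)) [⟨C (d + 1), v, v, Q 2 d⟩],
        clear (σ (2 * q + 2 * j)) (C (d + 1))])) f₇ 0 v 1 := by
    refine Tri.par_two (α := fun a => 2 * a + 1) (β := fun a => 2 * a)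
      (γ := fun a => 2 * q + 2 * a) (δ := fun a => 2 * q + 2 * a + 1) hσ (fun a ha => by omega)
      (fun a ha b hb => by omega) (fun a ha b hb => by omega) (fun j hj => ?_) (fun a ha => ?_)
      (fun a ha => ?_)
    · exact quad_cases (p := fun j => ∃ a < q, j = 2 * a + 1 ∨ j = 2 * a ∨ j = 2 * q + 2 * a ∨
        j = 2 * q + 2 * a + 1) (fun a ha => ⟨a, ha, by simp⟩) (fun a ha => ⟨a, ha, by simp⟩)
        (fun a ha => ⟨a, ha, by simp⟩) (fun a ha => ⟨a, ha, by simp⟩) hj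
    · refine (Tri.message (L₁ := [copy (σ (2 * a + 1)) (C (d + 1)) v v (Q 1 d)]) (L₂ := [])
        (L₃ := [clear (σ (2 * a + 1)) (C (d + 1))]) (L₄ := [])
        (hne (by omega) (by omega) (by omega)) (by simp [Instr.Local, Instr.Free]) (by simp)
        (by simp [Instr.Local, Instr.Free]) (by simp) (b6 _ (by omega)) (b6 _ (by omega))
        (by simp [Instr.grow]; omega) (by simp; omega) ?_ ?_).weaken le_rfl (by simp) le_rfl
      · rw [e7lo _ (by omega)]
        simp [f₆, quad_1 ha, lrun, lstep, mid_C, mid_Q1, update_mid_C, update_mid_Q1,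
          slice_block_hi]
      · rw [e7lo _ (by omega)]
        simp [f₆, quad_0 ha, quad_1 ha, lrun, lstep, recv, mid_C, mid_Q1, update_mid_Q1,
          slice_block_lo]
    · refine (Tri.message (L₁ := [copy (σ (2 * q + 2 * a)) (C (d + 1)) 0 v (Q 2 d)]) (L₂ := [])
        (L₃ := [clear (σ (2 * q + 2 * a)) (C (d + 1))]) (L₄ := [])
        (hne (by omega) (by omega) (by omega)) (by simp [Instr.Local, Instr.Free]) (by simp)
        (by simp [Instr.Local, Instr.Free]) (by simp) (b6 _ (by omega)) (b6 _ (by omega))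
        (by simp [Instr.grow]; omega) (by simp; omega) ?_ ?_).weaken le_rfl (by simp) le_rfl
      · rw [e7hi]
        simp [f₆, quad_2, lrun, lstep, mid_C, mid_Q2, update_mid_C, update_mid_Q2,
          slice_block_lo]
      · rw [add_assoc, e7hi, ← add_assoc]
        simp [f₆, quad_2, quad_3, lrun, lstep, recv, mid_C, mid_Q2, update_mid_Q2,
          slice_block_hi]
  -- Messages append, so the target variable must be empty on arrival. The two inner quarters
  -- therefore exchange and release their blocks before the outer quarters send theirs.
  have t8 : Tri s K σ {j | j < 4 * q} f₇ (par q (fun j => [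
        send (σ (q + j)) (σ (2 * q + j)) [⟨Q 1 d, 0, v, Q 1 d⟩], clear (σ (q + j)) (Q 1 d)]))
      f₈ 0 v 1 := by
    refine Tri.par_one (α := fun a => q + a) (β := fun a => 2 * q + a) hσ (fun a ha => by omega)
      (fun a ha b hb => by omega) (fun a ha b hb => by omega) (fun a ha => ?_) (fun j hj hj' => ?_)
    · refine (Tri.message (L₁ := []) (L₂ := []) (L₃ := [clear (σ (q + a)) (Q 1 d)]) (L₄ := [])
        (hne (by omega) (by omega) (by omega)) (by simp) (by simp)
        (by simp [Instr.Local, Instr.Free]) (by simp) (b7 _ (by omega)) (b7 _ (by omega))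
        (by simp [Instr.grow]; omega) (by simp; omega) ?_ ?_).weaken le_rfl (by simp) le_rfl
      · rw [e7lo _ (by omega)]
        simp [f₈, quar_1 ha, lrun, lstep, update_mid_Q1]
      · rw [e7lo _ (by omega), e7hi]
        simp [f₈, quar_2 ha, lrun, recv, mid_Q1, update_mid_Q1, slice_block]
    · refine ⟨?_, (b7 j hj).mono (by omega)⟩
      refine quar_cases (p := fun j => (∀ a < q, j ≠ q + a ∧ j ≠ 2 * q + a) → f₈ j = f₇ j)
        (fun a ha _ => ?_) (fun a ha h => ((h a ha).1 rfl).elim)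
        (fun a ha h => ((h a ha).2 rfl).elim) (fun a ha _ => ?_) hj hj'
      · rw [e7lo _ (by omega)]; exact quar_0 ha
      · rw [e7hi']; exact quar_3
  have t9 : Tri s K σ {j | j < 4 * q} f₈ (par q (fun j => [
        send (σ (2 * q + j)) (σ (q + j)) [⟨Q 2 d, 0, v, Q 2 d⟩],
        clear (σ (2 * q + j)) (Q 2 d)])) f₉ 0 v 1 := by
    refine Tri.par_one (α := fun a => 2 * q + a) (β := fun a => q + a) hσ (fun a ha => by omega)
      (fun a ha b hb => by omega) (fun a ha b hb => by omega) (fun a ha => ?_) (fun j hj hj' => ?_)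
    · refine (Tri.message (L₁ := []) (L₂ := []) (L₃ := [clear (σ (2 * q + a)) (Q 2 d)]) (L₄ := [])
        (hne (by omega) (by omega) (by omega)) (by simp) (by simp)
        (by simp [Instr.Local, Instr.Free]) (by simp) (b8 _ (by omega)) (b8 _ (by omega))
        (by simp [Instr.grow]; omega) (by simp; omega) ?_ ?_).weaken le_rfl (by simp) le_rfl
      · simp [f₈, f₉, quar_2 ha, lrun, lstep, update_mid_Q2]
      · simp [f₈, f₉, quar_1 ha, quar_2 ha, lrun, recv, mid_Q2, update_mid_Q2, slice_block]
    · refine ⟨?_, (b8 j hj).mono (by omega)⟩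
      refine quar_cases (p := fun j => (∀ a < q, j ≠ 2 * q + a ∧ j ≠ q + a) → f₉ j = f₈ j)
        (fun a ha _ => ?_) (fun a ha h => ((h a ha).2 rfl).elim)
        (fun a ha h => ((h a ha).1 rfl).elim) (fun a ha _ => ?_) hj hj'
      · simp only [f₈, f₉, quar_0 ha]
      · simp only [f₈, f₉, quar_3]
  let f₁₀ : ℕ → Mem := fun j => mid d (m j) [] (if j < 2 * q then block s v j P₀ else [])
        (if q ≤ j ∧ j < 3 * q then block s v (j - q) P₁ else [])
        (if q ≤ j ∧ j < 3 * q then block s v (j - q) P₂ else [])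
        (if 2 * q ≤ j then block s v (j - 2 * q) P₃ else [])
  have t10 : Tri s K σ {j | j < 4 * q} f₉ (par q (fun j => [
        send (σ j) (σ (q + j)) [⟨Q 1 d, 0, v, Q 1 d⟩], clear (σ j) (Q 1 d)] ++ [
        send (σ (3 * q + j)) (σ (2 * q + j)) [⟨Q 2 d, 0, v, Q 2 d⟩],
        clear (σ (3 * q + j)) (Q 2 d)])) f₁₀ 0 v 1 := by
    refine Tri.par_two (α := fun a => a) (β := fun a => q + a)
      (γ := fun a => 3 * q + a) (δ := fun a => 2 * q + a) hσ (fun a ha => by omega)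
      (fun a ha b hb => by omega) (fun a ha b hb => by omega) (fun j hj => ?_) (fun a ha => ?_)
      (fun a ha => ?_)
    · exact quar_cases (p := fun j => ∃ a < q, j = a ∨ j = q + a ∨ j = 3 * q + a ∨
        j = 2 * q + a) (fun a ha => ⟨a, ha, by simp⟩) (fun a ha => ⟨a, ha, by simp⟩)
        (fun a ha => ⟨a, ha, by simp⟩) (fun a ha => ⟨a, ha, by simp⟩) hj
    · refine (Tri.message (L₁ := []) (L₂ := []) (L₃ := [clear (σ a) (Q 1 d)]) (L₄ := [])
        (hne (by omega) (by omega) (by omega)) (by simp) (by simp)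
        (by simp [Instr.Local, Instr.Free]) (by simp) (b9 _ (by omega)) (b9 _ (by omega))
        (by simp [Instr.grow]; omega) (by simp; omega) ?_ ?_).weaken le_rfl (by simp) le_rfl
      · have e1 : a < 2 * q := by omega
        have e2 : ¬ q ≤ a := by omega
        have e3 : ¬ 2 * q ≤ a := by omega
        simp [f₉, f₁₀, quar_0 ha, lrun, lstep, update_mid_Q1, e1, e2, e3]
      · have e1 : q + a < 2 * q := by omega
        have e2 : q + a < 3 * q := by omega
        have e3 : ¬ 2 * q ≤ q + a := by omega
        simp [f₉, f₁₀, quar_0 ha, quar_1 ha, lrun, recv, mid_Q1, update_mid_Q1, slice_block,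
          e1, e2, e3]
    · refine (Tri.message (L₁ := []) (L₂ := []) (L₃ := [clear (σ (3 * q + a)) (Q 2 d)]) (L₄ := [])
        (hne (by omega) (by omega) (by omega)) (by simp) (by simp)
        (by simp [Instr.Local, Instr.Free]) (by simp) (b9 _ (by omega)) (b9 _ (by omega))
        (by simp [Instr.grow]; omega) (by simp; omega) ?_ ?_).weaken le_rfl (by simp) le_rfl
      · have e1 : ¬ 3 * q + a < 2 * q := by omega
        have e3 : 2 * q ≤ 3 * q + a := by omega
        have e4 : 3 * q + a - 2 * q = q + a := by omega
        simp [f₉, f₁₀, quar_3, lrun, lstep, update_mid_Q2, e1, e3, e4]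
      · have e2 : q ≤ 2 * q + a := by omega
        have e3 : 2 * q + a < 3 * q := by omega
        have e4 : 2 * q + a - q = q + a := by omega
        simp [f₉, f₁₀, quar_2 ha, quar_3, lrun, recv, mid_Q2, update_mid_Q2, slice_block,
          e2, e3, e4]
  exact ((((t6.seq t7).seq t8).seq t9).seq t10).weaken (by omega) (by omega) (by omega)

end Redistribute

/-! ### The memory-independent recursion. -/

/-- The halves of two numbers and the value of their product. -/
theorem mul_halves (H X Y : ℕ) :
    X % H * (Y % H) + H * (X % H * (Y / H)) + H * (X / H * (Y % H)) + H ^ 2 * (X / H * (Y / H)) =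
      X * Y := by
  conv_rhs => rw [← Nat.mod_add_div X H, ← Nat.mod_add_div Y H]
  ring

theorem mid_of_clean {d : ℕ} {m : Mem} {c : List ℕ} (hm : Clean d m) :
    mid d m c [] [] [] [] = update m (C (d + 1)) c := by
  have h : ∀ i, m (Q i d) = [] := fun i => hm _ (by simp [Var.Below])
  ext1 v; simp only [mid, prods, update_apply]; split_ifs <;> simp_all

/-- COPSIM in the memory-independent mode. -/
theorem tri_copsimMI {s : ℕ} (hs : 2 ≤ s) : ∀ (k r d : ℕ) (σ : ℕ → ℕ) (m : ℕ → Mem)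
    (X Y u K t n l : ℕ), Set.InjOn σ {j | j < 4 ^ k} →
    (∀ j < 4 ^ k, Clean d (m j) ∧ Bnd (m j) u) →
    X < s ^ (4 ^ k * 2 ^ r) → Y < s ^ (4 ^ k * 2 ^ r) → u + 12 * 2 ^ (r + k) ≤ K →
    12 * 4 ^ (r + k) + 36 * 2 ^ (r + k) + 12 * (k * (k + 1)) ≤ t + 36 * 2 ^ r →
    16 * 2 ^ (r + k) + 12 * (k * (k + 1)) ≤ n + 16 * 2 ^ r → 6 * k ^ 2 + 14 * k ≤ l →
    Tri s K σ {j | j < 4 ^ k}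
      (fun j => inputs d (m j) (block s (2 ^ r) j X) (block s (2 ^ r) j Y)) (copsimMI k r σ d)
      (fun j => update (m j) (C d) (block s (2 * 2 ^ r) j (X * Y))) t n l := by
  intro k
  induction k with
  | zero =>
    intro r d σ m X Y u K t n l hσ hm hX hY hK ht hn hl
    -- On one processor the budget is `12 * 4 ^ r` operations and `12 * 2 ^ r` words; long
    -- multiplication needs `12 * 4 ^ r - 9 * 2 ^ r` operations and `8 * 2 ^ r` words.
    obtain ⟨hc, hb⟩ := hm 0 (by simp)
    simp only [pow_zero, one_mul, add_zero] at *
    have h := ltri_slim hs (σ 0) r d hc hb hX hY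
    have ho := lops_slim (σ 0) r d
    have hD : {j | j < 1} = ({0} : Set ℕ) := by ext; simp
    rw [hD]
    refine (Tri.local (t := t) slim_local ?_ ?_ (by omega)).weaken le_rfl (Nat.zero_le _)
      (Nat.zero_le _)
    · simp only [block_zero_left]; exact h.1.symm
    · simp only [block_zero_left]; exact h.2.mono (by omega)
  | succ k ih =>
    intro r d σ m X Y u K t n l hσ hm hX hY hK ht hn hl
    have hs0 : 0 < s := by omega
    have h4 : 4 ^ (k + 1) = 4 * 4 ^ k := by rw [pow_succ]; ring
    have hw1 : 1 ≤ 2 ^ r := Nat.one_le_two_pow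
    have hwk : 2 ^ (r + (k + 1)) = 2 * 2 ^ (r + k) := by rw [← add_assoc, pow_succ]; ring
    have hrk : 2 ^ r ≤ 2 ^ (r + k) := Nat.pow_le_pow_right (by omega) (by omega)
    -- The sum of the two exponents is the same in the sub-problems. Since each processor serves
    -- only one of them and its old inputs are cleared, the memory bound passes down unchanged.
    have hr1 : r + 1 + k = r + (k + 1) := by ring
    -- The closed forms are chosen to telescope: these increments are the logarithmic costs of the
    -- sums at one level, together with the eight messages of splitting and redistribution.
    have hkk : (k + 1) * (k + 1 + 1) = k * (k + 1) + 2 * (k + 1) := by ring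
    have hk2 : 6 * (k + 1) ^ 2 + 14 * (k + 1) = 6 * k ^ 2 + 14 * k + 12 * (k + 1) + 8 := by ring
    have hv : 2 ^ (r + 1) = 2 * 2 ^ r := by rw [pow_succ]; ring
    rw [h4] at hσ hm hX hY
    set q := 4 ^ k with hq
    set w := 2 ^ r with hw
    let H := s ^ (q * (2 * w))
    have hH : 0 < H := by positivity
    have hHH : H * H = s ^ (4 * q * w) := by rw [← pow_add]; congr 1; ring
    have hmodlt : ∀ Z : ℕ, Z % H < H := fun Z => Nat.mod_lt _ hH
    have hdivlt : ∀ Z : ℕ, Z < s ^ (4 * q * w) → Z / H < H := fun Z hZ =>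
      Nat.div_lt_of_lt_mul (by rwa [hHH])
    have blo : ∀ (Z a : ℕ), a < q → block s (2 * w) a (Z % H) = block s (2 * w) a Z :=
      fun Z a ha => block_mod (Nat.mul_le_mul_right _ ha)
    have bhi : ∀ Z a : ℕ, block s (2 * w) a (Z / H) = block s (2 * w) (q + a) Z := fun Z a =>
      block_div s (2 * w) q a Z
    have inj : ∀ ι : ℕ → ℕ, (∀ a < q, ι a < 4 * q ∧ ∀ b < q, ι a = ι b → a = b) →
        Set.InjOn (fun j => σ (ι j)) {j | j < q} := fun ι hι a ha b hb hab =>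
      (hι a ha).2 b hb (hσ (hι a ha).1 (hι b hb).1 hab)
    -- What remains of each budget after the work of this level: 36 is 18 · 2 from the sums on
    -- blocks of `2 * w` digits, 16 is 6 for splitting plus 5 · 2 for redistribution, and 8 is 3 + 5
    -- messages.
    have sub : ∀ (ι : ℕ → ℕ) (X' Y' : ℕ), (∀ a < q, ι a < 4 * q ∧ ∀ b < q, ι a = ι b → a = b) →
        X' < H → Y' < H → Tri s K (fun j => σ (ι j)) {j | j < q}
          (fun j => inputs (d + 1) (m (ι j)) (block s (2 * w) j X') (block s (2 * w) j Y'))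
          (copsimMI k (r + 1) (fun j => σ (ι j)) (d + 1))
          (fun j => mid d (m (ι j)) (block s (2 * (2 * w)) j (X' * Y')) [] [] [] [])
          (t - (36 * w + 24 * (k + 1))) (n - (16 * w + 24 * (k + 1))) (l - (8 + 12 * (k + 1))) :=
      fun ι X' Y' hι hX' hY' => by
        have := ih (r + 1) (d + 1) (fun j => σ (ι j)) (fun j => m (ι j)) X' Y' u K
          (t - (36 * w + 24 * (k + 1))) (n - (16 * w + 24 * (k + 1))) (l - (8 + 12 * (k + 1)))
          (inj ι hι) (fun j hj => ⟨(hm _ (hι j hj).1).1.succ, (hm _ (hι j hj).1).2⟩)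
          (by rwa [hv]) (by rwa [hv]) (by rwa [hr1]) (by rw [hr1]; omega) (by rw [hr1]; omega)
          (by omega)
        rw [hv] at this
        refine this.congr (fun _ _ => rfl) fun j hj => ?_
        exact mid_of_clean (hm _ (hι j hj).1).1
    have t1 := tri_split (s := s) (X := X) (Y := Y) hσ (K := K) (u := u) (w := w) (by omega) hm
    have t2 := Tri.quads (s := s) (K := K) (σ := σ) (q := q) (f := quad q _ _ _ _)
      (g := quad q _ _ _ _) hσ
      ((sub (fun j => 2 * j) (X % H) (Y % H) (fun a ha => ⟨by omega, fun b hb h => by omega⟩)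
        (hmodlt X) (hmodlt Y)).congr
        (fun j hj => (quad_0 hj).trans (by rw [blo X j hj, blo Y j hj])) fun j hj => quad_0 hj)
      ((sub (fun j => 2 * j + 1) (X % H) (Y / H) (fun a ha => ⟨by omega, fun b hb h => by omega⟩)
        (hmodlt X) (hdivlt Y hY)).congr
        (fun j hj => (quad_1 hj).trans (by rw [blo X j hj, bhi Y])) fun j hj => quad_1 hj)
      ((sub (fun j => 2 * q + 2 * j) (X / H) (Y % H)
        (fun a ha => ⟨by omega, fun b hb h => by omega⟩) (hdivlt X hX) (hmodlt Y)).congr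
        (fun j hj => quad_2.trans (by rw [bhi X j, blo Y j hj])) fun j hj => quad_2)
      ((sub (fun j => 2 * q + 2 * j + 1) (X / H) (Y / H)
        (fun a ha => ⟨by omega, fun b hb h => by omega⟩) (hdivlt X hX) (hdivlt Y hY)).congr
        (fun j hj => quad_3.trans (by rw [bhi X j, bhi Y])) fun j hj => quad_3)
    have t3 := tri_redistribute (s := s) (v := 2 * w) (d := d) (P₀ := X % H * (Y % H))
      (P₁ := X % H * (Y / H)) (P₂ := X / H * (Y % H)) (P₃ := X / H * (Y / H)) hσ (K := K) (u := u)
      (by omega) fun j hj => (hm j hj).2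
    have hval := mul_halves H X Y
    have hH2 : H ^ 2 = s ^ (2 * 4 ^ k * (2 * w)) := by rw [← pow_mul]; congr 1; ring
    have hH' : s ^ (4 ^ k * (2 * w)) = H := rfl
    have hlt : ∀ Z W : ℕ, Z < H → W < H → Z * W < s ^ (2 * 4 ^ k * (2 * w)) := fun Z W hZ hW => by
      rw [← hH2, pow_two]; exact Nat.mul_lt_mul'' hZ hW
    have t4 := tri_combine (k := k) (w := 2 * w) (d := d) (m := m) (P₀ := X % H * (Y % H))
      (P₁ := X % H * (Y / H)) (P₂ := X / H * (Y % H)) (P₃ := X / H * (Y / H)) (K := K) (u := u) hs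
      (by rwa [h4]) (by omega) (by rwa [h4]) (hlt _ _ (hmodlt X) (hmodlt Y))
      (hlt _ _ (hmodlt X) (hdivlt Y hY)) (hlt _ _ (hdivlt X hX) (hmodlt Y)) (by
        rw [← hH2, hH', hval]
        refine (Nat.mul_lt_mul'' hX hY).trans_eq ?_
        rw [← pow_add]; congr 1; ring)
    rw [← hH2, hH', hval, h4] at t4
    have t4' := t4.congr (f' := fun j => mid d (m j) []
        (if j < 2 * q then block s (2 * w) j (X % H * (Y % H)) else [])
        (if q ≤ j ∧ j < 3 * q then block s (2 * w) (j - q) (X % H * (Y / H)) else [])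
        (if q ≤ j ∧ j < 3 * q then block s (2 * w) (j - q) (X / H * (Y % H)) else [])
        (if 2 * q ≤ j then block s (2 * w) (j - 2 * q) (X / H * (Y / H)) else []))
      (fun j hj => mid_nil (hm j hj).1.succ) (fun _ _ => rfl)
    rw [h4]
    have := (((t1.seq t2).seq t3).seq t4').weaken (t' := t) (w' := n) (l' := l) (by omega)
      (by omega) (by omega)
    simpa only [copsimMI, List.append_assoc, ← hq, ← hw] using this

/-! ### The depth-first step. -/

section DepthFirst

variable {s h q v d K u X Y P : ℕ} {σ : ℕ → ℕ} {M : ℕ → Mem}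

/-- The position of the processor `j` in the interleaving of the two halves of
`{0, …, 2 * h - 1}`. -/
def shuffle (h j : ℕ) : ℕ := if j < h then 2 * j else 2 * (j - h) + 1

theorem shuffle_lo {a : ℕ} (ha : a < h) : shuffle h a = 2 * a := if_pos ha

theorem shuffle_hi (a : ℕ) : shuffle h (h + a) = 2 * a + 1 := by
  rw [shuffle, if_neg (by omega), Nat.add_sub_cancel_left]

/-- Distribution of the inputs of a sub-problem, both of them from the lower half. -/
theorem tri_dist_lo_lo (hσ : Set.InjOn σ {j | j < 2 * h}) (hK : u + 4 * v ≤ K)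
    (hM : ∀ j < 2 * h, Clean (d + 1) (M j) ∧ Bnd (M j) u)
    (hA : ∀ a < h, M a (A d) = block s (2 * v) a X)
        (hB : ∀ a < h, M a (B d) = block s (2 * v) a Y) :
    Tri s K σ {j | j < 2 * h} M (par h fun j => [
        copy (σ j) (A d) 0 v (A (d + 1)), copy (σ j) (B d) 0 v (B (d + 1)),
        send (σ j) (σ (h + j)) [⟨A d, v, v, A (d + 1)⟩, ⟨B d, v, v, B (d + 1)⟩]])
      (fun j => inputs (d + 1) (M j) (block s v (shuffle h j) X) (block s v (shuffle h j) Y))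
      0 (2 * v) 1 := by
  refine Tri.par_pairs hσ fun a ha => ?_
  obtain ⟨c1, b1⟩ := hM a (by omega)
  obtain ⟨c2, b2⟩ := hM (h + a) (by omega)
  have a1 := c1 (A (d + 1)) (by simp [Var.Below])
  have a2 := c1 (B (d + 1)) (by simp [Var.Below])
  have a3 := c2 (A (d + 1)) (by simp [Var.Below])
  have a4 := c2 (B (d + 1)) (by simp [Var.Below])
  refine (Tri.message (L₁ := [copy (σ a) (A d) 0 v (A (d + 1)), copy (σ a) (B d) 0 v (B (d + 1))])
    (L₂ := []) (L₃ := []) (L₄ := []) (ne_of_injOn hσ (by omega) (by omega) (by omega))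
    (by simp [Instr.Local, Instr.Free]) (by simp) (by simp) (by simp) b1 b2
    (by simp [Instr.grow]; omega) (by simp; omega) ?_ ?_).weaken le_rfl (by simp; omega) le_rfl
  · simp [lrun, lstep, inputs, a1, a2, hA a ha, hB a ha, slice_block_lo, shuffle_lo ha]
  · simp [lrun, lstep, recv, inputs, a3, a4, hA a ha, hB a ha, slice_block_hi, shuffle_hi]

/-- Distribution of the inputs of a sub-problem, both of them from the upper half. -/
theorem tri_dist_hi_hi (hσ : Set.InjOn σ {j | j < 2 * h}) (hK : u + 4 * v ≤ K)
    (hM : ∀ j < 2 * h, Clean (d + 1) (M j) ∧ Bnd (M j) u)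
    (hA : ∀ a < h, M (h + a) (A d) = block s (2 * v) a X)
    (hB : ∀ a < h, M (h + a) (B d) = block s (2 * v) a Y) :
    Tri s K σ {j | j < 2 * h} M (par h fun j => [
        copy (σ (h + j)) (A d) v v (A (d + 1)), copy (σ (h + j)) (B d) v v (B (d + 1)),
        send (σ (h + j)) (σ j) [⟨A d, 0, v, A (d + 1)⟩, ⟨B d, 0, v, B (d + 1)⟩]])
      (fun j => inputs (d + 1) (M j) (block s v (shuffle h j) X) (block s v (shuffle h j) Y))
      0 (2 * v) 1 := by
  refine Tri.par_pairs hσ fun a ha => ?_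
  rw [Set.pair_comm]
  obtain ⟨c1, b1⟩ := hM a (by omega)
  obtain ⟨c2, b2⟩ := hM (h + a) (by omega)
  have a1 := c1 (A (d + 1)) (by simp [Var.Below])
  have a2 := c1 (B (d + 1)) (by simp [Var.Below])
  have a3 := c2 (A (d + 1)) (by simp [Var.Below])
  have a4 := c2 (B (d + 1)) (by simp [Var.Below])
  refine (Tri.message (L₁ := [copy (σ (h + a)) (A d) v v (A (d + 1)),
    copy (σ (h + a)) (B d) v v (B (d + 1))])
    (L₂ := []) (L₃ := []) (L₄ := []) (ne_of_injOn hσ (by omega) (by omega) (by omega))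
    (by simp [Instr.Local, Instr.Free]) (by simp) (by simp) (by simp) b2 b1
    (by simp [Instr.grow]; omega) (by simp; omega) ?_ ?_).weaken le_rfl (by simp; omega) le_rfl
  · simp [lrun, lstep, inputs, a3, a4, hA a ha, hB a ha, slice_block_hi, shuffle_hi]
  · simp [lrun, lstep, recv, inputs, a1, a2, hA a ha, hB a ha, slice_block_lo, shuffle_lo ha]

/-- Distribution of the inputs of a sub-problem, the first one from the lower half, the second one
from the upper half. -/
theorem tri_dist_lo_hi (hσ : Set.InjOn σ {j | j < 2 * h}) (hK : u + 4 * v ≤ K)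
    (hM : ∀ j < 2 * h, Clean (d + 1) (M j) ∧ Bnd (M j) u)
    (hA : ∀ a < h, M a (A d) = block s (2 * v) a X)
    (hB : ∀ a < h, M (h + a) (B d) = block s (2 * v) a Y) :
    Tri s K σ {j | j < 2 * h} M (par h fun j => [
        copy (σ j) (A d) 0 v (A (d + 1)), copy (σ (h + j)) (B d) v v (B (d + 1)),
        send (σ j) (σ (h + j)) [⟨A d, v, v, A (d + 1)⟩],
        send (σ (h + j)) (σ j) [⟨B d, 0, v, B (d + 1)⟩]])
      (fun j => inputs (d + 1) (M j) (block s v (shuffle h j) X) (block s v (shuffle h j) Y))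
      0 (2 * v) 2 := by
  refine Tri.par_pairs hσ fun a ha => ?_
  obtain ⟨c1, b1⟩ := hM a (by omega)
  obtain ⟨c2, b2⟩ := hM (h + a) (by omega)
  have a1 := c1 (A (d + 1)) (by simp [Var.Below])
  have a2 := c1 (B (d + 1)) (by simp [Var.Below])
  have a3 := c2 (A (d + 1)) (by simp [Var.Below])
  have a4 := c2 (B (d + 1)) (by simp [Var.Below])
  let f : ℕ → Mem := fun j => inputs (d + 1) (M j) (block s v (shuffle h j) X)
    (if j < h then [] else block s v (shuffle h j) Y)
  have f1 : f a = inputs (d + 1) (M a) (block s v (2 * a) X) [] := by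
    simp [f, ha, shuffle_lo ha]
  have f2 : f (h + a) = inputs (d + 1) (M (h + a)) (block s v (2 * a + 1) X)
    (block s v (2 * a + 1) Y) := by simp [f, shuffle_hi]
  have t1 : Tri s K σ {a, h + a} M _ f 0 v 1 := (Tri.message (ts := [⟨A d, v, v, A (d + 1)⟩])
    (L₁ := [copy (σ a) (A d) 0 v (A (d + 1))])
    (L₂ := [copy (σ (h + a)) (B d) v v (B (d + 1))]) (L₃ := []) (L₄ := [])
    (ne_of_injOn hσ (by omega) (by omega) (by omega))
    (by simp [Instr.Local, Instr.Free]) (by simp [Instr.Local, Instr.Free]) (by simp) (by simp)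
    b1 b2 (by simp [Instr.grow]; omega) (by simp [Instr.grow]; omega) (by
      rw [f1, inputs, update_nil (x := B (d + 1)) (by simp [a2])]
      simp [lrun, lstep, a1, hA a ha, slice_block_lo]) (by
      rw [f2, inputs, update_comm (by simp)]
      simp [lrun, lstep, recv, a3, a4, hA a ha, hB a ha, slice_block_hi])).weaken le_rfl
        (by simp) le_rfl
  have t2 : Tri s K σ {a, h + a} f [Instr.send (σ (h + a)) (σ a) [⟨B d, 0, v, B (d + 1)⟩]]
      (fun j => inputs (d + 1) (M j) (block s v (shuffle h j) X)
      (block s v (shuffle h j) Y)) 0 v 1 := by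
    rw [Set.pair_comm]
    refine (Tri.message (L₁ := []) (ts := [⟨B d, 0, v, B (d + 1)⟩]) (ua := u + 2 * v)
      (ub := u + 2 * v) (L₂ := []) (L₃ := []) (L₄ := [])
      (ne_of_injOn hσ (by omega) (by omega) (by omega))
      (by simp) (by simp) (by simp) (by simp) ?_ ?_ (by simp; omega) (by simp; omega)
      ?_ ?_).weaken le_rfl (by simp) le_rfl
    · rw [f2]; exact b2.inputs (by simp) (by simp)
    · rw [f1]; exact ((b1.set (a := v) (by simp)).set (a := v) (by simp)).mono (by omega)
    · simp [f2, lrun, shuffle_hi]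
    · simp [f1, f2, lrun, recv, shuffle_lo ha, inputs, hB a ha, slice_block_lo]
  exact (t1.seq t2).weaken le_rfl (by omega) le_rfl

/-- Distribution of the inputs of a sub-problem, the first one from the upper half, the second one
from the lower half. -/
theorem tri_dist_hi_lo (hσ : Set.InjOn σ {j | j < 2 * h}) (hK : u + 4 * v ≤ K)
    (hM : ∀ j < 2 * h, Clean (d + 1) (M j) ∧ Bnd (M j) u)
    (hA : ∀ a < h, M (h + a) (A d) = block s (2 * v) a X)
    (hB : ∀ a < h, M a (B d) = block s (2 * v) a Y) :
    Tri s K σ {j | j < 2 * h} M (par h fun j => [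
        copy (σ (h + j)) (A d) v v (A (d + 1)), copy (σ j) (B d) 0 v (B (d + 1)),
        send (σ j) (σ (h + j)) [⟨B d, v, v, B (d + 1)⟩],
        send (σ (h + j)) (σ j) [⟨A d, 0, v, A (d + 1)⟩]])
      (fun j => inputs (d + 1) (M j) (block s v (shuffle h j) X) (block s v (shuffle h j) Y))
      0 (2 * v) 2 := by
  refine Tri.par_pairs hσ fun a ha => ?_
  obtain ⟨c1, b1⟩ := hM a (by omega)
  obtain ⟨c2, b2⟩ := hM (h + a) (by omega)
  have a1 := c1 (A (d + 1)) (by simp [Var.Below])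
  have a2 := c1 (B (d + 1)) (by simp [Var.Below])
  have a3 := c2 (A (d + 1)) (by simp [Var.Below])
  have a4 := c2 (B (d + 1)) (by simp [Var.Below])
  have hinj : Set.InjOn σ {a, h + a} := hσ.mono (by rintro j (rfl | rfl) <;> simp <;> omega)
  have hh : h ≠ 0 := by omega
  -- Here the receiver's copy precedes the sender's in the program, contrary to the order in
  -- `Tri.message`; it is split off as a separate first stage.
  let f₀ : ℕ → Mem := fun j => if j < h then M j else
    update (M j) (A (d + 1)) (block s v (shuffle h j) X)
  have e1 : f₀ a = M a := by simp [f₀, ha]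
  have e2 : f₀ (h + a) = update (M (h + a)) (A (d + 1)) (block s v (2 * a + 1) X) := by
    simp [f₀, shuffle_hi]
  let f : ℕ → Mem := fun j => inputs (d + 1) (M j) (if j < h then [] else block s v (shuffle h j) X)
    (block s v (shuffle h j) Y)
  have f1 : f a = inputs (d + 1) (M a) [] (block s v (2 * a) Y) := by
    simp [f, ha, shuffle_lo ha]
  have f2 : f (h + a) = inputs (d + 1) (M (h + a)) (block s v (2 * a + 1) X)
    (block s v (2 * a + 1) Y) := by simp [f, shuffle_hi]
  have t0 : Tri s K σ {a, h + a} M [copy (σ (h + a)) (A d) v v (A (d + 1))] f₀ 0 0 0 := by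
    refine Tri.frame (E := {h + a}) hinj (by simp) (Tri.free (by simp [Instr.Local, Instr.Free]) b2
      (by simp [Instr.grow]; omega) ?_) ?_
    · simp [e2, lrun, lstep, a3, hA a ha, slice_block_hi]
    · rintro j (rfl | rfl) hj
      · exact ⟨e1, b1.mono (by omega)⟩
      · simp at hj
  have t1 : Tri s K σ {a, h + a} f₀ _ f 0 v 1 := (Tri.message (ts := [⟨B d, v, v, B (d + 1)⟩])
    (L₁ := [copy (σ a) (B d) 0 v (B (d + 1))]) (ua := u) (ub := u + v)
    (L₂ := []) (L₃ := []) (L₄ := [])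
    (ne_of_injOn hσ (by omega) (by omega) (by omega))
    (by simp [Instr.Local, Instr.Free]) (by simp) (by simp) (by simp)
    (by rwa [e1]) (by rw [e2]; exact b2.set (by simp))
    (by simp [Instr.grow]; omega) (by simp; omega) (by
      rw [f1, e1, inputs, update_nil a1]
      simp [lrun, lstep, a2, hB a ha, slice_block_lo]) (by
      rw [f2, e1, e2, inputs]
      simp [lrun, lstep, recv, a4, hB a ha, slice_block_hi])).weaken le_rfl
        (by simp) le_rfl
  have t2 : Tri s K σ {a, h + a} f [Instr.send (σ (h + a)) (σ a) [⟨A d, 0, v, A (d + 1)⟩]]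
      (fun j => inputs (d + 1) (M j) (block s v (shuffle h j) X)
      (block s v (shuffle h j) Y)) 0 v 1 := by
    rw [Set.pair_comm]
    refine (Tri.message (L₁ := []) (ts := [⟨A d, 0, v, A (d + 1)⟩]) (ua := u + 2 * v)
      (ub := u + 2 * v) (L₂ := []) (L₃ := []) (L₄ := [])
      (ne_of_injOn hσ (by omega) (by omega) (by omega))
      (by simp) (by simp) (by simp) (by simp) ?_ ?_ (by simp; omega) (by simp; omega)
      ?_ ?_).weaken le_rfl (by simp) le_rfl
    · rw [f2]; exact b2.inputs (by simp) (by simp)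
    · rw [f1]; exact ((b1.set (a := v) (by simp)).set (a := v) (by simp)).mono (by omega)
    · simp [f2, lrun, shuffle_hi]
    · simp [f1, f2, lrun, recv, shuffle_lo ha, update_inputs_A, inputs_A, inputs_of_ne, hA a ha,
        slice_block_lo]
  exact ((t0.seq t1).seq t2).weaken le_rfl (by omega) le_rfl

/-- A sub-product is collected in the lower half. -/
theorem tri_collect_lo (hσ : Set.InjOn σ {j | j < 2 * h}) (hK : u + 4 * v ≤ K) (x : Var)
    (hx : ∀ j < 2 * h, M j x = []) (hxC : x ≠ C (d + 1))
    (hM : ∀ j < 2 * h, Clean (d + 1) (M j) ∧ Bnd (M j) u) :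
    Tri s K σ {j | j < 2 * h}
      (fun j => update (M j) (C (d + 1)) (block s v (shuffle h j) P)) (par h fun j => [
        copy (σ j) (C (d + 1)) 0 v x, clear (σ j) (C (d + 1)),
        send (σ (h + j)) (σ j) [⟨C (d + 1), 0, v, x⟩], clear (σ (h + j)) (C (d + 1))])
      (fun j => update (M j) x (if j < h then block s (2 * v) j P else [])) 0 v 1 := by
  refine Tri.par_pairs hσ fun a ha => ?_
  rw [Set.pair_comm]
  obtain ⟨c1, b1⟩ := hM a (by omega)
  obtain ⟨c2, b2⟩ := hM (h + a) (by omega)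
  have a1 := c1 (C (d + 1)) (by simp [Var.Below])
  have a2 := c2 (C (d + 1)) (by simp [Var.Below])
  have x1 := hx a (by omega)
  have x2 := hx (h + a) (by omega)
  refine (Tri.message (L₁ := []) (ua := u + v) (ub := u + v)
    (L₂ := [copy (σ a) (C (d + 1)) 0 v x, clear (σ a) (C (d + 1))])
    (L₃ := [clear (σ (h + a)) (C (d + 1))]) (L₄ := [])
    (ne_of_injOn hσ (by omega) (by omega) (by omega))
    (by simp) (by simp [Instr.Local, Instr.Free]) (by simp [Instr.Local, Instr.Free]) (by simp)
    (b2.set (by simp)) (b1.set (by simp))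
    (by simp [Instr.grow]; omega) (by simp [Instr.grow]; omega) ?_ ?_).weaken le_rfl (by simp)
        le_rfl
  · simp [lrun, lstep, update_nil a2, update_nil x2]
  · simp only [shuffle_lo ha, shuffle_hi, if_pos ha, ← block_append]
    ext1 y
    simp [lrun, lstep, recv, update_apply, slice_block, x1, hxC]
    split_ifs <;> simp_all

/-- A sub-product is collected in the upper half. -/
theorem tri_collect_hi (hσ : Set.InjOn σ {j | j < 2 * h}) (hK : u + 4 * v ≤ K) (x : Var)
    (hx : ∀ j < 2 * h, M j x = []) (hxC : x ≠ C (d + 1))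
    (hM : ∀ j < 2 * h, Clean (d + 1) (M j) ∧ Bnd (M j) u) :
    Tri s K σ {j | j < 2 * h}
      (fun j => update (M j) (C (d + 1)) (block s v (shuffle h j) P)) (par h fun j => [
        send (σ j) (σ (h + j)) [⟨C (d + 1), 0, v, x⟩], clear (σ j) (C (d + 1)),
        copy (σ (h + j)) (C (d + 1)) 0 v x, clear (σ (h + j)) (C (d + 1))])
      (fun j => update (M j) x (if h ≤ j then block s (2 * v) (j - h) P else [])) 0 v 1 := by
  refine Tri.par_pairs hσ fun a ha => ?_
  obtain ⟨c1, b1⟩ := hM a (by omega)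
  obtain ⟨c2, b2⟩ := hM (h + a) (by omega)
  have a1 := c1 (C (d + 1)) (by simp [Var.Below])
  have a2 := c2 (C (d + 1)) (by simp [Var.Below])
  have x1 := hx a (by omega)
  have x2 := hx (h + a) (by omega)
  -- The receiver now holds the odd block, so it must append its own digits after those of the
  -- message. In the lower half the order is the opposite.
  refine (Tri.message (L₁ := []) (ua := u + v) (ub := u + v) (L₂ := [])
    (L₃ := [clear (σ a) (C (d + 1))])
    (L₄ := [copy (σ (h + a)) (C (d + 1)) 0 v x, clear (σ (h + a)) (C (d + 1))])
    (ne_of_injOn hσ (by omega) (by omega) (by omega))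
    (by simp) (by simp) (by simp [Instr.Local, Instr.Free]) (by simp [Instr.Local, Instr.Free])
    (b1.set (by simp)) (b2.set (by simp))
    (by simp [Instr.grow]; omega) (by simp [Instr.grow]; omega) ?_ ?_).weaken le_rfl (by simp)
        le_rfl
  · simp [lrun, lstep, update_nil a1, update_nil x1, ha.not_ge]
  · simp only [shuffle_lo ha, shuffle_hi, Nat.le_add_right, if_true, Nat.add_sub_cancel_left,
      ← block_append]
    ext1 y
    simp [lrun, lstep, recv, update_apply, slice_block, x2, hxC, hxC.symm]
    split_ifs <;> simp_all

/-- A sub-product is collected in the middle half. -/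
theorem tri_collect_middle (hσ : Set.InjOn σ {j | j < 4 * q}) (hK : u + 4 * v ≤ K) (x : Var)
    (hx : ∀ j < 4 * q, M j x = []) (hxC : x ≠ C (d + 1))
    (hM : ∀ j < 4 * q, Clean (d + 1) (M j) ∧ Bnd (M j) u) :
    Tri s K σ {j | j < 4 * q}
      (fun j => update (M j) (C (d + 1)) (block s v (shuffle (2 * q) j) P)) (
        par q (fun j => [
          copy (σ j) (C (d + 1)) 0 v x, clear (σ j) (C (d + 1)),
          send (σ (2 * q + j)) (σ j) [⟨C (d + 1), 0, v, x⟩], clear (σ (2 * q + j)) (C (d + 1)),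
          send (σ (q + j)) (σ (2 * q + (q + j))) [⟨C (d + 1), 0, v, x⟩],
          clear (σ (q + j)) (C (d + 1)),
          copy (σ (2 * q + (q + j))) (C (d + 1)) 0 v x,
          clear (σ (2 * q + (q + j))) (C (d + 1))]) ++
        par q (fun j => [
          send (σ j) (σ (q + j)) [⟨x, 0, 2 * v, x⟩], clear (σ j) x,
          send (σ (3 * q + j)) (σ (2 * q + j)) [⟨x, 0, 2 * v, x⟩], clear (σ (3 * q + j)) x]))
      (fun j => update (M j) x (if q ≤ j ∧ j < 3 * q then block s (2 * v) (j - q) P else []))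
      0 (3 * v) 2 := by
  have hne : ∀ {i j : ℕ}, i < 4 * q → j < 4 * q → i ≠ j → σ i ≠ σ j := fun hi hj hij =>
    ne_of_injOn hσ hi hj hij
  -- Between the two stages the product lies in order in the two outer quarters; a single message
  -- per pair then moves it inwards.
  let f : ℕ → Mem := fun j => update (M j) x (if j < q then block s (2 * v) j P else
    if 3 * q ≤ j then block s (2 * v) (j - 2 * q) P else [])
  have hC : ∀ j < 4 * q, M j (C (d + 1)) = [] := fun j hj => (hM j hj).1 _ (by simp [Var.Below])
  have hb : ∀ j < 4 * q, Bnd (f j) (u + 2 * v) := fun j hj =>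
    (hM j hj).2.set (by split_ifs <;> simp)
  have t1 : Tri s K σ {j | j < 4 * q}
      (fun j => update (M j) (C (d + 1)) (block s v (shuffle (2 * q) j) P)) (
        par q (fun j => [
          copy (σ j) (C (d + 1)) 0 v x, clear (σ j) (C (d + 1)),
          send (σ (2 * q + j)) (σ j) [⟨C (d + 1), 0, v, x⟩], clear (σ (2 * q + j)) (C (d + 1))] ++ [
          send (σ (q + j)) (σ (2 * q + (q + j))) [⟨C (d + 1), 0, v, x⟩],
          clear (σ (q + j)) (C (d + 1)),
          copy (σ (2 * q + (q + j))) (C (d + 1)) 0 v x,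
          clear (σ (2 * q + (q + j))) (C (d + 1))])) f 0 v 1 := by
    refine Tri.par_two (α := fun a => 2 * q + a) (β := fun a => a) (γ := fun a => q + a)
      (δ := fun a => 2 * q + (q + a)) hσ (fun a ha => by omega)
      (fun a ha b hb => by omega) (fun a ha b hb => by omega) (fun j hj => ?_) (fun a ha => ?_)
      (fun a ha => ?_)
    · exact quar_cases (p := fun j => ∃ a < q, j = 2 * q + a ∨ j = a ∨ j = q + a ∨
        j = 2 * q + (q + a)) (fun a ha => ⟨a, ha, by simp⟩) (fun a ha => ⟨a, ha, by simp⟩)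
        (fun a ha => ⟨a, ha, by simp⟩) (fun a ha => ⟨a, ha, by omega⟩) hj
    · have x1 := hx a (by omega)
      refine (Tri.message (L₁ := []) (ua := u + v) (ub := u + v)
        (L₂ := [copy (σ a) (C (d + 1)) 0 v x, clear (σ a) (C (d + 1))])
        (L₃ := [clear (σ (2 * q + a)) (C (d + 1))]) (L₄ := [])
        (hne (by omega) (by omega) (by omega))
        (by simp) (by simp [Instr.Local, Instr.Free]) (by simp [Instr.Local, Instr.Free]) (by simp)
        ((hM _ (by omega)).2.set (by simp)) ((hM _ (by omega)).2.set (by simp))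
        (by simp [Instr.grow]; omega) (by simp [Instr.grow]; omega) ?_ ?_).weaken le_rfl (by simp)
        le_rfl
      · have e1 : ¬ 2 * q + a < q := by omega
        have e2 : ¬ 3 * q ≤ 2 * q + a := by omega
        simp [f, lrun, lstep, update_nil (hC (2 * q + a) (by omega)),
          update_nil (hx (2 * q + a) (by omega)), e1, e2]
      · have e0 := hC a (by omega)
        simp only [shuffle_lo (show a < 2 * q by omega), shuffle_hi, f, if_pos ha, ← block_append]
        ext1 y
        simp [lrun, lstep, recv, update_apply, slice_block, x1, hxC]
        split_ifs <;> simp_all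
    · have x1 := hx (2 * q + (q + a)) (by omega)
      refine (Tri.message (L₁ := []) (ua := u + v) (ub := u + v) (L₂ := [])
        (L₃ := [clear (σ (q + a)) (C (d + 1))])
        (L₄ := [copy (σ (2 * q + (q + a))) (C (d + 1)) 0 v x,
          clear (σ (2 * q + (q + a))) (C (d + 1))])
        (hne (by omega) (by omega) (by omega))
        (by simp) (by simp) (by simp [Instr.Local, Instr.Free]) (by simp [Instr.Local, Instr.Free])
        ((hM _ (by omega)).2.set (by simp)) ((hM _ (by omega)).2.set (by simp))
        (by simp [Instr.grow]; omega) (by simp [Instr.grow]; omega) ?_ ?_).weaken le_rfl (by simp)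
        le_rfl
      · have e1 : ¬ q + a < q := by omega
        have e2 : ¬ 3 * q ≤ q + a := by omega
        simp [f, lrun, lstep, update_nil (hC (q + a) (by omega)),
          update_nil (hx (q + a) (by omega)), e2]
      · have e0 := hC (2 * q + (q + a)) (by omega)
        have e1 : ¬ 2 * q + (q + a) < q := by omega
        have e2 : 3 * q ≤ 2 * q + (q + a) := by omega
        simp only [shuffle_lo (show q + a < 2 * q by omega), shuffle_hi, f, if_neg e1, if_pos e2,
          Nat.add_sub_cancel_left, ← block_append]
        ext1 y
        simp [lrun, lstep, recv, update_apply, slice_block, x1, hxC, hxC.symm]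
        clear e1 e2
        split_ifs <;> simp_all
  have t2 : Tri s K σ {j | j < 4 * q} f (par q (fun j => [
          send (σ j) (σ (q + j)) [⟨x, 0, 2 * v, x⟩], clear (σ j) x] ++ [
          send (σ (3 * q + j)) (σ (2 * q + j)) [⟨x, 0, 2 * v, x⟩], clear (σ (3 * q + j)) x]))
      (fun j => update (M j) x (if q ≤ j ∧ j < 3 * q then block s (2 * v) (j - q) P else []))
      0 (2 * v) 1 := by
    refine Tri.par_two (α := fun a => a) (β := fun a => q + a)
      (γ := fun a => 3 * q + a) (δ := fun a => 2 * q + a) hσ (fun a ha => by omega)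
      (fun a ha b hb => by omega) (fun a ha b hb => by omega) (fun j hj => ?_) (fun a ha => ?_)
      (fun a ha => ?_)
    · exact quar_cases (p := fun j => ∃ a < q, j = a ∨ j = q + a ∨ j = 3 * q + a ∨
        j = 2 * q + a) (fun a ha => ⟨a, ha, by simp⟩) (fun a ha => ⟨a, ha, by simp⟩)
        (fun a ha => ⟨a, ha, by simp⟩) (fun a ha => ⟨a, ha, by simp⟩) hj
    · refine (Tri.message (L₁ := []) (L₂ := []) (L₃ := [clear (σ a) x]) (L₄ := [])
        (hne (by omega) (by omega) (by omega)) (by simp) (by simp)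
        (by simp [Instr.Local, Instr.Free]) (by simp) (hb _ (by omega)) (hb _ (by omega))
        (by simp [Instr.grow]; omega) (by simp; omega) ?_ ?_).weaken le_rfl (by simp) le_rfl
      · simp [f, lrun, lstep, ha.not_ge]
      · have e1 : ¬ 3 * q ≤ q + a := by omega
        have e2 : q + a < 3 * q := by omega
        simp [f, lrun, recv, slice_block, e1, e2, ha]
    · refine (Tri.message (L₁ := []) (L₂ := []) (L₃ := [clear (σ (3 * q + a)) x]) (L₄ := [])
        (hne (by omega) (by omega) (by omega)) (by simp) (by simp)
        (by simp [Instr.Local, Instr.Free]) (by simp) (hb _ (by omega)) (hb _ (by omega))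
        (by simp [Instr.grow]; omega) (by simp; omega) ?_ ?_).weaken le_rfl (by simp) le_rfl
      · simp [f, lrun, lstep]
      · have e1 : ¬ 2 * q + a < q := by omega
        have e2 : q ≤ 2 * q + a := by omega
        have e3 : 2 * q + a < 3 * q := by omega
        have e4 : ¬ 3 * q ≤ 2 * q + a := by omega
        have e5 : ¬ 3 * q + a < q := by omega
        have e6 : 2 * q + a - q = 3 * q + a - 2 * q := by omega
        simp [f, lrun, recv, slice_block, e1, e2, e3, e4, e5, e6]
  exact (t1.seq t2).weaken le_rfl (by omega) le_rfl

end DepthFirst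

theorem Clean.prods {d : ℕ} {m : Mem} {l₀ l₁ l₂ l₃ : List ℕ} (hm : Clean (d + 1) m) :
    Clean (d + 1) (prods d m l₀ l₁ l₂ l₃) :=
  (((hm.update le_rfl (by simp [Var.Below]) _).update le_rfl (by simp [Var.Below]) _).update le_rfl
    (by simp [Var.Below]) _).update le_rfl (by simp [Var.Below]) _

theorem prods_of_ne {d : ℕ} {m : Mem} {l₀ l₁ l₂ l₃ : List ℕ} {x : Var} (hx : ∀ i, x ≠ Q i d) :
    prods d m l₀ l₁ l₂ l₃ x = m x := by simp [prods, hx]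

theorem clear_prods_inputs {d : ℕ} {m : Mem} {a b l₀ l₁ l₂ l₃ : List ℕ} (hA : m (A d) = [])
    (hB : m (B d) = []) :
    update (update (prods d (inputs d m a b) l₀ l₁ l₂ l₃) (A d) []) (B d) [] =
      prods d m l₀ l₁ l₂ l₃ := by
  ext1 x
  by_cases h₁ : x = A d
  · subst h₁; simp [prods, hA]
  by_cases h₂ : x = B d
  · subst h₂; simp [prods, hB]
  · simp only [prods, inputs, update_apply, h₁, h₂, if_false]

/-- A program on the interleaving of the two halves of the processors. -/
theorem Tri.of_shuffle {s K h t n l : ℕ} {σ : ℕ → ℕ} {f g f' g' : ℕ → Mem} {L : List Instr}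
    (h₁ : Tri s K (fun j => if j % 2 = 0 then σ (j / 2) else σ (h + j / 2)) {j | j < 2 * h} f' L g'
      t n l) (hf : ∀ j < 2 * h, f j = f' (shuffle h j)) (hg : ∀ j < 2 * h, g j = g' (shuffle h j)) :
    Tri s K σ {j | j < 2 * h} f L g t n l := by
  let τ : ℕ → ℕ := fun j => if j % 2 = 0 then j / 2 else h + j / 2
  have hτ : ∀ i < 2 * h, τ i < 2 * h ∧ shuffle h (τ i) = i := fun i hi => by
    simp only [τ, shuffle]; split_ifs <;> omega
  have hD : {j | j < 2 * h} = τ '' {j | j < 2 * h} := by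
    ext j
    refine ⟨fun hj => ⟨shuffle h j, ?_, ?_⟩, ?_⟩
    · have hj : j < 2 * h := hj
      simp only [shuffle, Set.mem_ofPred_eq]; split_ifs <;> omega
    · have hj : j < 2 * h := hj
      simp only [τ, shuffle]; split_ifs <;> omega
    · rintro ⟨i, hi, rfl⟩; exact (hτ i hi).1
  have hστ : (fun j => if j % 2 = 0 then σ (j / 2) else σ (h + j / 2)) = fun j => σ (τ j) := by
    funext j; exact (apply_ite σ _ _ _).symm
  rw [hστ] at h₁
  rw [hD]
  refine Tri.reindex (h₁.congr (fun j hj => ?_) fun j hj => ?_)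
  · rw [hf _ (hτ j hj).1, (hτ j hj).2]
  · rw [hg _ (hτ j hj).1, (hτ j hj).2]

/-- A depth-first step, for a program `L` that solves the sub-problems. -/
theorem tri_depthFirst {s k v d K u X Y t n l : ℕ} (hs : 2 ≤ s) {σ : ℕ → ℕ} {m : ℕ → Mem}
    {L : List Instr} (hv : 0 < v) (hσ : Set.InjOn σ {j | j < 4 * 4 ^ k})
    (hm : ∀ j < 4 * 4 ^ k, Clean d (m j) ∧ Bnd (m j) u)
    (hX : X < s ^ (4 * 4 ^ k * (2 * v))) (hY : Y < s ^ (4 * 4 ^ k * (2 * v)))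
    (hK : u + 40 * v ≤ K)
    (hL : ∀ (N : ℕ → Mem) (X' Y' : ℕ),
      (∀ j < 4 * 4 ^ k, Clean (d + 1) (N j) ∧ Bnd (N j) (u + 20 * v)) →
      X' < s ^ (4 * 4 ^ k * v) → Y' < s ^ (4 * 4 ^ k * v) →
      Tri s K σ {j | j < 4 * 4 ^ k}
        (fun j => inputs (d + 1) (N j) (block s v (shuffle (2 * 4 ^ k) j) X')
          (block s v (shuffle (2 * 4 ^ k) j) Y')) L
        (fun j => update (N j) (C (d + 1)) (block s (2 * v) (shuffle (2 * 4 ^ k) j) (X' * Y')))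
        t n l) :
    Tri s K σ {j | j < 4 * 4 ^ k}
      (fun j => inputs d (m j) (block s (2 * v) j X) (block s (2 * v) j Y))
      (par (2 * 4 ^ k) (fun j => [
        copy (σ j) (A d) 0 v (A (d + 1)), copy (σ j) (B d) 0 v (B (d + 1)),
        send (σ j) (σ (2 * 4 ^ k + j)) [⟨A d, v, v, A (d + 1)⟩, ⟨B d, v, v, B (d + 1)⟩]]) ++
      L ++
      par (2 * 4 ^ k) (fun j => [
        copy (σ j) (C (d + 1)) 0 (2 * v) (Q 0 d), clear (σ j) (C (d + 1)),
        send (σ (2 * 4 ^ k + j)) (σ j) [⟨C (d + 1), 0, 2 * v, Q 0 d⟩],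
        clear (σ (2 * 4 ^ k + j)) (C (d + 1))]) ++
      par (2 * 4 ^ k) (fun j => [
        copy (σ j) (A d) 0 v (A (d + 1)), copy (σ (2 * 4 ^ k + j)) (B d) v v (B (d + 1)),
        send (σ j) (σ (2 * 4 ^ k + j)) [⟨A d, v, v, A (d + 1)⟩],
        send (σ (2 * 4 ^ k + j)) (σ j) [⟨B d, 0, v, B (d + 1)⟩]]) ++
      L ++
      par (4 ^ k) (fun j => [
          copy (σ j) (C (d + 1)) 0 (2 * v) (Q 1 d), clear (σ j) (C (d + 1)),
          send (σ (2 * 4 ^ k + j)) (σ j) [⟨C (d + 1), 0, 2 * v, Q 1 d⟩],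
          clear (σ (2 * 4 ^ k + j)) (C (d + 1)),
          send (σ (4 ^ k + j)) (σ (2 * 4 ^ k + (4 ^ k + j))) [⟨C (d + 1), 0, 2 * v, Q 1 d⟩],
          clear (σ (4 ^ k + j)) (C (d + 1)),
          copy (σ (2 * 4 ^ k + (4 ^ k + j))) (C (d + 1)) 0 (2 * v) (Q 1 d),
          clear (σ (2 * 4 ^ k + (4 ^ k + j))) (C (d + 1))]) ++
      par (4 ^ k) (fun j => [
          send (σ j) (σ (4 ^ k + j)) [⟨Q 1 d, 0, 2 * (2 * v), Q 1 d⟩], clear (σ j) (Q 1 d),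
          send (σ (3 * 4 ^ k + j)) (σ (2 * 4 ^ k + j)) [⟨Q 1 d, 0, 2 * (2 * v), Q 1 d⟩],
          clear (σ (3 * 4 ^ k + j)) (Q 1 d)]) ++
      par (2 * 4 ^ k) (fun j => [
        copy (σ (2 * 4 ^ k + j)) (A d) v v (A (d + 1)), copy (σ j) (B d) 0 v (B (d + 1)),
        send (σ j) (σ (2 * 4 ^ k + j)) [⟨B d, v, v, B (d + 1)⟩],
        send (σ (2 * 4 ^ k + j)) (σ j) [⟨A d, 0, v, A (d + 1)⟩]]) ++
      L ++
      par (4 ^ k) (fun j => [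
          copy (σ j) (C (d + 1)) 0 (2 * v) (Q 2 d), clear (σ j) (C (d + 1)),
          send (σ (2 * 4 ^ k + j)) (σ j) [⟨C (d + 1), 0, 2 * v, Q 2 d⟩],
          clear (σ (2 * 4 ^ k + j)) (C (d + 1)),
          send (σ (4 ^ k + j)) (σ (2 * 4 ^ k + (4 ^ k + j))) [⟨C (d + 1), 0, 2 * v, Q 2 d⟩],
          clear (σ (4 ^ k + j)) (C (d + 1)),
          copy (σ (2 * 4 ^ k + (4 ^ k + j))) (C (d + 1)) 0 (2 * v) (Q 2 d),
          clear (σ (2 * 4 ^ k + (4 ^ k + j))) (C (d + 1))]) ++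
      par (4 ^ k) (fun j => [
          send (σ j) (σ (4 ^ k + j)) [⟨Q 2 d, 0, 2 * (2 * v), Q 2 d⟩], clear (σ j) (Q 2 d),
          send (σ (3 * 4 ^ k + j)) (σ (2 * 4 ^ k + j)) [⟨Q 2 d, 0, 2 * (2 * v), Q 2 d⟩],
          clear (σ (3 * 4 ^ k + j)) (Q 2 d)]) ++
      par (2 * 4 ^ k) (fun j => [
        copy (σ (2 * 4 ^ k + j)) (A d) v v (A (d + 1)),
        copy (σ (2 * 4 ^ k + j)) (B d) v v (B (d + 1)),
        send (σ (2 * 4 ^ k + j)) (σ j) [⟨A d, 0, v, A (d + 1)⟩, ⟨B d, 0, v, B (d + 1)⟩]]) ++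
      L ++
      par (2 * 4 ^ k) (fun j => [
        send (σ j) (σ (2 * 4 ^ k + j)) [⟨C (d + 1), 0, 2 * v, Q 3 d⟩], clear (σ j) (C (d + 1)),
        copy (σ (2 * 4 ^ k + j)) (C (d + 1)) 0 (2 * v) (Q 3 d),
        clear (σ (2 * 4 ^ k + j)) (C (d + 1))]) ++
      par (4 * 4 ^ k) (fun j => [clear (σ j) (A d), clear (σ j) (B d)]) ++
      combine (k + 1) (2 * (2 * v)) d σ)
      (fun j => update (m j) (C d) (block s (2 * (2 * v)) j (X * Y)))
      (4 * t + (72 * v + 24 * (k + 1))) (4 * n + (24 * v + 24 * (k + 1)))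
      (4 * l + (12 + 12 * (k + 1))) := by
  have hs0 : 0 < s := by omega
  have h4 : 4 ^ (k + 1) = 4 * 4 ^ k := by rw [pow_succ]; ring
  let H := s ^ (4 * 4 ^ k * v)
  have hH : 0 < H := by positivity
  have hHH : H * H = s ^ (4 * 4 ^ k * (2 * v)) := by rw [← pow_add]; congr 1; ring
  have hmodlt : ∀ Z : ℕ, Z % H < H := fun Z => Nat.mod_lt _ hH
  have hdivlt : ∀ Z : ℕ, Z < s ^ (4 * 4 ^ k * (2 * v)) → Z / H < H := fun Z hZ =>
    Nat.div_lt_of_lt_mul (by rwa [hHH])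
  have hH2 : H ^ 2 = s ^ (2 * 4 ^ k * (2 * (2 * v))) := by rw [← pow_mul]; congr 1; ring
  have hH' : s ^ (4 ^ k * (2 * (2 * v))) = H := by
    change _ = s ^ _
    congr 1; ring
  have hHd : s ^ (2 * 4 ^ k * (2 * v)) = H := by
    change _ = s ^ _
    congr 1; ring
  have hval := mul_halves H X Y
  have hlt : ∀ Z W : ℕ, Z < H → W < H → Z * W < s ^ (2 * 4 ^ k * (2 * (2 * v))) :=
    fun Z W hZ hW => by rw [← hH2, pow_two]; exact Nat.mul_lt_mul'' hZ hW
  have hlt4 : X * Y < s ^ (4 * 4 ^ k * (2 * (2 * v))) := by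
    refine (Nat.mul_lt_mul'' hX hY).trans_eq ?_
    rw [← pow_add]; congr 1; ring
  have blo : ∀ (Z a : ℕ), a < 2 * 4 ^ k → block s (2 * v) a Z = block s (2 * v) a (Z % H) :=
    fun Z a ha => by
      rw [← hHd]; exact (block_mod (Nat.mul_le_mul_right _ ha)).symm
  have bhi : ∀ Z a : ℕ, block s (2 * v) (2 * 4 ^ k + a) Z = block s (2 * v) a (Z / H) :=
      fun Z a => by
    rw [← hHd, block_div]
  set q := 4 ^ k with hq
  let M : ℕ → Mem := fun j => inputs d (m j) (block s (2 * v) j X) (block s (2 * v) j Y)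
  -- Retained during every sub-problem: two inputs of `2 * v` words and at most four sub-products of
  -- `4 * v` words, hence `20 * v`.
  have hc : ∀ j < 4 * q, ∀ {l₀ l₁ l₂ l₃ : List ℕ}, l₀.length ≤ 4 * v → l₁.length ≤ 4 * v →
      l₂.length ≤ 4 * v → l₃.length ≤ 4 * v → Clean (d + 1) (prods d (M j) l₀ l₁ l₂ l₃) ∧
      Bnd (prods d (M j) l₀ l₁ l₂ l₃) (u + 20 * v) := fun j hj _ _ _ _ h0 h1 h2 h3 =>
    ⟨((hm j hj).1.inputs _ _).prods,
      (((hm j hj).2.inputs (n := 2 * v) (by simp) (by simp)).prods h0 h1 h2 h3).mono (by omega)⟩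
  have hA : ∀ j l₀ l₁ l₂ l₃, prods d (M j) l₀ l₁ l₂ l₃ (A d) = block s (2 * v) j X :=
    fun j _ _ _ _ => (prods_of_ne (by simp)).trans (inputs_A ..)
  have hB : ∀ j l₀ l₁ l₂ l₃, prods d (M j) l₀ l₁ l₂ l₃ (B d) = block s (2 * v) j Y :=
    fun j _ _ _ _ => (prods_of_ne (by simp)).trans (inputs_B ..)
  let c₀ : ℕ → List ℕ := fun j =>
      if j < 2 * q then block s (2 * (2 * v)) j (X % H * (Y % H)) else []
  let c₁ : ℕ → List ℕ := fun j => if q ≤ j ∧ j < 3 * q then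
    block s (2 * (2 * v)) (j - q) (X % H * (Y / H)) else []
  let c₂ : ℕ → List ℕ := fun j => if q ≤ j ∧ j < 3 * q then
    block s (2 * (2 * v)) (j - q) (X / H * (Y % H)) else []
  let c₃ : ℕ → List ℕ := fun j => if 2 * q ≤ j then
    block s (2 * (2 * v)) (j - 2 * q) (X / H * (Y / H)) else []
  have l₀ : ∀ j, (c₀ j).length ≤ 4 * v := fun j => by simp only [c₀]; split_ifs <;> simp; omega
  have l₁ : ∀ j, (c₁ j).length ≤ 4 * v := fun j => by simp only [c₁]; split_ifs <;> simp; omega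
  have l₂ : ∀ j, (c₂ j).length ≤ 4 * v := fun j => by simp only [c₂]; split_ifs <;> simp; omega
  let N₀ : ℕ → Mem := fun j => prods d (M j) [] [] [] []
  let N₁ : ℕ → Mem := fun j => prods d (M j) (c₀ j) [] [] []
  let N₂ : ℕ → Mem := fun j => prods d (M j) (c₀ j) (c₁ j) [] []
  let N₃ : ℕ → Mem := fun j => prods d (M j) (c₀ j) (c₁ j) (c₂ j) []
  let N₄ : ℕ → Mem := fun j => prods d (M j) (c₀ j) (c₁ j) (c₂ j) (c₃ j)
  have h₀ : ∀ j < 4 * q, Clean (d + 1) (N₀ j) ∧ Bnd (N₀ j) (u + 20 * v) := fun j hj =>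
    hc j hj (by simp) (by simp) (by simp) (by simp)
  have h₁ : ∀ j < 4 * q, Clean (d + 1) (N₁ j) ∧ Bnd (N₁ j) (u + 20 * v) := fun j hj =>
    hc j hj (l₀ j) (by simp) (by simp) (by simp)
  have h₂ : ∀ j < 4 * q, Clean (d + 1) (N₂ j) ∧ Bnd (N₂ j) (u + 20 * v) := fun j hj =>
    hc j hj (l₀ j) (l₁ j) (by simp) (by simp)
  have h₃ : ∀ j < 4 * q, Clean (d + 1) (N₃ j) ∧ Bnd (N₃ j) (u + 20 * v) := fun j hj =>
    hc j hj (l₀ j) (l₁ j) (l₂ j) (by simp)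
  have hMN : ∀ j < 4 * q, M j = N₀ j := fun j hj => by
    have hQ : ∀ i, M j (Q i d) = [] := fun i => by
      simpa [M, inputs] using (hm j hj).1 (Q i d) (by simp [Var.Below])
    simp [N₀, prods, update_nil, hQ]
  have e2 : 4 * q = 2 * (2 * q) := by ring
  have hσ' := hσ
  rw [e2] at hσ'
  have d₀ := tri_dist_lo_lo (s := s) (X := X % H) (Y := Y % H) (K := K) hσ' (by omega)
    (fun j hj => h₀ j (by omega)) (fun a ha => (hA ..).trans (blo X a ha))
    fun a ha => (hB ..).trans (blo Y a ha)
  have d₁ := tri_dist_lo_hi (s := s) (X := X % H) (Y := Y / H) (K := K) hσ' (by omega)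
    (fun j hj => h₁ j (by omega)) (fun a ha => (hA ..).trans (blo X a ha))
    fun a ha => (hB ..).trans (bhi Y a)
  have d₂ := tri_dist_hi_lo (s := s) (X := X / H) (Y := Y % H) (K := K) hσ' (by omega)
    (fun j hj => h₂ j (by omega)) (fun a ha => (hA ..).trans (bhi X a))
    fun a ha => (hB ..).trans (blo Y a ha)
  have d₃ := tri_dist_hi_hi (s := s) (X := X / H) (Y := Y / H) (K := K) hσ' (by omega)
    (fun j hj => h₃ j (by omega)) (fun a ha => (hA ..).trans (bhi X a))
    fun a ha => (hB ..).trans (bhi Y a)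
  have g₀ := tri_collect_lo (s := s) (K := K) (v := 2 * v) (P := X % H * (Y % H)) hσ' (by omega)
    (Q 0 d) (fun j hj => prods_Q0) (by simp) (fun j hj => h₀ j (by omega))
  have g₁ := tri_collect_middle (s := s) (K := K) (v := 2 * v) (P := X % H * (Y / H)) hσ (by omega)
    (Q 1 d) (fun j hj => prods_Q1) (by simp) h₁
  have g₂ := tri_collect_middle (s := s) (K := K) (v := 2 * v) (P := X / H * (Y % H)) hσ (by omega)
    (Q 2 d) (fun j hj => prods_Q2) (by simp) h₂
  have g₃ := tri_collect_hi (s := s) (K := K) (v := 2 * v) (P := X / H * (Y / H)) hσ' (by omega)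
    (Q 3 d) (fun j hj => prods_Q3) (by simp) (fun j hj => h₃ j (by omega))
  rw [← e2] at d₀ d₁ d₂ d₃ g₀ g₃
  have g₀' := g₀.congr (g' := N₁) (fun _ _ => rfl) fun j hj => update_prods_Q0.symm
  have g₁' := g₁.congr (g' := N₂) (fun _ _ => rfl) fun j hj => update_prods_Q1.symm
  have g₂' := g₂.congr (g' := N₃) (fun _ _ => rfl) fun j hj => update_prods_Q2.symm
  have g₃' := g₃.congr (g' := N₄) (fun _ _ => rfl) fun j hj => update_prods_Q3.symm
  have tc : Tri s K σ {j | j < 4 * q} N₄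
      (par (4 * q) (fun j => [clear (σ j) (A d), clear (σ j) (B d)]))
      (parts s (2 * (2 * v)) q d (X % H * (Y % H)) (X % H * (Y / H)) (X / H * (Y % H))
        (X / H * (Y / H)) m) 0 0 0 := by
    refine Tri.par_local (ι := fun a => a) hσ (fun a ha => ⟨ha, fun b hb => hb.ne⟩)
      (fun a ha => Tri.free (u := u + 20 * v) (by simp [Instr.Local, Instr.Free]) ?_
        (by simp [Instr.grow]; omega) ?_) fun j hj h => (h j hj rfl).elim
    · exact (hc a ha (l₀ a) (l₁ a) (l₂ a)
        (by simp only [c₃]; split_ifs <;> simp; omega)).2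
    · have e1 := (hm a ha).1 (A d) (by simp [Var.Below])
      have e2 := (hm a ha).1 (B d) (by simp [Var.Below])
      exact (clear_prods_inputs e1 e2).symm
  have t4 := tri_combine (k := k) (w := 2 * (2 * v)) (d := d) (m := m) (P₀ := X % H * (Y % H))
    (P₁ := X % H * (Y / H)) (P₂ := X / H * (Y % H)) (P₃ := X / H * (Y / H)) (K := K) (u := u) hs
    (by rwa [h4]) (by omega) (by rwa [h4]) (hlt _ _ (hmodlt X) (hmodlt Y))
    (hlt _ _ (hmodlt X) (hdivlt Y hY)) (hlt _ _ (hdivlt X hX) (hmodlt Y))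
    (by rw [← hH2, hH', hval]; exact hlt4)
  rw [← hH2, hH', hval, h4] at t4
  have s₀ := ((d₀.congr hMN fun _ _ => rfl).seq (hL N₀ _ _ h₀ (hmodlt X) (hmodlt Y))).seq g₀'
  have s₁ := (d₁.seq (hL N₁ _ _ h₁ (hmodlt X) (hdivlt Y hY))).seq g₁'
  have s₂ := (d₂.seq (hL N₂ _ _ h₂ (hdivlt X hX) (hmodlt Y))).seq g₂'
  have s₃ := (d₃.seq (hL N₃ _ _ h₃ (hdivlt X hX) (hdivlt Y hY))).seq g₃'
  have := ((((s₀.seq s₁).seq s₂).seq s₃).seq (tc.seq t4)).weaken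
    (t' := 4 * t + (72 * v + 24 * (k + 1))) (w' := 4 * n + (24 * v + 24 * (k + 1)))
    (l' := 4 * l + (12 + 12 * (k + 1))) (by omega) (by omega) (by omega)
  simpa only [List.append_assoc] using this

/-! ### Cost functions and the full recursion. -/

/-- A cost of COPSIM on `4 ^ k` processors with `M` words, given the costs `mi` of the
memory-independent mode and `dfs` of a depth-first step without its recursive calls. -/
def recCost (k : ℕ) (mi dfs : ℕ → ℕ) : ℕ → ℕ → ℕ
  | 0, _ => mi 0
  | r + 1, M =>
    if 12 * (2 ^ (r + 1) * 4 ^ k) ≤ M * 2 ^ k then mi (r + 1)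
    else 4 * recCost k mi dfs r (M - 20 * 2 ^ (r + 1)) + dfs (r + 1)

theorem recCost_of_not {k r M : ℕ} {mi dfs : ℕ → ℕ}
    (h : ¬ 12 * (2 ^ (r + 1) * 4 ^ k) ≤ M * 2 ^ k) : recCost k mi dfs (r + 1) M =
      4 * recCost k mi dfs r (M - 20 * 2 ^ (r + 1)) + dfs (r + 1) := if_neg h

/-- Digit operations of COPSIM. -/
def recTime (k : ℕ) : ℕ → ℕ → ℕ :=
  recCost k (fun r => 12 * 4 ^ (r + k) + 36 * 2 ^ (r + k) + 12 * (k * (k + 1)) - 36 * 2 ^ r)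
    fun r => 36 * 2 ^ r + 24 * k

/-- Words exchanged by COPSIM. -/
def recWords (k : ℕ) : ℕ → ℕ → ℕ :=
  recCost k (fun r => 16 * 2 ^ (r + k) + 12 * (k * (k + 1))) fun r => 12 * 2 ^ r + 24 * k

/-- Messages exchanged by COPSIM. -/
def recMsgs (k : ℕ) : ℕ → ℕ → ℕ :=
  recCost k (fun _ => 6 * k ^ 2 + 14 * k) fun _ => 12 + 12 * k

theorem four_pow_eq (k : ℕ) : 4 ^ k = 2 ^ k * 2 ^ k := by rw [← mul_pow]; norm_num

/-- The condition of the memory-independent mode. -/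
theorem mode_iff (k r M : ℕ) :
    12 * (2 ^ r * 4 ^ k) ≤ M * 2 ^ k ↔ 12 * 2 ^ (r + k) ≤ M := by
  rw [four_pow_eq, show 12 * (2 ^ r * (2 ^ k * 2 ^ k)) = 12 * 2 ^ (r + k) * 2 ^ k by ring]
  exact Nat.mul_le_mul_right_iff (by positivity)

/-- COPSIM. -/
theorem tri_copsimRec {s k : ℕ} (hs : 2 ≤ s) : ∀ (r M d : ℕ) (σ : ℕ → ℕ) (m : ℕ → Mem)
    (X Y u K : ℕ), Set.InjOn σ {j | j < 4 ^ k} → (∀ j < 4 ^ k, Clean d (m j) ∧ Bnd (m j) u) →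
    X < s ^ (4 ^ k * 2 ^ r) → Y < s ^ (4 ^ k * 2 ^ r) → u + M ≤ K → 80 * 2 ^ r ≤ M →
    12 * 2 ^ k + 40 * 2 ^ r ≤ M ∨ 12 * 2 ^ (r + k) ≤ M →
    Tri s K σ {j | j < 4 ^ k}
      (fun j => inputs d (m j) (block s (2 ^ r) j X) (block s (2 ^ r) j Y)) (copsimRec k r M σ d)
      (fun j => update (m j) (C d) (block s (2 * 2 ^ r) j (X * Y)))
      (recTime k r M) (recWords k r M) (recMsgs k r M) := by
  intro r
  induction r with
  | zero =>
    intro M d σ m X Y u K hσ hm hX hY hK hM hM'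
    refine tri_copsimMI hs k 0 d σ m X Y u K _ _ _ hσ hm hX hY ?_ ?_ ?_ le_rfl
    -- With one digit per processor both alternatives of `hM'` imply that the memory-independent
    -- mode fits.
    · rw [zero_add] at hM' ⊢; omega
    · simp only [recTime, recCost]; omega
    · simp only [recWords, recCost]; omega
  | succ r ih =>
    intro M d σ m X Y u K hσ hm hX hY hK hM hM'
    by_cases hmode : 12 * (2 ^ (r + 1) * 4 ^ k) ≤ M * 2 ^ k
    · simp only [recTime, recWords, recMsgs, recCost, copsimRec, if_pos hmode]
      rw [mode_iff] at hmode
      exact tri_copsimMI hs k (r + 1) d σ m X Y u K _ _ _ hσ hm hX hY (by omega) (by omega)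
        (by omega) le_rfl
    · have hmode' := hmode
      rw [mode_iff] at hmode'
      have hM1 := hM'.resolve_right hmode'
      have hv : 2 ^ (r + 1) = 2 * 2 ^ r := by rw [pow_succ]; ring
      -- On a single processor the two conditions contradict each other: `hM1` demands `12 + 40 * 2
      -- ^ (r + 1) ≤ M`, whereas `hmode'` says `M < 12 * 2 ^ (r + 1)`.
      obtain _ | k := k
      · simp at hM1 hmode'; omega
      have h4 : 4 ^ (k + 1) = 4 * 4 ^ k := by rw [pow_succ]; ring
      have hq : 4 ^ (k + 1) / 4 = 4 ^ k := by omega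
      have hh : 4 ^ (k + 1) / 2 = 2 * 4 ^ k := by omega
      rw [hv] at hM hM1 hX hY
      have hvpos : 0 < 2 ^ r := by positivity
      set v := 2 ^ r with hvdef
      have hL := ih
      simp only [h4] at hσ hm hX hY hL
      have key := tri_depthFirst (s := s) (k := k) (v := v) (d := d) (K := K) (u := u) (X := X)
        (Y := Y) (t := recTime (k + 1) r (M - 20 * (2 * v)))
        (n := recWords (k + 1) r (M - 20 * (2 * v))) (l := recMsgs (k + 1) r (M - 20 * (2 * v))) hs
        (σ := σ) (m := m)
        (L := copsimRec (k + 1) r (M - 20 * (2 * v))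
          (fun j => if j % 2 = 0 then σ (j / 2) else σ (2 * 4 ^ k + j / 2)) (d + 1))
        hvpos hσ hm hX hY (by omega) (fun N X' Y' hN hX' hY' => ?_)
      · rw [recTime, recWords, recMsgs, recCost_of_not hmode, recCost_of_not hmode,
          recCost_of_not hmode, copsimRec, if_neg hmode]
        simp only [hq, hh, List.append_assoc] at key ⊢
        simp only [hv, h4] at key ⊢
        exact key.weaken (by simp only [recTime]; omega) (by simp only [recWords]; omega)
          (by simp only [recMsgs]; omega)
      · rw [show 4 * 4 ^ k = 2 * (2 * 4 ^ k) by ring] at hσ hN hX' hY' ⊢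
        -- The inverse of `shuffle`, that is, the processor which stores the block `j` of the inputs
        -- of a sub-problem.
        let τ : ℕ → ℕ := fun j => if j % 2 = 0 then j / 2 else 2 * 4 ^ k + j / 2
        have hN' : ∀ j < 2 * (2 * 4 ^ k), τ j < 2 * (2 * 4 ^ k) ∧ shuffle (2 * 4 ^ k) (τ j) = j :=
          fun j hj => by simp only [τ, shuffle]; split_ifs <;> omega
        have hN'' : ∀ j < 2 * (2 * 4 ^ k), τ (shuffle (2 * 4 ^ k) j) = j :=
          fun j hj => by simp only [τ, shuffle]; split_ifs <;> omega
        have hστ : (fun j => if j % 2 = 0 then σ (j / 2) else σ (2 * 4 ^ k + j / 2)) =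
            fun j => σ (τ j) := by funext j; exact (apply_ite σ _ _ _).symm
        rw [show 4 * 4 ^ k = 2 * (2 * 4 ^ k) by ring] at hL
        -- A step gives up `40 * v` words. From `160 * v ≤ M` at least `120 * v` remain, more than
        -- the required `80 * v`; and `12 * 2 ^ (k + 1) + 80 * v ≤ M` turns exactly into the same
        -- inequality for `v` and the reduced memory.
        have := hL (M - 20 * (2 * v)) (d + 1) (fun j => σ (τ j)) (fun j => N (τ j)) X' Y'
          (u + 20 * v) K (fun a ha b hb hab => ?_) (fun j hj => hN _ (hN' j hj).1) hX' hY'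
          (by omega) (by omega) (.inl (by omega))
        · rw [hστ]
          refine Tri.of_shuffle (f' := fun j => inputs (d + 1) (N (τ j)) (block s v j X')
            (block s v j Y')) (g' := fun j => update (N (τ j)) (C (d + 1))
            (block s (2 * v) j (X' * Y'))) (hστ ▸ this) (fun j hj => ?_) fun j hj => ?_
          · simp only [hN'' j hj]
          · simp only [hN'' j hj]
        · have h := hσ (hN' a ha).1 (hN' b hb).1 hab
          rw [← (hN' a ha).2, h, (hN' b hb).2]

/-! ### Solution of the cost recurrences. -/

/-- Unfolding of the recursion: `l` depth-first steps are followed by the memory-independent mode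
for blocks of `2 ^ a` digits. -/
theorem recCost_le {k : ℕ} {mi dfs pot : ℕ → ℕ} (h : ∀ r, dfs (r + 1) + pot (r + 1) ≤ 4 * pot r) :
    ∀ {r M : ℕ}, 80 * 2 ^ r ≤ M → ∃ a l, r = a + l ∧
      recCost k mi dfs r M + pot r ≤ 4 ^ l * (mi a + pot a) ∧
      (l = 0 ∨ M < 12 * 2 ^ (r + k) ∧
          M + 40 * 2 ^ (a + 1) < 12 * 2 ^ (a + 1 + k) + 40 * 2 ^ r) := by
  intro r
  induction r with
  | zero => exact fun _ => ⟨0, 0, rfl, by simp [recCost], .inl rfl⟩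
  | succ r ih =>
    intro M hM
    by_cases hmode : 12 * (2 ^ (r + 1) * 4 ^ k) ≤ M * 2 ^ k
    · exact ⟨r + 1, 0, rfl, by simp [recCost, hmode], .inl rfl⟩
    · have hr : 2 ^ (r + 1) = 2 * 2 ^ r := by rw [pow_succ]; ring
      obtain ⟨a, l, rfl, h1, h2⟩ := @ih (M - 20 * 2 ^ (r + 1)) (by omega)
      rw [recCost_of_not hmode]
      rw [mode_iff, not_le] at hmode
      refine ⟨a, l + 1, by ring, ?_, .inr ⟨hmode, ?_⟩⟩
      -- Four times the potential one level below pays for the step itself and for the potential of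
      -- the present level. In all three applications this holds with equality.
      · have := h (a + l)
        rw [show 4 ^ (l + 1) * (mi a + pot a) = 4 * (4 ^ l * (mi a + pot a)) by ring]
        omega
      -- Either the present step is the last one, and its failed memory test is the claim; or the
      -- released `20 * 2 ^ (r + 1)` words account exactly for the passage from `40 * 2 ^ r` to `40
      -- * 2 ^ (r + 1)`, as in a geometric sum.
      · obtain rfl | ⟨h3, h4⟩ := h2
        · simp only [add_zero] at hmode ⊢; omega
        · omega

theorem sq_add_le_two_pow (k : ℕ) : k * (k + 1) ≤ 2 * 2 ^ k := by
  induction k with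
  | zero => simp
  | succ k ih =>
    rw [pow_succ]
    rcases Nat.lt_or_ge k 2 with h | h
    · interval_cases k <;> simp
    · nlinarith

/-- The constant is 3530 - 768, what the bandwidth bound leaves for the logarithmic terms. The
quotient by `2 ^ k` is largest at `k = 2`, where it is 2256; small cases are checked directly, and
later doubling outgrows the quadratic. -/
theorem quadratic_le_two_pow (k : ℕ) : 576 + 1152 * k ^ 2 + 1920 * k ≤ 2762 * 2 ^ k := by
  induction k with
  | zero => simp
  | succ k ih =>
    rw [pow_succ 2]
    rcases Nat.lt_or_ge k 3 with h | h
    · interval_cases k <;> simp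
    · nlinarith

/-- The potential at the bottom cancels the subtracted `36 * 2 ^ a`. By `sq_add_le_two_pow` the
remaining terms are at most 12 + 36 + 24 + 16 = 88 times `4 ^ (a + k)`, and multiplication by `4 ^
l` gives the exponent `r + k` regardless of the depth. -/
theorem recTime_le {k r M : ℕ} (hM : 80 * 2 ^ r ≤ M) : recTime k r M ≤ 196 * 4 ^ (r + k) := by
  obtain ⟨a, l, rfl, h, -⟩ := recCost_le (k := k)
    (mi := fun r => 12 * 4 ^ (r + k) + 36 * 2 ^ (r + k) + 12 * (k * (k + 1)) - 36 * 2 ^ r)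
    (dfs := fun r => 36 * 2 ^ r + 24 * k) (pot := fun r => 36 * 2 ^ r + 8 * k)
    (fun r => by simp only [pow_succ]; omega) hM
  refine (Nat.le_add_right _ _).trans (h.trans ?_)
  have h1 : 2 ^ a ≤ 2 ^ (a + k) := Nat.pow_le_pow_right (by omega) (by omega)
  have h2 : 2 ^ (a + k) ≤ 4 ^ (a + k) := Nat.pow_le_pow_left (by omega) _
  have h3 : 2 ^ k ≤ 2 ^ (a + k) := Nat.pow_le_pow_right (by omega) (by omega)
  have h4 := sq_add_le_two_pow k
  have h5 : k ≤ k * (k + 1) := Nat.le_mul_of_pos_right _ (by omega)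
  calc _ ≤ 4 ^ l * (196 * 4 ^ (a + k)) := Nat.mul_le_mul_left _ (by omega)
    _ = _ := by ring

/-- The number `2 ^ l` of blocks in terms of the memory. -/
theorem depth_lt {a l k M : ℕ} (hM : 80 * 2 ^ (a + l) ≤ M)
    (h : M + 40 * 2 ^ (a + 1) < 12 * 2 ^ (a + 1 + k) + 40 * 2 ^ (a + l)) :
    2 ^ l * M + 160 * 2 ^ (a + l) < 48 * (2 ^ (a + l) * 2 ^ k) := by
  simp only [pow_add, pow_one] at *
  have hE : 0 < 2 ^ l := by positivity
  -- As `80 * 2 ^ (a + l) ≤ M`, the term `40 * 2 ^ (a + l)` is at most half of `M`. Moving it to the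
  -- left, doubling, and multiplying by `2 ^ l` gives the claim.
  nlinarith

/-- Stated as a product with the memory, so that no division occurs. The main term needs only
`depth_lt`; the terms in `k` are multiplied by `4 ^ l`, and there the hypothesis `24 * 2 ^ k ≤ M`
gains the missing factor `2 ^ k`. -/
theorem recWords_le {k r M : ℕ} (hM : 80 * 2 ^ r ≤ M)
    (hM' : M < 12 * 2 ^ (r + k) → 24 * 2 ^ k ≤ M) :
    min M (12 * 2 ^ (r + k)) * recWords k r M ≤ 3530 * 4 ^ (r + k) := by
  obtain ⟨a, l, rfl, h, h'⟩ := recCost_le (k := k)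
    (mi := fun r => 16 * 2 ^ (r + k) + 12 * (k * (k + 1))) (dfs := fun r => 12 * 2 ^ r + 24 * k)
    (pot := fun r => 12 * 2 ^ r + 8 * k) (fun r => by simp only [pow_succ]; omega) hM
  change recWords k (a + l) M + _ ≤ _ at h
  have h0 := sq_add_le_two_pow k
  obtain rfl | ⟨h1, h2⟩ := h'
  · simp only [add_zero, pow_zero, one_mul] at h ⊢
    have h3 : 2 ^ k ≤ 2 ^ (a + k) := Nat.pow_le_pow_right (by omega) (by omega)
    calc _ ≤ 12 * 2 ^ (a + k) * (40 * 2 ^ (a + k)) :=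
          Nat.mul_le_mul (min_le_right _ _) (by omega)
      _ ≤ _ := by rw [four_pow_eq]; nlinarith [Nat.zero_le (2 ^ (a + k) * 2 ^ (a + k))]
  · have h3 := depth_lt hM h2
    have h4 := hM' h1
    have h5 := quadratic_le_two_pow k
    refine (Nat.mul_le_mul_right _ (min_le_left _ _)).trans ?_
    rw [four_pow_eq]
    rw [four_pow_eq] at h
    simp only [pow_add] at *
    generalize 2 ^ a = A at *
    generalize 2 ^ l = E at *
    generalize 2 ^ k = S at *
    generalize recWords k (a + l) M = W at *
    have e1 : E * M ≤ 48 * (A * E * S) := by omega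
    have e2 : W ≤ E * (16 * (A * E * S) + 12 * (A * E)) + E * E * (12 * k ^ 2 + 20 * k) := by
      nlinarith
    -- One factor `24 * S` is traded for `M`, after which the square of `e1` applies; cancelling it
    -- leaves 48² / 24 = 96.
    have e3 : E * E * M * (24 * S) ≤ 96 * (A * E) ^ 2 * S * (24 * S) := by
      calc _ ≤ E * E * M * M := Nat.mul_le_mul_left _ h4
        _ = (E * M) * (E * M) := by ring
        _ ≤ (48 * (A * E * S)) * (48 * (A * E * S)) := Nat.mul_le_mul e1 e1
        _ = _ := by ring
    have hS : 0 < 24 * S := by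
      rcases Nat.eq_zero_or_pos S with rfl | hS
      · simp at h3
      · omega
    have e4 := Nat.le_of_mul_le_mul_right e3 hS
    -- The constant 3530 arises as 768 + 2762, with 768 = 48 · 16 from the geometric part.
    calc M * W ≤ M * (E * (16 * (A * E * S) + 12 * (A * E)) + E * E * (12 * k ^ 2 + 20 * k)) :=
          Nat.mul_le_mul_left _ e2
      _ = E * M * (16 * (A * E * S) + 12 * (A * E)) + E * E * M * (12 * k ^ 2 + 20 * k) := by ring
      _ ≤ 48 * (A * E * S) * (16 * (A * E * S) + 12 * (A * E)) +
          96 * (A * E) ^ 2 * S * (12 * k ^ 2 + 20 * k) :=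
        Nat.add_le_add (Nat.mul_le_mul_right _ e1) (Nat.mul_le_mul_right _ e4)
      _ = (A * E) ^ 2 * S * (768 * S + (576 + 1152 * k ^ 2 + 1920 * k)) := by ring
      _ ≤ (A * E) ^ 2 * S * (768 * S + 2762 * S) := by gcongr
      _ = _ := by ring

/-- The leading terms are quadratic in `k` on both sides. The constant term 4 of the left side could
not be absorbed for `k = 0`, so it matters that depth-first steps force `k` to be at least 3. -/
theorem recMsgs_le {k r M : ℕ} (hM : 80 * 2 ^ r ≤ M) :
    min M (12 * 2 ^ (r + k)) ^ 2 * recMsgs k r M ≤ 28048 * k ^ 2 * 4 ^ (r + k) := by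
  obtain ⟨a, l, rfl, h, h'⟩ := recCost_le (k := k) (mi := fun _ => 6 * k ^ 2 + 14 * k)
    (dfs := fun _ => 12 + 12 * k) (pot := fun _ => 4 + 4 * k) (fun r => by omega) hM
  change recMsgs k (a + l) M + _ ≤ _ at h
  obtain rfl | hl := Nat.eq_zero_or_pos l
  · simp only [add_zero, pow_zero, one_mul] at h ⊢
    have h3 : k ≤ k ^ 2 := Nat.le_self_pow (by omega) k
    calc _ ≤ (12 * 2 ^ (a + k)) ^ 2 * (20 * k ^ 2) :=
          Nat.mul_le_mul (Nat.pow_le_pow_left (min_le_right _ _) 2) (by omega)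
      _ = 2880 * (k ^ 2 * (2 ^ (a + k) * 2 ^ (a + k))) := by ring
      _ ≤ _ := by rw [four_pow_eq]; nlinarith [Nat.zero_le (k ^ 2 * (2 ^ (a + k) * 2 ^ (a + k)))]
  · have h3 := depth_lt hM (h'.resolve_left hl.ne').2
    have hl : 2 ≤ 2 ^ l := Nat.le_self_pow hl.ne' 2
    have hN : 0 < 2 ^ (a + l) := by positivity
    -- With `2 ≤ 2 ^ l` and `80 * 2 ^ (a + l) ≤ M`, the bound of `depth_lt` gives 320 < 48 · 2^k,
    -- which excludes `2 ^ k ≤ 4`.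
    have hk : 3 ≤ k := by
      by_contra hk
      have h4 : 2 ^ k ≤ 4 := by interval_cases k <;> simp
      nlinarith
    have key : (2 ^ l * M) ^ 2 * (6 * k ^ 2 + 18 * k + 4) ≤
        28048 * k ^ 2 * (2 ^ (a + l) * 2 ^ k) ^ 2 := by
      -- For `k = 3` the constant is missed if the summand 160 of `depth_lt` is dropped; keeping it
      -- replaces 48 · 8 = 384 by 224. From `k = 4` on the simpler bound suffices.
      obtain rfl | hk4 := eq_or_lt_of_le hk
      · have : 2 ^ l * M ≤ 224 * 2 ^ (a + l) := by omega
        calc _ ≤ (224 * 2 ^ (a + l)) ^ 2 * (6 * 3 ^ 2 + 18 * 3 + 4) := by gcongr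
          _ ≤ _ := by ring_nf; omega
      · have : 2 ^ l * M ≤ 48 * (2 ^ (a + l) * 2 ^ k) := by omega
        calc _ ≤ (48 * (2 ^ (a + l) * 2 ^ k)) ^ 2 * (6 * k ^ 2 + 18 * k + 4) := by gcongr
          _ = 2304 * (6 * k ^ 2 + 18 * k + 4) * (2 ^ (a + l) * 2 ^ k) ^ 2 := by ring
          _ ≤ _ := by
            apply Nat.mul_le_mul_right
            nlinarith
    calc _ ≤ M ^ 2 * (4 ^ l * (6 * k ^ 2 + 18 * k + 4)) :=
          Nat.mul_le_mul (Nat.pow_le_pow_left (min_le_left _ _) 2) (by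
            rw [show 6 * k ^ 2 + 14 * k + (4 + 4 * k) = 6 * k ^ 2 + 18 * k + 4 by ring] at h
            omega)
      _ = (2 ^ l * M) ^ 2 * (6 * k ^ 2 + 18 * k + 4) := by rw [four_pow_eq]; ring
      _ ≤ _ := key
      _ = _ := by rw [four_pow_eq]; ring

end Copsim

/-! ### Translation into real quantities and the final estimate. -/

theorem mainTheorem3 (s n P M a b : ℕ) (hs : 2 ≤ s)
    (hn : ∃ e : ℕ, n = 2 ^ e) (hP : ∃ k : ℕ, P = 4 ^ k) (hPn : P ≤ n)
    (ha : a < s ^ n) (hb : b < s ^ n)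
    (hM : max (80 * (n : ℝ) / P) (Real.logb 2 P) ≤ M)
    (hM' : (M : ℝ) < 12 * n / Real.sqrt P → 24 * Real.sqrt P ≤ M) :
    let prog : List Copsim.Instr := Copsim.copsim n P M
    let start : Copsim.Config := Copsim.initial s (n / P) P a b
    let final : Copsim.Config := Copsim.run s prog start
    let M₀ : ℝ := min (M : ℝ) (12 * n / Real.sqrt P)
    Copsim.Executable s P M prog start ∧
    Copsim.Partitioned s (2 * (n / P)) P (Copsim.Var.C 0) (a * b) final ∧
    (Copsim.compTime P final : ℝ) ≤ 196 * (n : ℝ) ^ 2 / P ∧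
    (Copsim.bandwidth P final : ℝ) ≤ 3530 * (n : ℝ) ^ 2 / (M₀ * P) ∧
    (Copsim.latency P final : ℝ) ≤
      7012 * ((n : ℝ) ^ 2 * Real.logb 2 P ^ 2) / (M₀ ^ 2 * P) := by
  obtain ⟨e, rfl⟩ := hn
  obtain ⟨k, rfl⟩ := hP
  have h24 : ∀ i : ℕ, 4 ^ i = 2 ^ (2 * i) := fun i => by rw [pow_mul]; norm_num
  obtain ⟨r, rfl⟩ := Nat.exists_eq_add_of_le
      ((Nat.pow_le_pow_iff_right (by norm_num)).1 (h24 k ▸ hPn))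
  have hnP : 2 ^ (2 * k + r) = 4 ^ k * 2 ^ r := by rw [pow_add, h24]
  have hdiv : 2 ^ (2 * k + r) / 4 ^ k = 2 ^ r := by
    rw [hnP, Nat.mul_div_cancel_left _ (by positivity)]
  have hnR : ((2 ^ (2 * k + r) : ℕ) : ℝ) = 4 ^ k * 2 ^ r := by rw [hnP]; push_cast; ring
  have hPR : ((4 ^ k : ℕ) : ℝ) = 2 ^ k * 2 ^ k := by push_cast; rw [← mul_pow]; norm_num
  have hsqrt : Real.sqrt ((4 ^ k : ℕ) : ℝ) = 2 ^ k := by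
    rw [hPR]; exact Real.sqrt_mul_self (by positivity)
  have hlog : Real.logb 2 ((4 ^ k : ℕ) : ℝ) = 2 * k := by
    rw [h24, Nat.cast_pow, Nat.cast_ofNat, Real.logb_pow, Real.logb_self_eq_one (by norm_num)]
    push_cast; ring
  have h4R : (4 : ℝ) ^ k = 2 ^ k * 2 ^ k := by rw [← mul_pow]; norm_num
  have hthr : 12 * ((2 ^ (2 * k + r) : ℕ) : ℝ) / 2 ^ k = ((12 * 2 ^ (r + k) : ℕ) : ℝ) := by
    rw [hnR, h4R]; push_cast; field_simp; ring
  have hM1 : 80 * 2 ^ r ≤ M := by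
    have h := (le_max_left _ _).trans hM
    rw [hnR, hPR, h4R] at h
    have : 80 * (2 ^ k * 2 ^ k * 2 ^ r) / (2 ^ k * 2 ^ k : ℝ) = ((80 * 2 ^ r : ℕ) : ℝ) := by
      push_cast; field_simp
    rw [this] at h
    exact_mod_cast h
  have hM2 : M < 12 * 2 ^ (r + k) → 24 * 2 ^ k ≤ M := fun h => by
    have := hM' (by rw [hsqrt, hthr]; exact_mod_cast h)
    rw [hsqrt] at this
    exact_mod_cast this
  intro prog start final M₀
  have hM0 : M₀ = ((min M (12 * 2 ^ (r + k)) : ℕ) : ℝ) := by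
    simp only [M₀, hsqrt, hthr, Nat.cast_min]
  have hM0pos : 0 < M₀ := by
    have h1 : 0 < 2 ^ r := by positivity
    have h2 : 0 < 2 ^ (r + k) := by positivity
    rw [hM0]
    exact_mod_cast lt_min (by omega) (by omega)
  have hprog : prog = Copsim.copsimRec k r M (fun j => j) 0 := by
    simp only [prog, Copsim.copsim, hdiv, Nat.log_pow (show 1 < 4 by norm_num),
      Nat.log_pow (show 1 < 2 by norm_num)]
  have hstart : Copsim.Holds (fun j => j) {j | j < 4 ^ k}
      (fun j => Copsim.inputs 0 (fun _ => []) (Copsim.block s (2 ^ r) j a)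
        (Copsim.block s (2 ^ r) j b)) 0 0 0 start := by
    intro j hj
    have hj : j < 4 ^ k := hj
    refine ⟨?_, le_rfl, le_rfl, le_rfl⟩
    funext x
    simp only [start, Copsim.initial, hdiv, hj, true_and, Copsim.inputs, Function.update_apply]
    split_ifs <;> simp_all
  have key := Copsim.tri_copsimRec (k := k) hs r M 0 (fun j => j) (fun _ _ => []) a b 0 M
    (fun _ _ _ _ h => h) (fun j _ => ⟨fun _ _ => rfl, fun F => by simp⟩) (by rwa [← hnP])
    (by rwa [← hnP]) (by omega) hM1 (by
      rcases Nat.lt_or_ge M (12 * 2 ^ (r + k)) with h | h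
      -- Half of each lower bound on the memory, `24 * 2 ^ k ≤ M` and `80 * 2 ^ r ≤ M`, gives the
      -- invariant of the recursion.
      · have := hM2 h
        exact .inl (by omega)
      · exact .inr h)
  rw [← hprog] at key
  obtain ⟨hfin, hsafe⟩ := key.2 start 0 0 0 hstart
  simp only [zero_add] at hfin
  have hsup : ∀ (f : ℕ → ℕ) (B : ℕ), (∀ j < 4 ^ k, f j ≤ B) → (Finset.range (4 ^ k)).sup f ≤ B :=
    fun f B h => Finset.sup_le fun j hj => h j (Finset.mem_range.1 hj)
  have hT : Copsim.compTime (4 ^ k) final ≤ 196 * 4 ^ (r + k) :=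
    (hsup _ _ fun j hj => (hfin j hj).2.1).trans (Copsim.recTime_le hM1)
  have hW : min M (12 * 2 ^ (r + k)) * Copsim.bandwidth (4 ^ k) final ≤ 3530 * 4 ^ (r + k) :=
    (Nat.mul_le_mul_left _ (hsup _ _ fun j hj => (hfin j hj).2.2.1)).trans
      (Copsim.recWords_le hM1 hM2)
  have hL : min M (12 * 2 ^ (r + k)) ^ 2 * Copsim.latency (4 ^ k) final ≤
      28048 * k ^ 2 * 4 ^ (r + k) :=
    (Nat.mul_le_mul_left _ (hsup _ _ fun j hj => (hfin j hj).2.2.2)).trans (Copsim.recMsgs_le hM1)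
  -- In other words, n²/P = 4^(r+k), the common right-hand factor of the three integer estimates.
  have hsq : ((2 ^ (2 * k + r) : ℕ) : ℝ) ^ 2 = ((4 ^ (r + k) : ℕ) : ℝ) * ((4 ^ k : ℕ) : ℝ) := by
    exact_mod_cast show (2 ^ (2 * k + r)) ^ 2 = 4 ^ (r + k) * 4 ^ k by
      rw [h24, h24, ← pow_mul, ← pow_add]; congr 1; ring
  have hPpos : (0 : ℝ) < ((4 ^ k : ℕ) : ℝ) := by positivity
  refine ⟨?_, ?_, ?_, ?_, ?_⟩
  · exact Copsim.executable_of_safe (by simpa using key.1) hsafe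
  · intro j hj
    rw [hdiv]
    simpa using congrFun (hfin j hj).1 (Copsim.Var.C 0)
  · rw [hsq, ← mul_assoc, mul_div_cancel_right₀ _ hPpos.ne']
    exact_mod_cast hT
  · rw [hsq, ← mul_assoc, mul_div_mul_right _ _ hPpos.ne', le_div_iff₀ hM0pos, mul_comm, hM0]
    exact_mod_cast hW
  -- The logarithm of P to base 2 is 2k, whence 28048 = 4 · 7012.
  · rw [hsq, hlog, le_div_iff₀ (by positivity), hM0]
    have h : ((min M (12 * 2 ^ (r + k)) : ℕ) : ℝ) ^ 2 * (Copsim.latency (4 ^ k) final : ℝ) ≤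
      28048 * (k : ℝ) ^ 2 * ((4 ^ (r + k) : ℕ) : ℝ) := by exact_mod_cast hL
    calc _ = ((min M (12 * 2 ^ (r + k)) : ℕ) : ℝ) ^ 2 * (Copsim.latency (4 ^ k) final : ℝ) *
          ((4 ^ k : ℕ) : ℝ) := by ring
      _ ≤ 28048 * (k : ℝ) ^ 2 * ((4 ^ (r + k) : ℕ) : ℝ) * ((4 ^ k : ℕ) : ℝ) := by gcongr
      _ = _ := by ring
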